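/- Let $p\in[0,1]$ and $\alpha=\frac{\arccos p}{2\pi}$. Let $\mathbb R_+=[0,\infty)\subset\mathbb C$, and for $z\in\mathbb C\setminus\mathbb R_+$ let $\log z=\log r+i\theta$, where $z=re^{i\theta}$, $r>0$, $0<\theta<2\pi$ (the branch which is real on the upper side of $\mathbb R_+$), and $z^s=e^{s\log z}$ for $s\in\mathbb R$. A region $\Omega$ is said to solve the killing-passing-reflecting Hele-Shaw problem with parameter $p$ if the following holds. (a) $\Omega$ is a bounded connected open set containing $0$, and there are $0<a<b$ such that $\partial\Omega$ is a Jordan curve consisting of the interval $[a,b]$ of the positive half-axis (with $\Omega$ above it) and a simple curve $\Gamma$, which is regular of class $C^1$ away from its endpoints, goes counterclockwise from $b$ to $a$ around the origin (with $\Omega$ on its left), and meets $\mathbb R_+$ only at its endpoints. (b) There is a harmonic function $\Phi:\Omega\setminus\mathbb R_+\to\mathbb R$ (the potential) which extends continuously to $\Gamma$ and to each side of $\mathbb R_+$, except at $0$, and whose first derivatives also extend continuously there, except at $0,a,b$; which satisfies the boundary conditions $$\Phi=0\text{ on }\Gamma;\qquad (\Phi_y)_+=0\text{ on }(a,b);\qquad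 \Phi_-=0\text{ on }(0,a];\qquad (\Phi_y)_+=p\,(\Phi_y)_-\text{ on }(0,a),$$ where $\Phi_y$ is the derivative with respect to $y$ and $+,-$ denote the limits from above and from below; and which has a source at the origin, i.e., for some $\kappa>0$, as $z=re^{i\theta}\to0$, $0<\theta<2\pi$, $$\Phi=-\kappa\, r^{-\alpha}\sin(\alpha(2\pi-\theta))+o(r^{-\alpha})\ \text{ if }p<1,\qquad \Phi=-\kappa\,(2\pi-\theta)\log\tfrac1r+o(\log\tfrac1r)\ \text{ if }p=1.$$ (c) The infinitesimal deformation of $\Gamma$ with normal velocity $\partial\Phi/\partial\mathbf n$ ($\mathbf n$ the outward unit normal) is homothetic: for some $c>0$, $\frac{\partial\Phi}{\partial\mathbf n}(z)=c\,\mathrm{Re}(\bar z\,\mathbf n)$ for all $z\in\Gamma$ other than the endpoints. **Proposition.** (i) If $\Omega$ solves the problem with parameter $p$, then for all integers $n\ge1$ the following integrals converge absolutely and $$\int_\Omega\mathrm{Re}(z^{n+\alpha})\,dx\,dy=0,\qquad \int_\Omega\mathrm{Re}(z^{n-\alpha})\,dx\,dy=0;$$ moreover $0\le\alpha\le\frac14$.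 (ii) If $p=1$ (so $\alpha=0$), then for all integers $n\ge1$ the following integrals converge absolutely and $$\int_\Omega\mathrm{Re}(z^n)\,dx\,dy=0,\qquad \int_\Omega\mathrm{Re}(z^n\log z)\,dx\,dy=0.$$ -/

import Mathlib

open Set Filter Topology MeasureTheory Asymptotics

noncomputable section

namespace HeleShaw

/-- The closed positive half-axis `ℝ₊ = [0, ∞)` in the complex plane. -/
def posAxis : Set ℂ := {z | 0 ≤ z.re ∧ z.im = 0}

/-- The open upper half-plane. -/
def upper : Set ℂ := {z | 0 < z.im}

/-- The open lower half-plane. -/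
def lower : Set ℂ := {z | z.im < 0}

/-- The continuous branch of `log` on `ℂ ∖ ℝ₊` whose limits from above on the positive half-axis
are real: `log (r e^{iθ}) = log r + iθ` for `r > 0`, `0 < θ < 2π`. -/
def logBranch (z : ℂ) : ℂ := Complex.log (-z) + Real.pi * Complex.I

/-- The argument `θ ∈ (0, 2π)` on `ℂ ∖ ℝ₊`. -/
def angle (z : ℂ) : ℝ := (logBranch z).im

/-- The branch `z ^ s = exp (s log z)` on `ℂ ∖ ℝ₊`. -/
def branchPow (z : ℂ) (s : ℝ) : ℂ := Complex.exp (s * logBranch z)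

/-- `α = arccos p / 2π`. -/
def alpha (p : ℝ) : ℝ := Real.arccos p / (2 * Real.pi)

/-- `Ω` is a bounded region containing the origin, whose boundary is a Jordan curve that consists
of the interval `[a, b]` of the positive half-axis and of the curve `Γ`, parametrized by `γ` on
`[0, 1]`, which goes counterclockwise from `b` to `a` around the origin and meets the positive
half-axis only at its endpoints; `Γ` is a regular `C¹` curve away from its endpoints. -/
structure IsRegion (Ω : Set ℂ) (a b : ℝ) (γ : ℝ → ℂ) : Prop where
  isOpen : IsOpen Ω
  isConnected : IsConnected Ω
  isBounded : Bornology.IsBounded Ω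
  zero_mem : (0 : ℂ) ∈ Ω
  a_pos : 0 < a
  a_lt_b : a < b
  continuousOn : ContinuousOn γ (Icc 0 1)
  injOn : InjOn γ (Icc 0 1)
  start : γ 0 = (b : ℂ)
  finish : γ 1 = (a : ℂ)
  contDiffOn : ContDiffOn ℝ 1 γ (Ioo 0 1)
  deriv_ne_zero : ∀ t ∈ Ioo (0 : ℝ) 1, deriv γ t ≠ 0
  not_mem_posAxis : ∀ t ∈ Ioo (0 : ℝ) 1, γ t ∉ posAxis
  frontier_eq : frontier Ω = γ '' Icc 0 1 ∪ (fun x : ℝ => (x : ℂ)) '' Icc a b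
  /-- Counterclockwise: `Ω` lies on the left of `Γ`, and not on its right. -/
  left_of_curve : ∀ t ∈ Ioo (0 : ℝ) 1, ∀ᶠ s : ℝ in 𝓝[>] 0,
    γ t + s * (Complex.I * deriv γ t) ∈ Ω ∧ γ t - s * (Complex.I * deriv γ t) ∉ Ω
  /-- Along `(a, b)` the region `Ω` lies above the axis, and not below it. -/
  above_interval : ∀ x ∈ Ioo a b, ∀ᶠ s : ℝ in 𝓝[>] 0,
    (x : ℂ) + s * Complex.I ∈ Ω ∧ (x : ℂ) - s * Complex.I ∉ Ω

/-- The outward unit normal to `Γ` at the point `γ t`. -/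
def outwardNormal (γ : ℝ → ℂ) (t : ℝ) : ℂ := -Complex.I * (deriv γ t / ‖deriv γ t‖)

/-- The potential of a source at the origin of the whole plane, with the killing-passing-reflecting
condition on the whole positive half-axis, up to sign and a positive factor: it is harmonic and
positive near the origin of `ℂ ∖ ℝ₊`, vanishes on the lower side of the half-axis, and its
`y`-derivative on the upper side is `p` times that on the lower side.
For `p = 0` it is `Re (z ^ (-1/4))`. -/
def sourceProfile (p : ℝ) (z : ℂ) : ℝ :=
  if p < 1 then ‖z‖ ^ (-alpha p) * Real.sin (alpha p * (2 * Real.pi - angle z))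
  else Real.log (1 / ‖z‖) * (2 * Real.pi - angle z)

/-- The order of magnitude of `sourceProfile p` near the origin. -/
def sourceSize (p : ℝ) (z : ℂ) : ℝ :=
  if p < 1 then ‖z‖ ^ (-alpha p) else Real.log (1 / ‖z‖)

/-- `Φ` is a potential in `Ω` with a source at the origin and with the
killing-passing-reflecting condition with parameter `p` on the positive half-axis.
Boundary values of `Φ` and of its differential are limits from inside `Ω ∖ ℝ₊`, taken from
above or from below on the half-axis. Evaluating the differential at `Complex.I` gives `Φ_y`.
The differential need not have limits at the points `0`, `a`, `b`. -/
structure IsPotential (p : ℝ) (Ω : Set ℂ) (a b : ℝ) (γ : ℝ → ℂ) (Φ : ℂ → ℝ) : Prop where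
  harmonic : InnerProductSpace.HarmonicOnNhd Φ (Ω \ posAxis)
  /-- `Φ ∼ -κ sourceProfile` near the origin, with `κ > 0`. -/
  source : ∃ κ : ℝ, 0 < κ ∧
    (fun z => Φ z + κ * sourceProfile p z) =o[𝓝[Ω \ posAxis] 0] sourceSize p
  /-- `Φ = 0` on `Γ` (for its endpoint `a` see the next two fields). -/
  curve_zero : ∀ t ∈ Ico (0 : ℝ) 1, Tendsto Φ (𝓝[Ω \ posAxis] (γ t)) (𝓝 0)
  /-- `Φ₋ = 0` on `(0, a]`. -/
  lower_zero : ∀ x ∈ Ioc 0 a, Tendsto Φ (𝓝[Ω ∩ lower] (x : ℂ)) (𝓝 0)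
  /-- `Φ₊` exists on `(0, b)`. -/
  upper_cont : ∀ x ∈ Ioo 0 b, ∃ v : ℝ, Tendsto Φ (𝓝[Ω ∩ upper] (x : ℂ)) (𝓝 v)
  /-- The differential of `Φ` extends continuously to `Γ`. -/
  curve_diff : ∀ t ∈ Ioo (0 : ℝ) 1, ∃ L : ℂ →L[ℝ] ℝ,
    Tendsto (fderiv ℝ Φ) (𝓝[Ω \ posAxis] (γ t)) (𝓝 L)
  /-- `(Φ_y)₊ = 0` on `(a, b)`. -/
  reflecting : ∀ x ∈ Ioo a b, ∃ L : ℂ →L[ℝ] ℝ,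
    Tendsto (fderiv ℝ Φ) (𝓝[Ω ∩ upper] (x : ℂ)) (𝓝 L) ∧ L Complex.I = 0
  /-- `(Φ_y)₊ = p (Φ_y)₋` on `(0, a)`. -/
  passing : ∀ x ∈ Ioo 0 a, ∃ Lp Lm : ℂ →L[ℝ] ℝ,
    Tendsto (fderiv ℝ Φ) (𝓝[Ω ∩ upper] (x : ℂ)) (𝓝 Lp) ∧
    Tendsto (fderiv ℝ Φ) (𝓝[Ω ∩ lower] (x : ℂ)) (𝓝 Lm) ∧
    Lp Complex.I = p * Lm Complex.I

/-- `Γ`, moving with normal velocity `∂Φ/∂n`, is transformed homothetically: for some `c > 0`,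
`∂Φ/∂n` is on `Γ` the normal component of the velocity field `z ↦ c z` of the dilations. -/
def IsHomothetic (Ω : Set ℂ) (γ : ℝ → ℂ) (Φ : ℂ → ℝ) : Prop :=
  ∃ c : ℝ, 0 < c ∧ ∀ t ∈ Ioo (0 : ℝ) 1,
    Tendsto (fun z => fderiv ℝ Φ z (outwardNormal γ t)) (𝓝[Ω \ posAxis] (γ t))
      (𝓝 (c * inner ℝ (γ t) (outwardNormal γ t)))

/-- `Ω` solves the Hele-Shaw problem with the killing-passing-reflecting condition with
parameter `p` on the positive half-axis. -/
def IsSolution (p : ℝ) (Ω : Set ℂ) : Prop :=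
  ∃ (a b : ℝ) (γ : ℝ → ℂ) (Φ : ℂ → ℝ),
    IsRegion Ω a b γ ∧ IsPotential p Ω a b γ Φ ∧ IsHomothetic Ω γ Φ

end HeleShaw

end

/-! Let `u = Re f` be harmonic on the slit plane and satisfy the conditions adjoint to those of the
potential: `u_y = 0` on the upper side of `ℝ₊`, and the value of `u` below is `p` times its value
above. The field `V = Φ ∇u - u (∇Φ - c z)` then has no net flux through the boundary. On `Γ`, `Φ =
0`, and homothety says that `∇Φ - c z` is tangential. On the upper side of `(a, b)`, `Φ_y`, `u_y`
and `y` all vanish. On `(0, a)` the vertical component of `V` is `-u₊ (Φ_y)₊ = -p u₊ (Φ_y)₋` above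
and `-u₋ (Φ_y)₋`, the same number, below. As `div V = c (z · ∇u + 2u)`, the divergence theorem gives
`∫ (z · ∇u + 2u) = 0` (`integral_test_eq_zero`).

For `f = z ^ s` the condition is `cos 2πs = p`, which `s = n ± α` satisfies, and the integrand is
`(s + 2) u`. For `p = 1`, `f = z ^ n log z` also qualifies; the integrand is `(n + 2) u + Re z ^ n`,
whose last term has integral zero by the previous case.

Two points need work. First, nothing is assumed about `∇Φ` at `0`, `a`, `b`. The test function is
multiplied by `cut (w / L)`, where `w` is the sum of the logarithms of the distances to these three
points. This `w` is harmonic and symmetric about the real axis, so the boundary conditions survive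
the cutoff and `div V` contains `Φ` but not its derivatives. The term with `cut''` has integral `O(1
/ L)`, because `|∇w|²` integrates to `O(L)` where the cutoff is not zero while its factor is `L⁻²`;
the remaining terms converge dominatedly as `L → ∞`, by `Φ = O(r^(-1/3))`, `f = O(r^(1/2))` and `f'
= O(r^(-1/2))`.

Second, the divergence theorem itself (`IsSealedField.integral_eq_zero`). Near a boundary point
where `Ω` lies on one side, it is `{s > 0}` for a `C¹` function `s` (`IsRegion.exists_chart` on
`Γ`). Multiplying the field by `step (N s)` makes it compactly supported; the error lives in a strip
of area `O(1 / N)`, where it is `N` times a quantity that tends to zero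
(`setIntegral_planeDiv_eq_zero`). Near `(0, a)` the lower half-disc is first folded onto the upper
one by conjugation. A partition of unity glues the pieces. -/

noncomputable section

/-! ### Divergence theorem on `{s > 0}` by cutting off near `{s = 0}`. -/

namespace HeleShaw

/-- The divergence of the planar vector field `(P, Q)`. -/
def planeDiv (P Q : ℂ → ℝ) (z : ℂ) : ℝ := fderiv ℝ P z 1 + fderiv ℝ Q z Complex.I

/-- Integration by parts against the constant function `1`. -/
theorem integral_fderiv_apply_eq_zero {P : ℂ → ℝ} (hP : ContDiff ℝ 1 P) (cP : HasCompactSupport P)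
    (v : ℂ) : Integrable (fun z => fderiv ℝ P z v) ∧ ∫ z, fderiv ℝ P z v = 0 := by
  have hc : Continuous (fun z => fderiv ℝ P z v) :=
    (hP.continuous_fderiv one_ne_zero).clm_apply continuous_const
  have hs : HasCompactSupport (fun z => fderiv ℝ P z v) := cP.fderiv_apply ℝ v
  have hi := hc.integrable_of_hasCompactSupport (μ := volume) hs
  refine ⟨hi, ?_⟩
  have h := integral_mul_fderiv_eq_neg_fderiv_mul_of_integrable (μ := (volume : Measure ℂ))
    (f := fun _ : ℂ => (1 : ℝ)) (g := P) (v := v) (by simp) (by simpa using hi)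
    (by simpa using hP.continuous.integrable_of_hasCompactSupport cP) (by fun_prop)
    (fun x _ => hP.differentiable one_ne_zero x)
  simpa using h

theorem integral_planeDiv_eq_zero {P Q : ℂ → ℝ} (hP : ContDiff ℝ 1 P) (hQ : ContDiff ℝ 1 Q)
    (cP : HasCompactSupport P) (cQ : HasCompactSupport Q) : ∫ z, planeDiv P Q z = 0 := by
  have h1 := integral_fderiv_apply_eq_zero hP cP 1
  have h2 := integral_fderiv_apply_eq_zero hQ cQ Complex.I
  simp only [planeDiv]
  rw [integral_add h1.1 h2.1, h1.2, h2.2, add_zero]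

/-- The transition is constant outside `[0, 1]`, so both derivatives are continuous with compact
support. One constant serves both cutoffs, `step` and `cut`, which are translates of this function.
-/
theorem exists_bound_deriv_smoothTransition :
    ∃ M : ℝ, 0 ≤ M ∧ ∀ t : ℝ, |deriv Real.smoothTransition t| ≤ M ∧
      |deriv (deriv Real.smoothTransition) t| ≤ M := by
  have hcd : ContDiff ℝ 2 Real.smoothTransition := Real.smoothTransition.contDiff
  have hcd1 : ContDiff ℝ 1 (deriv Real.smoothTransition) :=
    ((contDiff_succ_iff_deriv (n := 1)).1 hcd).2.2
  have hcd0 : Continuous (deriv (deriv Real.smoothTransition)) := hcd1.continuous_deriv le_rfl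
  have hs : HasCompactSupport (deriv Real.smoothTransition) := by
    refine HasCompactSupport.intro (isCompact_Icc (a := (0 : ℝ)) (b := 1)) fun t ht => ?_
    rw [mem_Icc, not_and_or, not_le, not_le] at ht
    rcases ht with ht | ht
    · have : Real.smoothTransition =ᶠ[𝓝 t] fun _ => 0 := by
        filter_upwards [Iio_mem_nhds ht] with x hx
        exact Real.smoothTransition.zero_of_nonpos (le_of_lt hx)
      rw [this.deriv_eq, deriv_const]
    · have : Real.smoothTransition =ᶠ[𝓝 t] fun _ => 1 := by
        filter_upwards [Ioi_mem_nhds ht] with x hx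
        exact Real.smoothTransition.one_of_one_le (le_of_lt hx)
      rw [this.deriv_eq, deriv_const]
  obtain ⟨C1, h1⟩ := hcd1.continuous.bounded_above_of_compact_support hs
  obtain ⟨C2, h2⟩ := hcd0.bounded_above_of_compact_support hs.deriv
  exact ⟨max C1 C2, le_max_of_le_left ((norm_nonneg _).trans (h1 0)), fun t =>
    ⟨(h1 t).trans (le_max_left _ _), (h2 t).trans (le_max_right _ _)⟩⟩

/-- A smooth step, `0` for `t ≤ 1` and `1` for `t ≥ 2`. -/
def step (t : ℝ) : ℝ := Real.smoothTransition (t - 1)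

theorem step_contDiff : ContDiff ℝ 1 step :=
  Real.smoothTransition.contDiff.comp (contDiff_id.sub contDiff_const)

theorem step_eq_zero {t : ℝ} (h : t ≤ 1) : step t = 0 :=
  Real.smoothTransition.zero_of_nonpos (by linarith)

theorem step_eq_one {t : ℝ} (h : 2 ≤ t) : step t = 1 :=
  Real.smoothTransition.one_of_one_le (by linarith)

theorem abs_step_le (t : ℝ) : |step t| ≤ 1 := by
  rw [step, abs_of_nonneg (Real.smoothTransition.nonneg _)]
  exact Real.smoothTransition.le_one _

theorem deriv_step (t : ℝ) : deriv step t = deriv Real.smoothTransition (t - 1) := by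
  unfold step
  exact deriv_comp_sub_const ..

theorem deriv_step_eq_zero {t : ℝ} (h : 2 < t) : deriv step t = 0 := by
  have : step =ᶠ[𝓝 t] fun _ => 1 := by
    filter_upwards [Ioi_mem_nhds h] with x hx
    exact step_eq_one (le_of_lt hx)
  rw [this.deriv_eq, deriv_const]

/-- If `f → 0` at the points of a compact set where `s = 0`, from inside `{s > 0}`, then `f` is
uniformly small where `s` is small. -/
theorem exists_uniform_small {D K : Set ℂ} {s f : ℂ → ℝ} (hs : ContinuousOn s D) (hK : IsCompact K)
    (hKD : K ⊆ D)
    (hlim : ∀ q ∈ K, s q = 0 → Tendsto f (𝓝[D ∩ {z | 0 < s z}] q) (𝓝 0)) {δ : ℝ} (hδ : 0 < δ) :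
    ∃ ε > 0, ∀ z ∈ K, 0 < s z → s z < ε → |f z| < δ := by
  -- Otherwise points of `K` with `0 < s < 1 / (n + 1)` and `|f| ≥ δ` accumulate at a point of `K`
  -- where `s = 0`, against the pointwise limit there.
  by_contra! hcon
  choose! x hxK hx0 hx1 hxf using hcon
  let u : ℕ → ℂ := fun n => x (1 / ((n : ℝ) + 1))
  have hpos : ∀ n : ℕ, (0 : ℝ) < 1 / ((n : ℝ) + 1) := fun n => by positivity
  obtain ⟨q, hqK, φ, hφ, hq⟩ := hK.tendsto_subseq (x := u) fun n => hxK _ (hpos n)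
  have hsq : Tendsto (fun n => s (u (φ n))) atTop (𝓝 (s q)) := by
    have : ContinuousWithinAt s K q := (hs.mono hKD) q hqK
    exact this.tendsto.comp (tendsto_nhdsWithin_iff.2 ⟨hq, .of_forall fun n => hxK _ (hpos _)⟩)
  have hs0 : Tendsto (fun n => s (u (φ n))) atTop (𝓝 0) := by
    refine squeeze_zero (fun n => (hx0 _ (hpos _)).le) (fun n => (hx1 _ (hpos (φ n))).le) ?_
    exact tendsto_one_div_add_atTop_nhds_zero_nat.comp hφ.tendsto_atTop
  have hq0 : s q = 0 := tendsto_nhds_unique hsq hs0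
  have hf : Tendsto (fun n => f (u (φ n))) atTop (𝓝 0) :=
    (hlim q hqK hq0).comp (tendsto_nhdsWithin_iff.2
      ⟨hq, .of_forall fun n => ⟨hKD (hxK _ (hpos _)), hx0 _ (hpos _)⟩⟩)
  obtain ⟨n, hn⟩ := (hf.abs.eventually (gt_mem_nhds (show |(0 : ℝ)| < δ by simpa using hδ))).exists
  exact absurd hn (not_lt.2 (hxf _ (hpos _)))

/-- A field supported in `K` and cut off near `{s = 0}` vanishes near the points outside of
`{s > 0}`. -/
theorem indicator_cutoff_eventuallyEq_zero {D K : Set ℂ} {s P : ℂ → ℝ} (hD : IsOpen D)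
    (hs : ContDiffOn ℝ 1 s D) (hK : IsCompact K) (hKD : K ⊆ D)
    (hP0 : ∀ z ∈ D ∩ {z | 0 < s z}, z ∉ K → P z = 0) {N : ℝ} (hN : 0 < N) {z : ℂ}
    (hz : z ∉ D ∩ {z | 0 < s z}) :
    ((D ∩ {z | 0 < s z}).indicator fun z => step (N * s z) * P z) =ᶠ[𝓝 z] fun _ => 0 := by
  classical
  by_cases hzK : z ∈ K
  · have hzD := hKD hzK
    have hsz : s z < 1 / N := by
      have : ¬ 0 < s z := fun h => hz ⟨hzD, h⟩
      exact (not_lt.1 this).trans_lt (by positivity)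
    filter_upwards [(hs.continuousOn.continuousAt (hD.mem_nhds hzD)).eventually
      (gt_mem_nhds hsz)] with w hw
    rw [indicator_apply]
    split_ifs
    · rw [step_eq_zero, zero_mul]
      rw [lt_div_iff₀ hN] at hw
      linarith
    · rfl
  · filter_upwards [hK.isClosed.isOpen_compl.mem_nhds hzK] with w hw
    rw [indicator_apply]
    split_ifs with h
    · rw [hP0 w h hw, mul_zero]
    · rfl

/-- Extension by zero of a field cut off near `{s = 0}`. -/
theorem contDiff_indicator_cutoff {D K : Set ℂ} {s P : ℂ → ℝ} (hD : IsOpen D)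
    (hs : ContDiffOn ℝ 1 s D) (hK : IsCompact K) (hKD : K ⊆ D)
    (hP : ContDiffOn ℝ 1 P (D ∩ {z | 0 < s z}))
    (hP0 : ∀ z ∈ D ∩ {z | 0 < s z}, z ∉ K → P z = 0) {N : ℝ} (hN : 0 < N) :
    ContDiff ℝ 1 ((D ∩ {z | 0 < s z}).indicator fun z => step (N * s z) * P z) ∧
    HasCompactSupport ((D ∩ {z | 0 < s z}).indicator fun z => step (N * s z) * P z) := by
  have hU : IsOpen (D ∩ {z | 0 < s z}) := hs.continuousOn.isOpen_inter_preimage hD isOpen_Ioi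
  constructor
  · rw [contDiff_iff_contDiffAt]
    intro z
    by_cases hz : z ∈ D ∩ {z | 0 < s z}
    · have h1 : ContDiffAt ℝ 1 (fun z => step (N * s z) * P z) z :=
        ((step_contDiff.contDiffAt).comp z
          (contDiffAt_const.mul (hs.contDiffAt (hD.mem_nhds hz.1)))).mul
          (hP.contDiffAt (hU.mem_nhds hz))
      refine h1.congr_of_eventuallyEq ?_
      filter_upwards [hU.mem_nhds hz] with w hw
      rw [indicator_of_mem hw]
    · exact (contDiffAt_const (c := (0 : ℝ))).congr_of_eventuallyEq
        (indicator_cutoff_eventuallyEq_zero hD hs hK hKD hP0 hN hz)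
  · classical
    refine HasCompactSupport.intro hK fun z hz => ?_
    rw [indicator_apply]
    split_ifs with h
    · rw [hP0 z h hz, mul_zero]
    · rfl

/-- Divergence theorem on the part `{s > 0}` of an open set, for a field supported in a compact
set, whose component along the gradient of `s` vanishes on `{s = 0}`. -/
theorem setIntegral_planeDiv_eq_zero {D K : Set ℂ} {s P Q : ℂ → ℝ} (hD : IsOpen D)
    (hs : ContDiffOn ℝ 1 s D) (hK : IsCompact K) (hKD : K ⊆ D)
    (hP : ContDiffOn ℝ 1 P (D ∩ {z | 0 < s z})) (hQ : ContDiffOn ℝ 1 Q (D ∩ {z | 0 < s z}))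
    (hP0 : ∀ z ∈ D ∩ {z | 0 < s z}, z ∉ K → P z = 0)
    (hQ0 : ∀ z ∈ D ∩ {z | 0 < s z}, z ∉ K → Q z = 0)
    (hlim : ∀ q ∈ K, s q = 0 → Tendsto
      (fun z => P z * fderiv ℝ s z 1 + Q z * fderiv ℝ s z Complex.I)
      (𝓝[D ∩ {z | 0 < s z}] q) (𝓝 0))
    (hint : IntegrableOn (planeDiv P Q) (D ∩ {z | 0 < s z})) {C : ℝ}
    (hstrip : ∀ ε : ℝ, 0 < ε →
      volume (K ∩ {z | 0 < s z ∧ s z < ε}) ≤ ENNReal.ofReal (C * ε)) :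
    ∫ z in D ∩ {z | 0 < s z}, planeDiv P Q z = 0 := by
  set U := D ∩ {z | 0 < s z} with hUdef
  have hU : IsOpen U := hs.continuousOn.isOpen_inter_preimage hD isOpen_Ioi
  obtain ⟨M, hM0, hM⟩ := exists_bound_deriv_smoothTransition
  have hM' : ∀ t, |deriv step t| ≤ M := fun t => by rw [deriv_step]; exact (hM _).1
  set F : ℂ → ℝ := fun z => P z * fderiv ℝ s z 1 + Q z * fderiv ℝ s z Complex.I with hF
  have hFc : ContinuousOn F U := by
    have h1 : ContinuousOn (fderiv ℝ s) U :=
      (hs.continuousOn_fderiv_of_isOpen hD le_rfl).mono inter_subset_left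
    exact (hP.continuousOn.mul (h1.clm_apply continuousOn_const)).add
      (hQ.continuousOn.mul (h1.clm_apply continuousOn_const))
  have hdiv : ∀ N : ℝ, 0 < N → ∀ z ∈ U,
      planeDiv (U.indicator fun z => step (N * s z) * P z)
        (U.indicator fun z => step (N * s z) * Q z) z =
      step (N * s z) * planeDiv P Q z + N * deriv step (N * s z) * F z := by
    intro N hN z hz
    have hsz : DifferentiableAt ℝ s z :=
      (hs.contDiffAt (hD.mem_nhds hz.1)).differentiableAt one_ne_zero
    have hst : HasFDerivAt (fun z => step (N * s z)) (deriv step (N * s z) • (N • fderiv ℝ s z)) z :=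
      ((step_contDiff.differentiable one_ne_zero _).hasDerivAt).comp_hasFDerivAt z
        (hsz.hasFDerivAt.const_mul N)
    have key : ∀ R : ℂ → ℝ, ContDiffOn ℝ 1 R U → ∀ v,
        fderiv ℝ (U.indicator fun z => step (N * s z) * R z) z v =
        step (N * s z) * fderiv ℝ R z v + N * deriv step (N * s z) * (R z * fderiv ℝ s z v) := by
      intro R hR v
      have hRz := ((hR.contDiffAt (hU.mem_nhds hz)).differentiableAt one_ne_zero).hasFDerivAt
      have he : (U.indicator fun z => step (N * s z) * R z) =ᶠ[𝓝 z]
          fun z => step (N * s z) * R z := by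
        filter_upwards [hU.mem_nhds hz] with w hw
        rw [indicator_of_mem hw]
      rw [he.fderiv_eq, (hst.fun_mul hRz).fderiv]
      simp
      ring
    simp only [planeDiv]
    rw [key P hP, key Q hQ, hF]
    ring
  -- The cut off field, extended by zero, is `C¹` with compact support in the plane, so the two
  -- parts of its divergence have opposite integrals.
  have hzero : ∀ N : ℝ, 0 < N →
      ∫ z in U, (step (N * s z) * planeDiv P Q z + N * deriv step (N * s z) * F z) = 0 := by
    intro N hN
    have hp := contDiff_indicator_cutoff hD hs hK hKD hP hP0 hN
    have hq := contDiff_indicator_cutoff hD hs hK hKD hQ hQ0 hN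
    have h0 := integral_planeDiv_eq_zero hp.1 hq.1 hp.2 hq.2
    rw [← setIntegral_congr_fun hU.measurableSet (hdiv N hN)]
    rw [setIntegral_eq_integral_of_forall_compl_eq_zero]
    · exact h0
    · intro z hz
      simp only [planeDiv]
      rw [(indicator_cutoff_eventuallyEq_zero hD hs hK hKD hP0 hN hz).fderiv_eq,
        (indicator_cutoff_eventuallyEq_zero hD hs hK hKD hQ0 hN hz).fderiv_eq]
      simp
  have hmeas : ∀ N : ℝ, AEStronglyMeasurable (fun z => step (N * s z)) (volume.restrict U) :=
    fun N => (step_contDiff.continuous.comp_continuousOn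
      (continuousOn_const.mul (hs.continuousOn.mono inter_subset_left))).aestronglyMeasurable
      hU.measurableSet
  have hintN : ∀ N : ℝ, IntegrableOn (fun z => step (N * s z) * planeDiv P Q z) U := fun N =>
    hint.bdd_mul (c := 1) (hmeas N) (.of_forall fun z => abs_step_le _)
  have hlim1 : Tendsto (fun n : ℕ => ∫ z in U, step (((n : ℝ) + 1) * s z) * planeDiv P Q z) atTop
      (𝓝 (∫ z in U, planeDiv P Q z)) := by
    refine tendsto_integral_of_dominated_convergence (fun z => |planeDiv P Q z|)
      (fun n => (hintN _).aestronglyMeasurable) hint.norm ?_ ?_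
    · intro n
      refine .of_forall fun z => ?_
      rw [norm_mul]
      exact mul_le_of_le_one_left (norm_nonneg _) (abs_step_le _)
    · filter_upwards [ae_restrict_mem hU.measurableSet] with z hz
      refine tendsto_const_nhds.congr' ?_
      obtain ⟨n0, hn0⟩ := exists_nat_gt (2 / s z)
      filter_upwards [eventually_ge_atTop n0] with n hn
      rw [step_eq_one, one_mul]
      have h1 : (2 : ℝ) / s z < n + 1 := by
        have : (n0 : ℝ) ≤ n := by exact_mod_cast hn
        linarith
      exact ((div_lt_iff₀ hz.2).1 h1).le
  have hlim2 : Tendsto (fun n : ℕ => ∫ z in U, step (((n : ℝ) + 1) * s z) * planeDiv P Q z) atTop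
      (𝓝 0) := by
    rw [Metric.tendsto_atTop]
    intro δ hδ
    -- The final bound is (size `N M δ'`) times (area `3 |C| / N`), and `N` cancels; the `+ 1` makes
    -- the inequality strict and the denominator positive.
    set δ' := δ / (M * (3 * |C|) + 1) with hδ'
    have hden : 0 < M * (3 * |C|) + 1 := by positivity
    have hδ'pos : 0 < δ' := by positivity
    obtain ⟨ε, hε, hsmall⟩ := exists_uniform_small hs.continuousOn hK hKD hlim hδ'pos
    obtain ⟨n0, hn0⟩ := exists_nat_gt (3 / ε)
    refine ⟨n0, fun n hn => ?_⟩
    set N : ℝ := (n : ℝ) + 1 with hNdef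
    have hN : 0 < N := by positivity
    have hNε : 3 < N * ε := by
      have h1 : (3 : ℝ) / ε < N := by
        have : (n0 : ℝ) ≤ n := by exact_mod_cast hn
        linarith
      exact (div_lt_iff₀ hε).1 h1
    -- The derivative of `step` vanishes beyond `2`; width `3 / N` instead of `2 / N` gives the
    -- strict inequality that `deriv_step_eq_zero` needs off the strip.
    set S := K ∩ {z | 0 < s z ∧ s z < 3 / N} with hS
    have hbound : ∀ z ∈ U \ S, N * deriv step (N * s z) * F z = 0 := by
      rintro z ⟨hz, hzS⟩
      by_cases hzK : z ∈ K
      · have : 3 / N ≤ s z := by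
          by_contra! h
          exact hzS ⟨hzK, hz.2, h⟩
        rw [div_le_iff₀ hN] at this
        rw [deriv_step_eq_zero (by linarith)]
        simp
      · simp [hF, hP0 z hz hzK, hQ0 z hz hzK]
    have hSU : S ⊆ U := fun z hz => ⟨hKD hz.1, hz.2.1⟩
    have hSvol : volume S ≤ ENNReal.ofReal (C * (3 / N)) := hstrip _ (by positivity)
    have hSfin : volume S < ⊤ := hSvol.trans_lt ENNReal.ofReal_lt_top
    have hbd : ∀ z ∈ S, ‖N * deriv step (N * s z) * F z‖ ≤ N * M * δ' := by
      intro z hz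
      rw [norm_mul, norm_mul, Real.norm_of_nonneg hN.le]
      have h1 : 3 / N < ε := by rw [div_lt_iff₀ hN]; linarith
      have hFz : ‖F z‖ ≤ δ' := (hsmall z hz.1 hz.2.1 (hz.2.2.trans h1)).le
      have h2 : ‖deriv step (N * s z)‖ ≤ M := hM' _
      exact mul_le_mul (mul_le_mul_of_nonneg_left h2 hN.le) hFz (norm_nonneg _) (by positivity)
    have hmeasS : MeasurableSet S := by
      have : S = K ∩ (U ∩ s ⁻¹' Iio (3 / N)) := by
        ext z
        constructor
        · intro hz
          exact ⟨hz.1, hSU hz, hz.2.2⟩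
        · intro hz
          exact ⟨hz.1, hz.2.1.2, hz.2.2⟩
      rw [this]
      exact hK.measurableSet.inter ((hs.continuousOn.mono inter_subset_left).isOpen_inter_preimage
        hU isOpen_Iio).measurableSet
    have hG : ∫ z in U, N * deriv step (N * s z) * F z =
        ∫ z in S, N * deriv step (N * s z) * F z :=
      (setIntegral_eq_of_subset_of_forall_sdiff_eq_zero hU.measurableSet hSU hbound)
    have hnorm : ‖∫ z in S, N * deriv step (N * s z) * F z‖ ≤ N * M * δ' * volume.real S :=
      norm_setIntegral_le_of_norm_le_const hSfin hbd
    have hreal : volume.real S ≤ |C| * (3 / N) := by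
      refine ENNReal.toReal_le_of_le_ofReal (by positivity) (hSvol.trans ?_)
      exact ENNReal.ofReal_le_ofReal (mul_le_mul_of_nonneg_right (le_abs_self _) (by positivity))
    have hintG : IntegrableOn (fun z => N * deriv step (N * s z) * F z) U := by
      have h1 : IntegrableOn (fun z => N * deriv step (N * s z) * F z) S := by
        refine IntegrableOn.of_bound hSfin ?_ (N * M * δ') ?_
        · have hm : AEStronglyMeasurable (fun z => N * deriv step (N * s z) * F z)
              (volume.restrict U) := by
            refine ContinuousOn.aestronglyMeasurable ?_ hU.measurableSet
            exact (continuousOn_const.mul ((step_contDiff.continuous_deriv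
              le_rfl).comp_continuousOn (continuousOn_const.mul
              (hs.continuousOn.mono inter_subset_left)))).mul hFc
          exact hm.mono_measure (Measure.restrict_mono hSU le_rfl)
        · filter_upwards [ae_restrict_mem hmeasS] with z hz using hbd z hz
      have h2 : IntegrableOn (fun z => N * deriv step (N * s z) * F z) (U \ S) :=
        (integrableOn_zero).congr_fun (fun z hz => (hbound z hz).symm)
          (hU.measurableSet.diff hmeasS)
      have := h1.union h2
      rwa [union_sdiff_cancel hSU] at this
    have hsum := hzero N hN
    rw [integral_add (hintN N) hintG, hG] at hsum
    rw [dist_zero_right, eq_neg_of_add_eq_zero_left hsum, norm_neg]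
    calc ‖∫ z in S, N * deriv step (N * s z) * F z‖ ≤ N * M * δ' * (|C| * (3 / N)) :=
          hnorm.trans (by gcongr)
      _ = M * (3 * |C|) * δ' := by field_simp
      _ < (M * (3 * |C|) + 1) * δ' := by linarith
      _ = δ := by rw [hδ']; field_simp
  exact tendsto_nhds_unique hlim1 hlim2

end HeleShaw
end

/-! ### Straightening the free boundary curve. -/

noncomputable section

namespace HeleShaw

/-- Off its frontier the plane splits into the open sets `Ω` and the exterior of `Ω`. This turns the
one-point side information in `IsRegion` into statements about whole half-discs. -/
theorem subset_of_disjoint_frontier {Ω T : Set ℂ} (hΩ : IsOpen Ω) (hT : IsPreconnected T)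
    (hd : Disjoint T (frontier Ω)) (hne : (T ∩ Ω).Nonempty) : T ⊆ Ω := by
  refine hT.subset_left_of_subset_union hΩ isClosed_closure.isOpen_compl
    (disjoint_compl_right_iff_subset.2 subset_closure) ?_ hne
  intro z hz
  by_cases h : z ∈ Ω
  · exact Or.inl h
  · refine Or.inr fun hc => hd.le_bot ⟨hz, ?_⟩
    rw [hΩ.frontier_eq]
    exact ⟨hc, h⟩

theorem volume_re_im_Ioo (a b c d : ℝ) :
    volume {w : ℂ | w.re ∈ Ioo a b ∧ w.im ∈ Ioo c d} =
      ENNReal.ofReal (b - a) * ENNReal.ofReal (d - c) := by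
  have h := Complex.volume_preserving_equiv_real_prod.measure_preimage
    (s := Ioo a b ×ˢ Ioo c d) (measurableSet_Ioo.prod measurableSet_Ioo).nullMeasurableSet
  rw [Measure.volume_eq_prod, Measure.prod_prod, Real.volume_Ioo, Real.volume_Ioo] at h
  rw [← h]
  rfl

/-- The strip lies in a box of width `2r`. Linearity in `ε` is what `setIntegral_planeDiv_eq_zero`
asks of strips. -/
theorem volume_ball_strip_le (z₀ : ℂ) (r : ℝ) (ε : ℝ) :
    volume {w : ℂ | w ∈ Metric.ball z₀ r ∧ w.im ∈ Ioo 0 ε} ≤ ENNReal.ofReal (2 * |r| * ε) := by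
  have hsub : {w : ℂ | w ∈ Metric.ball z₀ r ∧ w.im ∈ Ioo 0 ε} ⊆
      {w : ℂ | w.re ∈ Ioo (z₀.re - r) (z₀.re + r) ∧ w.im ∈ Ioo 0 ε} := by
    rintro w ⟨hw, hi⟩
    refine ⟨?_, hi⟩
    have h := (Complex.abs_re_le_norm (w - z₀)).trans_lt (by simpa [dist_eq_norm] using hw)
    rw [Complex.sub_re, abs_lt] at h
    exact ⟨by linarith, by linarith⟩
  refine (measure_mono hsub).trans ?_
  rw [volume_re_im_Ioo, sub_zero]
  rcases le_or_gt ε 0 with h | h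
  · simp [ENNReal.ofReal_of_nonpos h]
  · rw [ENNReal.ofReal_mul (by positivity)]
    gcongr
    linarith [le_abs_self r]

theorem isPreconnected_ball_inter_upper (z₀ : ℂ) (r : ℝ) :
    IsPreconnected (Metric.ball z₀ r ∩ upper) :=
  ((convex_ball z₀ r).inter (convex_halfSpace_im_gt 0)).isPreconnected

theorem isPreconnected_ball_inter_lower (z₀ : ℂ) (r : ℝ) :
    IsPreconnected (Metric.ball z₀ r ∩ lower) :=
  ((convex_ball z₀ r).inter (convex_halfSpace_im_lt 0)).isPreconnected

theorem isClosed_posAxis : IsClosed posAxis :=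
  (isClosed_le continuous_const Complex.continuous_re).inter
    (isClosed_eq Complex.continuous_im continuous_const)

theorem isOpen_upper : IsOpen upper := isOpen_lt continuous_const Complex.continuous_im

theorem isOpen_lower : IsOpen lower := isOpen_lt Complex.continuous_im continuous_const

theorem ofReal_mem_posAxis {x : ℝ} (hx : 0 ≤ x) : (x : ℂ) ∈ posAxis := by simp [posAxis, hx]

theorem disjoint_upper_posAxis : Disjoint upper posAxis := by
  rw [Set.disjoint_left]
  intro z hz hz'
  simp only [upper, posAxis, mem_ofPred_eq] at hz hz'
  linarith [hz'.2]

theorem disjoint_lower_posAxis : Disjoint lower posAxis := by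
  rw [Set.disjoint_left]
  intro z hz hz'
  simp only [lower, posAxis, mem_ofPred_eq] at hz hz'
  linarith [hz'.2]

variable {Ω : Set ℂ} {a b : ℝ} {γ : ℝ → ℂ}

theorem IsRegion.contDiffAt (h : IsRegion Ω a b γ) {t : ℝ} (ht : t ∈ Ioo (0 : ℝ) 1) :
    ContDiffAt ℝ 1 γ t := h.contDiffOn.contDiffAt (isOpen_Ioo.mem_nhds ht)

/-- The map `(t, y) ↦ γ t + y ν` that straightens the curve. -/
def straighten (γ : ℝ → ℂ) (ν : ℂ) (w : ℂ) : ℂ := γ w.re + w.im • ν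

theorem straighten_hasFDerivAt {ν w : ℂ} (h : DifferentiableAt ℝ γ w.re) :
    HasFDerivAt (straighten γ ν)
      (Complex.reCLM.smulRight (deriv γ w.re) + Complex.imCLM.smulRight ν) w := by
  have h1 : HasFDerivAt (fun w : ℂ => γ w.re) (Complex.reCLM.smulRight (deriv γ w.re)) w := by
    refine HasFDerivAt.congr_fderiv (h.hasDerivAt.hasFDerivAt.comp w Complex.reCLM.hasFDerivAt) ?_
    ext v
    simp
  exact h1.add (Complex.imCLM.hasFDerivAt.smul_const ν)

theorem straighten_contDiffAt {ν w : ℂ} (h : ContDiffAt ℝ 1 γ w.re) :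
    ContDiffAt ℝ 1 (straighten γ ν) w :=
  (h.comp w Complex.reCLM.contDiff.contDiffAt).add
    (Complex.imCLM.contDiff.contDiffAt.smul contDiffAt_const)

/-- Near a point of the curve, the region is the set `{s > 0}` for a `C¹` function `s` that
vanishes on the curve. -/
theorem IsRegion.exists_chart (h : IsRegion Ω a b γ) {t₀ : ℝ} (ht₀ : t₀ ∈ Ioo (0 : ℝ) 1) :
    ∃ (D : Set ℂ) (s : ℂ → ℝ) (C : ℝ), IsOpen D ∧ Bornology.IsBounded D ∧ γ t₀ ∈ D ∧
      ContDiffOn ℝ 1 s D ∧ D ∩ Ω = D ∩ {z | 0 < s z} ∧ Disjoint D posAxis ∧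
      (∀ z ∈ D, s z = 0 → ∃ t ∈ Ioo (0 : ℝ) 1, z = γ t ∧ fderiv ℝ s z (deriv γ t) = 0) ∧
      ∀ ε : ℝ, 0 < ε → volume (D ∩ {z | 0 < s z ∧ s z < ε}) ≤ ENNReal.ofReal (C * ε) := by
  set ν := Complex.I * deriv γ t₀ with hν
  set S := straighten γ ν with hS
  have hd0 := h.deriv_ne_zero t₀ ht₀
  have hSre : ∀ t : ℝ, S t = γ t := fun t => by simp [hS, straighten]
  have hcd : ContDiffAt ℝ 1 S (t₀ : ℂ) := straighten_contDiffAt (by simpa using h.contDiffAt ht₀)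
  -- Since `ν = i γ'(t₀)`, the differential at `t₀` sends `t + iy` to `(t + iy) γ'(t₀)`: it is
  -- multiplication by a nonzero complex number, so the inverse function theorem applies.
  let E : ℂ ≃L[ℝ] ℂ := ContinuousLinearEquiv.smulLeft (Units.mk0 _ hd0)
  have hE : HasFDerivAt S (E : ℂ →L[ℝ] ℂ) (t₀ : ℂ) := by
    have := straighten_hasFDerivAt (γ := γ) (ν := ν) (w := (t₀ : ℂ))
      (by simpa using (h.contDiffAt ht₀).differentiableAt one_ne_zero)
    refine this.congr_fderiv ?_
    ext v
    simp only [E, hν, Complex.ofReal_re, add_apply,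
      ContinuousLinearMap.smulRight_apply, Complex.reCLM_apply, Complex.imCLM_apply,
      Complex.real_smul, ContinuousLinearEquiv.coe_coe, ContinuousLinearEquiv.smulLeft_apply_apply,
      Units.smul_def, Units.val_mk0, smul_eq_mul]
    nth_rewrite 3 [← Complex.re_add_im v]
    ring
  let e := hcd.toOpenPartialHomeomorph S hE one_ne_zero
  have hsrc : (t₀ : ℂ) ∈ e.source := hcd.mem_toOpenPartialHomeomorph_source hE one_ne_zero
  have hesymm : ContDiffAt ℝ 1 e.symm (S t₀) := hcd.to_localInverse hE one_ne_zero
  obtain ⟨r', hr', hball'⟩ : ∃ r' > 0, Metric.ball (t₀ : ℂ) r' ⊆ e.source ∩ {w | w.re ∈ Ioo 0 1} := by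
    refine Metric.mem_nhds_iff.1 (inter_mem (e.open_source.mem_nhds hsrc) ?_)
    exact (Complex.continuous_re.continuousAt.preimage_mem_nhds
      (isOpen_Ioo.mem_nhds (by simpa using ht₀)))
  -- A closed set that contains the part of the frontier away from `t₀`. It misses `γ t₀` by
  -- injectivity, so a small chart avoids it and meets the frontier only along the image of the real
  -- axis.
  set F : Set ℂ := γ '' (Icc 0 1 \ Metric.ball t₀ r') ∪ posAxis with hF
  have hFc : IsClosed F := by
    refine IsClosed.union ?_ isClosed_posAxis
    have : IsCompact (Icc (0 : ℝ) 1 \ Metric.ball t₀ r') := isCompact_Icc.diff Metric.isOpen_ball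
    exact (this.image_of_continuousOn (h.continuousOn.mono sdiff_subset)).isClosed
  have hF0 : γ t₀ ∉ F := by
    rintro (⟨t, ⟨ht, htb⟩, hγ⟩ | hp)
    · have := h.injOn ht (Ioo_subset_Icc_self ht₀) hγ
      exact htb (by simp [this, hr'])
    · exact h.not_mem_posAxis t₀ ht₀ hp
  have hdet : ∃ M : ℝ, 0 ≤ M ∧ ∀ᶠ w in 𝓝 (t₀ : ℂ), |(fderiv ℝ S w).det| ≤ M := by
    have hc : ContinuousAt (fun w => |(fderiv ℝ S w).det|) (t₀ : ℂ) :=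
      (ContinuousLinearMap.continuous_det.continuousAt.comp
        (hcd.fderiv_right (m := 0) (by simp)).continuousAt).abs
    refine ⟨|(fderiv ℝ S t₀).det| + 1, by positivity, ?_⟩
    exact (hc.eventually (gt_mem_nhds (lt_add_one _))).mono fun w hw => hw.le
  obtain ⟨M, hM0, hM⟩ := hdet
  have hScont := hcd.continuousAt
  have hev : ∀ᶠ w in 𝓝 (t₀ : ℂ), w ∈ Metric.ball (t₀ : ℂ) r' ∧ S w ∉ F ∧
      ContDiffAt ℝ 1 e.symm (S w) ∧ S w ∈ Metric.ball (S t₀) 1 ∧ |(fderiv ℝ S w).det| ≤ M := by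
    have h1 : ∀ᶠ z in 𝓝 (S t₀), z ∉ F := hFc.isOpen_compl.mem_nhds (by rw [hSre]; exact hF0)
    have h2 : ∀ᶠ z in 𝓝 (S t₀), z ∈ Metric.ball (S t₀) 1 := Metric.ball_mem_nhds _ one_pos
    have h3 : ∀ᶠ w in 𝓝 (t₀ : ℂ), w ∈ Metric.ball (t₀ : ℂ) r' := Metric.ball_mem_nhds _ hr'
    exact h3.and ((hScont.eventually h1).and ((hScont.eventually
      (hesymm.eventually (by simp))).and ((hScont.eventually h2).and hM)))
  obtain ⟨r, hr, hball⟩ := Metric.mem_nhds_iff.1 hev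
  set B := Metric.ball (t₀ : ℂ) r with hB
  have hBsrc : B ⊆ e.source := fun w hw => (hball' (hball hw).1).1
  have hBre : ∀ w ∈ B, w.re ∈ Ioo (0 : ℝ) 1 := fun w hw => (hball' (hball hw).1).2
  have hSB : ContinuousOn S B := fun w hw =>
    (straighten_contDiffAt (h.contDiffAt (hBre w hw))).continuousAt.continuousWithinAt
  have hleft : ∀ w ∈ B, e.symm (S w) = w := fun w hw => e.left_inv (hBsrc hw)
  have hfront : ∀ w ∈ B, S w ∈ frontier Ω → w.im = 0 := by
    intro w hw hwf
    rw [h.frontier_eq] at hwf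
    have hwF := (hball hw).2.1
    rcases hwf with ⟨t, ht, hγ⟩ | ⟨x, hx, hxw⟩
    · by_cases htb : t ∈ Metric.ball t₀ r'
      · have h1 : (t : ℂ) ∈ Metric.ball (t₀ : ℂ) r' := by
          simpa [Complex.dist_eq, ← Complex.ofReal_sub, Real.dist_eq] using htb
        have h2 : S t = S w := by rw [hSre, hγ]
        have := e.injOn (hball' h1).1 (hBsrc hw) h2
        rw [← this]
        simp
      · exact absurd (Or.inl ⟨t, ⟨ht, htb⟩, hγ⟩) hwF
    · refine absurd (Or.inr ?_) hwF
      rw [← hxw]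
      exact ofReal_mem_posAxis (h.a_pos.le.trans hx.1)
  -- The image of the upper half-disc is connected and misses the frontier; the orientation
  -- hypothesis provides one of its points in `Ω`.
  have hup : S '' (B ∩ upper) ⊆ Ω := by
    refine subset_of_disjoint_frontier h.isOpen
      ((isPreconnected_ball_inter_upper _ _).image _ (hSB.mono inter_subset_left)) ?_ ?_
    · rw [Set.disjoint_left]
      rintro _ ⟨w, ⟨hw, hwu⟩, rfl⟩ hf
      exact (ne_of_gt hwu) (hfront w hw hf)
    · obtain ⟨s, ⟨hs1, hs2⟩, hs3⟩ := ((h.left_of_curve t₀ ht₀).and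
        (Ioo_mem_nhdsGT hr)).exists
      refine ⟨_, ⟨t₀ + s * Complex.I, ⟨?_, ?_⟩, rfl⟩, ?_⟩
      · simp [hB, abs_of_pos hs3.1, hs3.2]
      · simp [upper, hs3.1]
      · convert hs1 using 1
        simp [hS, straighten, hν]
  have hlow : Disjoint (S '' (B ∩ lower)) Ω := by
    rw [Set.disjoint_left]
    by_contra! hcon
    obtain ⟨z, hz, hzΩ⟩ := hcon
    have hsub : S '' (B ∩ lower) ⊆ Ω := by
      refine subset_of_disjoint_frontier h.isOpen
        ((isPreconnected_ball_inter_lower _ _).image _ (hSB.mono inter_subset_left)) ?_ ⟨z, hz, hzΩ⟩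
      rw [Set.disjoint_left]
      rintro _ ⟨w, ⟨hw, hwu⟩, rfl⟩ hf
      exact (ne_of_lt hwu) (hfront w hw hf)
    obtain ⟨s, ⟨hs1, hs2⟩, hs3⟩ := ((h.left_of_curve t₀ ht₀).and
        (Ioo_mem_nhdsGT hr)).exists
    refine hs2 (hsub ⟨t₀ - s * Complex.I, ⟨?_, ?_⟩, ?_⟩)
    · simp [hB, abs_of_pos hs3.1, hs3.2]
    · simp [lower, hs3.1]
    · simp [hS, straighten, hν]
      ring
  have hzero : ∀ w ∈ B, w.im = 0 → S w = γ w.re := by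
    intro w hw hi
    simp [hS, straighten, hi]
  refine ⟨S '' B, fun z => (e.symm z).im, M * (2 * |r|), ?_, ?_, ⟨t₀, by simp [hB, hr], hSre _⟩, ?_,
    ?_, ?_, ?_, ?_⟩
  · exact e.isOpen_image_of_subset_source Metric.isOpen_ball hBsrc
  · refine (Metric.isBounded_ball (x := S t₀) (r := 1)).subset ?_
    rintro _ ⟨w, hw, rfl⟩
    exact (hball hw).2.2.2.1
  · rintro _ ⟨w, hw, rfl⟩
    exact (Complex.imCLM.contDiff.contDiffAt.comp _ (hball hw).2.2.1).contDiffWithinAt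
  · ext z
    simp only [mem_inter_iff, mem_ofPred_eq, and_congr_right_iff]
    rintro ⟨w, hw, rfl⟩
    rw [hleft w hw]
    rcases lt_trichotomy w.im 0 with hi | hi | hi
    · exact ⟨fun hm => absurd hm (Set.disjoint_left.1 hlow ⟨w, ⟨hw, hi⟩, rfl⟩),
        fun hm => absurd hm (by linarith)⟩
    · refine ⟨fun hm => ?_, fun hm => absurd hm (by linarith)⟩
      have hf : S w ∈ frontier Ω := by
        rw [h.frontier_eq, hzero w hw hi]
        exact Or.inl ⟨_, Ioo_subset_Icc_self (hBre w hw), rfl⟩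
      rw [h.isOpen.frontier_eq] at hf
      exact absurd hm hf.2
    · exact ⟨fun _ => hi, fun _ => hup ⟨w, ⟨hw, hi⟩, rfl⟩⟩
  · rw [Set.disjoint_left]
    rintro _ ⟨w, hw, rfl⟩ hp
    exact (hball hw).2.1 (Or.inr hp)
  · rintro _ ⟨w, hw, rfl⟩ hi
    simp only [hleft w hw] at hi
    refine ⟨w.re, hBre w hw, hzero w hw hi, ?_⟩
    have hwre : ((w.re : ℝ) : ℂ) = w := by apply Complex.ext <;> simp [hi]
    -- The defining function vanishes along the curve, so its derivative in the tangent direction is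
    -- zero.
    have h1 : (fun t : ℝ => (e.symm (γ t)).im) =ᶠ[𝓝 w.re] fun _ => 0 := by
      have : ∀ᶠ t : ℝ in 𝓝 w.re, (t : ℂ) ∈ B :=
        Complex.continuous_ofReal.continuousAt.eventually
          (Metric.isOpen_ball.mem_nhds (by rw [hwre]; exact hw))
      filter_upwards [this] with t ht
      rw [← hSre, hleft _ ht]
      simp
    have h2 : HasFDerivAt (fun z => (e.symm z).im) (fderiv ℝ (fun z => (e.symm z).im) (S w)) (S w) :=
      (DifferentiableAt.hasFDerivAt <| (Complex.imCLM.contDiff.contDiffAt.comp _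
        (hball hw).2.2.1 : ContDiffAt ℝ 1 _ _).differentiableAt one_ne_zero)
    rw [hzero w hw hi] at h2 ⊢
    have h3 := h2.comp_hasDerivAt w.re
      ((h.contDiffAt (hBre w hw)).differentiableAt one_ne_zero).hasDerivAt
    exact h3.unique ((hasDerivAt_const w.re (0 : ℝ)).congr_of_eventuallyEq h1)
  · intro ε hε
    set T := {w : ℂ | w ∈ B ∧ w.im ∈ Ioo 0 ε} with hT
    have hTm : MeasurableSet T := (Metric.isOpen_ball.inter
      (isOpen_Ioo.preimage Complex.continuous_im)).measurableSet
    -- The curved strip is the image of a flat one, and the Jacobian is at most `M` on the chart.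
    have hsub : S '' B ∩ {z | 0 < (e.symm z).im ∧ (e.symm z).im < ε} ⊆ S '' T := by
      rintro _ ⟨⟨w, hw, rfl⟩, hi⟩
      simp only [mem_ofPred_eq, hleft w hw] at hi
      exact ⟨w, ⟨hw, hi⟩, rfl⟩
    calc volume (S '' B ∩ {z | 0 < (e.symm z).im ∧ (e.symm z).im < ε}) ≤ volume (S '' T) :=
          measure_mono hsub
      _ ≤ ∫⁻ w in T, ENNReal.ofReal |(fderiv ℝ S w).det| :=
          addHaar_image_le_lintegral_abs_det_fderiv volume hTm fun w hw =>
            ((straighten_contDiffAt (h.contDiffAt (hBre w hw.1))).differentiableAt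
              one_ne_zero).hasFDerivAt.hasFDerivWithinAt
      _ ≤ ∫⁻ w in T, ENNReal.ofReal M :=
          setLIntegral_mono' hTm fun w hw => ENNReal.ofReal_le_ofReal (hball hw.1).2.2.2.2
      _ = ENNReal.ofReal M * volume T := by simp
      _ ≤ ENNReal.ofReal M * ENNReal.ofReal (2 * |r| * ε) := by
          gcongr
          exact volume_ball_strip_le _ _ _
      _ = ENNReal.ofReal (M * (2 * |r|) * ε) := by
          rw [← ENNReal.ofReal_mul hM0, mul_assoc M]

end HeleShaw
end

/-! ### The divergence theorem on the slit region. -/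

noncomputable section

namespace HeleShaw

variable {Ω : Set ℂ} {a b : ℝ} {γ : ℝ → ℂ} {P Q : ℂ → ℝ}

theorem volume_posAxis : volume posAxis = 0 := by
  have h := Complex.volume_preserving_equiv_real_prod.measure_preimage
    (s := univ ×ˢ {0}) (MeasurableSet.univ.prod (measurableSet_singleton 0)).nullMeasurableSet
  rw [Measure.volume_eq_prod, Measure.prod_prod, Real.volume_singleton, mul_zero] at h
  refine measure_mono_null (fun z hz => ?_) h
  exact ⟨mem_univ _, hz.2⟩

theorem setIntegral_sdiff_posAxis (f : ℂ → ℝ) (Ω : Set ℂ) :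
    ∫ z in Ω \ posAxis, f z = ∫ z in Ω, f z :=
  setIntegral_congr_set (sdiff_null_ae_eq_self volume_posAxis)

theorem integrableOn_sdiff_posAxis {f : ℂ → ℝ} {Ω : Set ℂ} :
    IntegrableOn f (Ω \ posAxis) ↔ IntegrableOn f Ω :=
  integrableOn_congr_set_ae (sdiff_null_ae_eq_self volume_posAxis)

theorem IsRegion.isOpen_slit (h : IsRegion Ω a b γ) : IsOpen (Ω \ posAxis) :=
  h.isOpen.sdiff isClosed_posAxis

theorem IsRegion.notMem_of_mem_frontier (h : IsRegion Ω a b γ) {z : ℂ} (hz : z ∈ frontier Ω) :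
    z ∉ Ω := by
  rw [h.isOpen.frontier_eq] at hz
  exact hz.2

theorem IsRegion.ofReal_mem_frontier (h : IsRegion Ω a b γ) {x : ℝ} (hx : x ∈ Icc a b) :
    (x : ℂ) ∈ frontier Ω := by
  rw [h.frontier_eq]
  exact Or.inr ⟨x, hx, rfl⟩

theorem IsRegion.curve_mem_frontier (h : IsRegion Ω a b γ) {t : ℝ} (ht : t ∈ Icc (0 : ℝ) 1) :
    γ t ∈ frontier Ω := by
  rw [h.frontier_eq]
  exact Or.inl ⟨t, ht, rfl⟩

theorem IsRegion.eq_endpoint_of_mem_posAxis (h : IsRegion Ω a b γ) {t : ℝ}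
    (ht : t ∈ Icc (0 : ℝ) 1) (hp : γ t ∈ posAxis) : γ t = b ∨ γ t = a := by
  rcases eq_endpoints_or_mem_Ioo_of_mem_Icc ht with rfl | rfl | ht'
  · exact Or.inl h.start
  · exact Or.inr h.finish
  · exact absurd hp (h.not_mem_posAxis t ht')

theorem IsRegion.ofReal_notMem_frontier (h : IsRegion Ω a b γ) {x : ℝ} (hx : 0 ≤ x)
    (hx' : x ∉ Icc a b) : (x : ℂ) ∉ frontier Ω := by
  rw [h.frontier_eq]
  rintro (⟨t, ht, htx⟩ | ⟨y, hy, hyx⟩)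
  · rcases h.eq_endpoint_of_mem_posAxis ht (htx ▸ ofReal_mem_posAxis hx) with h1 | h1
    · rw [htx, Complex.ofReal_inj] at h1
      exact hx' (by rw [h1]; exact right_mem_Icc.2 h.a_lt_b.le)
    · rw [htx, Complex.ofReal_inj] at h1
      exact hx' (by rw [h1]; exact left_mem_Icc.2 h.a_lt_b.le)
  · exact hx' (Complex.ofReal_inj.1 hyx ▸ hy)

/-- The segment `[0, a)` is connected, misses the frontier and starts in `Ω`. -/
theorem IsRegion.ofReal_mem (h : IsRegion Ω a b γ) {x : ℝ} (hx : x ∈ Ico 0 a) : (x : ℂ) ∈ Ω := by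
  refine subset_of_disjoint_frontier (T := (fun x : ℝ => (x : ℂ)) '' Ico 0 a) h.isOpen
    (isPreconnected_Ico.image _ Complex.continuous_ofReal.continuousOn) ?_
    ⟨0, ⟨0, ⟨le_rfl, h.a_pos⟩, by simp⟩, h.zero_mem⟩ ⟨x, hx, rfl⟩
  rw [Set.disjoint_left]
  rintro _ ⟨y, hy, rfl⟩
  exact h.ofReal_notMem_frontier hy.1 fun h' => not_le.2 hy.2 h'.1

/-- The ray beyond `b` misses the frontier; one of its points in `Ω` would put all of it in the
bounded set `Ω`. -/
theorem IsRegion.ofReal_notMem_of_lt (h : IsRegion Ω a b γ) {x : ℝ} (hx : b < x) :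
    (x : ℂ) ∉ Ω := by
  intro hxΩ
  have hsub : (fun x : ℝ => (x : ℂ)) '' Ioi b ⊆ Ω := by
    refine subset_of_disjoint_frontier h.isOpen
      (isPreconnected_Ioi.image _ Complex.continuous_ofReal.continuousOn) ?_ ⟨x, ⟨x, hx, rfl⟩, hxΩ⟩
    rw [Set.disjoint_left]
    rintro _ ⟨y, hy, rfl⟩
    exact h.ofReal_notMem_frontier ((h.a_pos.trans h.a_lt_b).trans hy).le
      fun h' => not_le.2 hy h'.2
  obtain ⟨R, hR⟩ := h.isBounded.exists_norm_le
  have := hR _ (hsub ⟨max (b + 1) (R + 1), lt_max_of_lt_left (lt_add_one b), rfl⟩)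
  rw [Complex.norm_real] at this
  linarith [le_abs_self (max (b + 1) (R + 1)), le_max_right (b + 1) (R + 1),
    Real.norm_eq_abs (max (b + 1) (R + 1))]

theorem abs_re_sub_lt_of_mem_ball {z : ℂ} {x r : ℝ} (hz : z ∈ Metric.ball (x : ℂ) r) :
    |z.re - x| < r := by
  have h := (Complex.abs_re_le_norm (z - x)).trans_lt (by simpa [dist_eq_norm] using hz)
  simpa using h

theorem IsRegion.exists_ball_passing (h : IsRegion Ω a b γ) {x : ℝ} (hx : x ∈ Ioo 0 a) :
    ∃ r > 0, Metric.ball (x : ℂ) r ⊆ Ω ∧ ∀ z ∈ Metric.ball (x : ℂ) r, z.re ∈ Ioo 0 a := by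
  obtain ⟨r, hr, hball⟩ := Metric.isOpen_iff.1 h.isOpen x (h.ofReal_mem ⟨hx.1.le, hx.2⟩)
  refine ⟨min r (min x (a - x)), lt_min hr (lt_min hx.1 (sub_pos.2 hx.2)),
    (Metric.ball_subset_ball (min_le_left _ _)).trans hball, fun z hz => ?_⟩
  have h1 := lt_min_iff.1 (lt_min_iff.1 (abs_re_sub_lt_of_mem_ball hz)).2
  rw [abs_lt, abs_lt] at h1
  exact ⟨by linarith, by linarith⟩

/-- The curve is at a positive distance from `x`, so in a small disc the frontier lies on the real
axis, and each half-disc lies wholly inside or wholly outside `Ω`. -/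
theorem IsRegion.exists_ball_reflecting (h : IsRegion Ω a b γ) {x : ℝ} (hx : x ∈ Ioo a b) :
    ∃ r > 0, Metric.ball (x : ℂ) r ∩ Ω = Metric.ball (x : ℂ) r ∩ upper ∧
      ∀ z ∈ Metric.ball (x : ℂ) r, z.re ∈ Ioo a b := by
  have hc : IsClosed (γ '' Icc 0 1) := (isCompact_Icc.image_of_continuousOn h.continuousOn).isClosed
  have hxc : (x : ℂ) ∉ γ '' Icc 0 1 := by
    rintro ⟨t, ht, htx⟩
    rcases h.eq_endpoint_of_mem_posAxis ht
      (htx ▸ ofReal_mem_posAxis (h.a_pos.trans hx.1).le) with h1 | h1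
    · rw [htx, Complex.ofReal_inj] at h1
      exact hx.2.ne h1
    · rw [htx, Complex.ofReal_inj] at h1
      exact hx.1.ne' h1
  obtain ⟨r, hr, hball⟩ := Metric.isOpen_iff.1 hc.isOpen_compl x hxc
  set r' := min r (min (x - a) (b - x)) with hr'
  have hr'0 : 0 < r' := lt_min hr (lt_min (sub_pos.2 hx.1) (sub_pos.2 hx.2))
  have hre : ∀ z ∈ Metric.ball (x : ℂ) r', z.re ∈ Ioo a b := by
    intro z hz
    have h1 := lt_min_iff.1 (lt_min_iff.1 (abs_re_sub_lt_of_mem_ball hz)).2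
    rw [abs_lt, abs_lt] at h1
    exact ⟨by linarith, by linarith⟩
  have hfr : ∀ z ∈ Metric.ball (x : ℂ) r', z ∈ frontier Ω → z.im = 0 := by
    intro z hz hf
    rw [h.frontier_eq] at hf
    rcases hf with hf | ⟨y, hy, rfl⟩
    · exact absurd hf (hball (Metric.ball_subset_ball (min_le_left _ _) hz))
    · simp
  obtain ⟨s, ⟨hs1, hs2⟩, hs3⟩ := ((h.above_interval x hx).and (Ioo_mem_nhdsGT hr'0)).exists
  have hup : Metric.ball (x : ℂ) r' ∩ upper ⊆ Ω := by
    refine subset_of_disjoint_frontier h.isOpen (isPreconnected_ball_inter_upper _ _) ?_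
      ⟨_, ⟨?_, ?_⟩, hs1⟩
    · rw [Set.disjoint_left]
      rintro z ⟨hz, hzu⟩ hf
      exact (ne_of_gt hzu) (hfr z hz hf)
    · simp [abs_of_pos hs3.1, hs3.2]
    · simp [upper, hs3.1]
  have hlow : Disjoint (Metric.ball (x : ℂ) r' ∩ lower) Ω := by
    rw [Set.disjoint_left]
    by_contra! hcon
    obtain ⟨z, hz, hzΩ⟩ := hcon
    refine hs2 (subset_of_disjoint_frontier h.isOpen (isPreconnected_ball_inter_lower (x : ℂ) r') ?_
      ⟨z, hz, hzΩ⟩ ⟨?_, ?_⟩)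
    · rw [Set.disjoint_left]
      rintro z ⟨hz, hzu⟩ hf
      exact (ne_of_lt hzu) (hfr z hz hf)
    · simp [abs_of_pos hs3.1, hs3.2]
    · simp [lower, hs3.1]
  refine ⟨r', hr'0, ?_, hre⟩
  ext z
  simp only [mem_inter_iff, and_congr_right_iff]
  intro hz
  refine ⟨fun hzΩ => ?_, fun hzu => hup ⟨hz, hzu⟩⟩
  rcases lt_trichotomy z.im 0 with hi | hi | hi
  · exact absurd hzΩ (Set.disjoint_left.1 hlow ⟨hz, hi⟩)
  · have : z = (z.re : ℂ) := by apply Complex.ext <;> simp [hi]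
    rw [this] at hzΩ
    exact absurd hzΩ (h.notMem_of_mem_frontier
      (h.ofReal_mem_frontier (Ioo_subset_Icc_self (hre z hz))))
  · exact hi

/-- The points of the closure of a region. -/
theorem IsRegion.cases_closure (h : IsRegion Ω a b γ) {q : ℂ} (hq : q ∈ closure Ω) :
    q ∈ Ω \ posAxis ∨ (∃ t ∈ Ioo (0 : ℝ) 1, q = γ t) ∨ q ∈ ({0, (a : ℂ), (b : ℂ)} : Set ℂ) ∨
      (∃ x ∈ Ioo 0 a, q = (x : ℂ)) ∨ (∃ x ∈ Ioo a b, q = (x : ℂ)) := by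
  by_cases hqΩ : q ∈ Ω
  · by_cases hp : q ∈ posAxis
    · have hqr : q = (q.re : ℂ) := by apply Complex.ext <;> simp [hp.2]
      rcases hp.1.eq_or_lt with h0 | h0
      · exact Or.inr (Or.inr (Or.inl (Or.inl (by rw [hqr, ← h0]; simp))))
      · rcases lt_or_ge q.re a with h1 | h1
        · exact Or.inr (Or.inr (Or.inr (Or.inl ⟨q.re, ⟨h0, h1⟩, hqr⟩)))
        · rw [hqr] at hqΩ
          rcases le_or_gt q.re b with h2 | h2
          · exact absurd hqΩ (h.notMem_of_mem_frontier (h.ofReal_mem_frontier ⟨h1, h2⟩))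
          · exact absurd hqΩ (h.ofReal_notMem_of_lt h2)
    · exact Or.inl ⟨hqΩ, hp⟩
  · have hf : q ∈ frontier Ω := by rw [h.isOpen.frontier_eq]; exact ⟨hq, hqΩ⟩
    rw [h.frontier_eq] at hf
    rcases hf with ⟨t, ht, rfl⟩ | ⟨x, hx, rfl⟩
    · rcases eq_endpoints_or_mem_Ioo_of_mem_Icc ht with rfl | rfl | ht'
      · exact Or.inr (Or.inr (Or.inl (by simp [h.start])))
      · exact Or.inr (Or.inr (Or.inl (by simp [h.finish])))
      · exact Or.inr (Or.inl ⟨t, ht', rfl⟩)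
    · rcases eq_endpoints_or_mem_Ioo_of_mem_Icc hx with rfl | rfl | hx'
      · exact Or.inr (Or.inr (Or.inl (by simp)))
      · exact Or.inr (Or.inr (Or.inl (by simp)))
      · exact Or.inr (Or.inr (Or.inr (Or.inr ⟨x, hx', rfl⟩)))

/-- A planar field on the slit region that vanishes near the three exceptional points and has no
flux through `Γ`, through the upper side of `(a, b)` and, on balance, out of the two sides of
`(0, a)`. -/
structure IsSealedField (Ω : Set ℂ) (a b : ℝ) (γ : ℝ → ℂ) (P Q : ℂ → ℝ) : Prop where
  contDiffOn_fst : ContDiffOn ℝ 1 P (Ω \ posAxis)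
  contDiffOn_snd : ContDiffOn ℝ 1 Q (Ω \ posAxis)
  eventually_zero : ∀ q ∈ ({0, (a : ℂ), (b : ℂ)} : Set ℂ),
    ∀ᶠ z in 𝓝 q, z ∈ Ω \ posAxis → P z = 0 ∧ Q z = 0
  curve : ∀ t ∈ Ioo (0 : ℝ) 1, ∃ P₀ Q₀ : ℝ, Tendsto P (𝓝[Ω \ posAxis] (γ t)) (𝓝 P₀) ∧
    Tendsto Q (𝓝[Ω \ posAxis] (γ t)) (𝓝 Q₀) ∧ P₀ * (deriv γ t).im = Q₀ * (deriv γ t).re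
  reflecting : ∀ x ∈ Ioo a b, Tendsto Q (𝓝[Ω ∩ upper] (x : ℂ)) (𝓝 0)
  passing : ∀ x ∈ Ioo 0 a, ∃ Q₀ : ℝ, Tendsto Q (𝓝[Ω ∩ upper] (x : ℂ)) (𝓝 Q₀) ∧
    Tendsto Q (𝓝[Ω ∩ lower] (x : ℂ)) (𝓝 Q₀)
  integrableOn_fst : IntegrableOn P Ω
  integrableOn_snd : IntegrableOn Q Ω
  integrableOn_div : IntegrableOn (planeDiv P Q) Ω

theorem planeDiv_mul {ρ : ℂ → ℝ} {z : ℂ} (hρ : DifferentiableAt ℝ ρ z)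
    (hP : DifferentiableAt ℝ P z) (hQ : DifferentiableAt ℝ Q z) :
    planeDiv (fun z => ρ z * P z) (fun z => ρ z * Q z) z =
      ρ z * planeDiv P Q z + (fderiv ℝ ρ z 1 * P z + fderiv ℝ ρ z Complex.I * Q z) := by
  simp only [planeDiv]
  rw [fderiv_fun_mul hρ hP, fderiv_fun_mul hρ hQ]
  simp
  ring

theorem IsSealedField.differentiableAt_fst (h : IsRegion Ω a b γ) (hf : IsSealedField Ω a b γ P Q)
    {z : ℂ} (hz : z ∈ Ω \ posAxis) : DifferentiableAt ℝ P z :=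
  (hf.contDiffOn_fst.contDiffAt (h.isOpen_slit.mem_nhds hz)).differentiableAt one_ne_zero

theorem IsSealedField.differentiableAt_snd (h : IsRegion Ω a b γ) (hf : IsSealedField Ω a b γ P Q)
    {z : ℂ} (hz : z ∈ Ω \ posAxis) : DifferentiableAt ℝ Q z :=
  (hf.contDiffOn_snd.contDiffAt (h.isOpen_slit.mem_nhds hz)).differentiableAt one_ne_zero

/-- Localization: the flux conditions are linear and pointwise, and `ρ` is continuous across the
axis. The divergence gains `∇ρ · (P, Q)`, which is why a sealed field carries the integrability of
its components. -/
theorem IsSealedField.mul (h : IsRegion Ω a b γ) (hf : IsSealedField Ω a b γ P Q) {ρ : ℂ → ℝ}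
    (hρ : ContDiff ℝ 1 ρ) (cρ : HasCompactSupport ρ) :
    IsSealedField Ω a b γ (fun z => ρ z * P z) (fun z => ρ z * Q z) := by
  obtain ⟨C, hC⟩ := hρ.continuous.bounded_above_of_compact_support cρ
  have hbdd : ∀ {f : ℂ → ℝ}, IntegrableOn f Ω → IntegrableOn (fun z => ρ z * f z) Ω :=
    fun hf => hf.bdd_mul hρ.continuous.aestronglyMeasurable (.of_forall hC)
  have hbdd' : ∀ v : ℂ, ∀ {f : ℂ → ℝ}, IntegrableOn f Ω →
      IntegrableOn (fun z => fderiv ℝ ρ z v * f z) Ω := by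
    intro v f hf
    have hc : Continuous (fun z => fderiv ℝ ρ z v) :=
      (hρ.continuous_fderiv one_ne_zero).clm_apply continuous_const
    obtain ⟨C', hC'⟩ := hc.bounded_above_of_compact_support (cρ.fderiv_apply ℝ v)
    exact hf.bdd_mul hc.aestronglyMeasurable (.of_forall hC')
  refine ⟨hρ.contDiffOn.mul hf.contDiffOn_fst, hρ.contDiffOn.mul hf.contDiffOn_snd, ?_, ?_, ?_, ?_,
    hbdd hf.integrableOn_fst, hbdd hf.integrableOn_snd, ?_⟩
  · intro q hq
    filter_upwards [hf.eventually_zero q hq] with z hz hzΩ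
    simp [hz hzΩ]
  · intro t ht
    obtain ⟨P₀, Q₀, h1, h2, h3⟩ := hf.curve t ht
    have h4 : Tendsto ρ (𝓝[Ω \ posAxis] (γ t)) (𝓝 (ρ (γ t))) :=
      hρ.continuous.continuousAt.tendsto.mono_left nhdsWithin_le_nhds
    exact ⟨_, _, h4.mul h1, h4.mul h2, by rw [mul_assoc, h3, mul_assoc]⟩
  · intro x hx
    have h4 : Tendsto ρ (𝓝[Ω ∩ upper] (x : ℂ)) (𝓝 (ρ x)) :=
      hρ.continuous.continuousAt.tendsto.mono_left nhdsWithin_le_nhds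
    simpa using h4.mul (hf.reflecting x hx)
  · intro x hx
    obtain ⟨Q₀, h1, h2⟩ := hf.passing x hx
    have h4 : Tendsto ρ (𝓝 (x : ℂ)) (𝓝 (ρ x)) := hρ.continuous.continuousAt.tendsto
    exact ⟨_, (h4.mono_left nhdsWithin_le_nhds).mul h1, (h4.mono_left nhdsWithin_le_nhds).mul h2⟩
  · rw [← integrableOn_sdiff_posAxis]
    refine IntegrableOn.congr_fun (f := fun z => ρ z * planeDiv P Q z +
      (fderiv ℝ ρ z 1 * P z + fderiv ℝ ρ z Complex.I * Q z)) ?_ (fun z hz => ?_)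
      h.isOpen_slit.measurableSet
    · rw [integrableOn_sdiff_posAxis]
      exact (hbdd hf.integrableOn_div).add
        ((hbdd' _ hf.integrableOn_fst).add (hbdd' _ hf.integrableOn_snd))
    · exact (planeDiv_mul (hρ.differentiable one_ne_zero z) (hf.differentiableAt_fst h hz)
        (hf.differentiableAt_snd h hz)).symm

/-- The integral of the divergence of a field supported in `K ⊆ D` can be taken over `D`. -/
theorem setIntegral_planeDiv_eq_inter {W D K : Set ℂ} (hW : IsOpen W)
    (hK : IsClosed K) (hKD : K ⊆ D) (h0 : ∀ z ∈ W, z ∉ K → P z = 0 ∧ Q z = 0) :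
    ∫ z in W, planeDiv P Q z = ∫ z in D ∩ W, planeDiv P Q z := by
  refine setIntegral_eq_of_subset_of_forall_sdiff_eq_zero hW.measurableSet inter_subset_right ?_
  rintro z ⟨hz, hzD⟩
  have hzK : z ∉ K := fun h => hzD ⟨hKD h, hz⟩
  have hn : ∀ᶠ w in 𝓝 z, P w = 0 ∧ Q w = 0 := by
    filter_upwards [hW.mem_nhds hz, hK.isOpen_compl.mem_nhds hzK] with w h1 h2 using h0 w h1 h2
  have h1 : P =ᶠ[𝓝 z] fun _ => 0 := hn.mono fun w hw => hw.1
  have h2 : Q =ᶠ[𝓝 z] fun _ => 0 := hn.mono fun w hw => hw.2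
  simp [planeDiv, h1.fderiv_eq, h2.fderiv_eq]

theorem fderiv_im (z v : ℂ) : fderiv ℝ (fun z : ℂ => z.im) z v = v.im := by
  have : HasFDerivAt (fun z : ℂ => z.im) Complex.imCLM z := Complex.imCLM.hasFDerivAt
  rw [this.fderiv]
  rfl

theorem planeDiv_conj (P Q : ℂ → ℝ) (z : ℂ) :
    planeDiv (fun z => P (starRingEnd ℂ z)) (fun z => -Q (starRingEnd ℂ z)) z =
      planeDiv P Q (starRingEnd ℂ z) := by
  have key : ∀ f : ℂ → ℝ, ∀ v, fderiv ℝ (fun z => f (starRingEnd ℂ z)) z v =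
      fderiv ℝ f (starRingEnd ℂ z) (starRingEnd ℂ v) := by
    intro f v
    have := Complex.conjCLE.comp_right_fderiv (f := f) (x := z)
    exact congrArg (fun L => L v) this
  simp only [planeDiv]
  rw [fderiv_fun_neg]
  simp [key]

theorem setIntegral_conj (f : ℂ → ℝ) (S : Set ℂ) :
    ∫ z in starRingEnd ℂ ⁻¹' S, f (starRingEnd ℂ z) = ∫ z in S, f z :=
  (Complex.conjLIE.measurePreserving).setIntegral_preimage_emb
    Complex.conjLIE.toHomeomorph.measurableEmbedding f S

/-- Here and in the next local versions, `D` depends on the point but not on the field, so that the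
partition of unity can be chosen afterwards. -/
theorem IsSealedField.integral_eq_zero_of_curve (h : IsRegion Ω a b γ) {t : ℝ}
    (ht : t ∈ Ioo (0 : ℝ) 1) :
    ∃ D : Set ℂ, IsOpen D ∧ Bornology.IsBounded D ∧ γ t ∈ D ∧
      ∀ P Q : ℂ → ℝ, IsSealedField Ω a b γ P Q → ∀ K ⊆ D, IsCompact K →
      (∀ z ∈ Ω \ posAxis, z ∉ K → P z = 0 ∧ Q z = 0) → ∫ z in Ω, planeDiv P Q z = 0 := by
  obtain ⟨D, s, C, hD, hDb, htD, hs, hΩ, hdisj, hzero, hvol⟩ := h.exists_chart ht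
  refine ⟨D, hD, hDb, htD, fun P Q hf K hKD hK h0 => ?_⟩
  have hsub : D ∩ (Ω \ posAxis) = D ∩ {z | 0 < s z} := by
    rw [← hΩ, ← inter_sdiff_assoc, sdiff_eq_left]
    exact hdisj.mono_left inter_subset_left
  have hsub' : D ∩ {z | 0 < s z} ⊆ Ω \ posAxis := hsub ▸ inter_subset_right
  rw [← setIntegral_sdiff_posAxis, setIntegral_planeDiv_eq_inter h.isOpen_slit hK.isClosed hKD
    h0, hsub]
  refine setIntegral_planeDiv_eq_zero hD hs hK hKD (hf.contDiffOn_fst.mono hsub')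
    (hf.contDiffOn_snd.mono hsub') (fun z hz hzK => (h0 z (hsub' hz) hzK).1)
    (fun z hz hzK => (h0 z (hsub' hz) hzK).2) ?_
    (hf.integrableOn_div.mono_set (hsub'.trans sdiff_subset)) (C := C) ?_
  · intro q hqK hq0
    obtain ⟨τ, hτ, rfl, hd⟩ := hzero q (hKD hqK) hq0
    obtain ⟨P₀, Q₀, hP, hQ, hPQ⟩ := hf.curve τ hτ
    have hc : ContinuousAt (fderiv ℝ s) (γ τ) :=
      (hs.continuousOn_fderiv_of_isOpen hD le_rfl).continuousAt (hD.mem_nhds (hKD hqK))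
    have hcv : ∀ v : ℂ, Tendsto (fun z => fderiv ℝ s z v) (𝓝[D ∩ {z | 0 < s z}] (γ τ))
        (𝓝 (fderiv ℝ s (γ τ) v)) := fun v =>
      ((hc.clm_apply continuousAt_const).tendsto).mono_left nhdsWithin_le_nhds
    have hlim := ((hP.mono_left (nhdsWithin_mono _ hsub')).mul (hcv 1)).add
      ((hQ.mono_left (nhdsWithin_mono _ hsub')).mul (hcv Complex.I))
    convert hlim using 2
    set L := fderiv ℝ s (γ τ)
    set d := deriv γ τ with hdd
    have hd' : d.re * L 1 + d.im * L Complex.I = 0 := by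
      have h1 : d = d.re • (1 : ℂ) + d.im • Complex.I := by
        simp [Complex.re_add_im]
      rw [h1, map_add, map_smul, map_smul] at hd
      simpa using hd
    have hd0 : d ≠ 0 := h.deriv_ne_zero τ hτ
    have hsq : d.re * d.re + d.im * d.im ≠ 0 := by
      intro h0
      exact hd0 (Complex.normSq_eq_zero.1 (by rw [Complex.normSq_apply]; exact h0))
    -- The limit field is parallel to the tangent `d` and the gradient of `s` is orthogonal to `d`;
    -- multiplying by `|d|² ≠ 0` expresses this without division.
    have : (d.re * d.re + d.im * d.im) * (P₀ * L 1 + Q₀ * L Complex.I) = 0 := by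
      linear_combination (P₀ * d.re + Q₀ * d.im) * hd' + (d.im * L 1 - d.re * L Complex.I) * hPQ
    exact ((mul_eq_zero.1 this).resolve_left hsq).symm
  · intro ε hε
    exact (measure_mono (inter_subset_inter_left _ hKD)).trans (hvol ε hε)

theorem IsSealedField.integral_eq_zero_of_interior (h : IsRegion Ω a b γ) {q : ℂ}
    (hq : q ∈ Ω \ posAxis) :
    ∃ D : Set ℂ, IsOpen D ∧ Bornology.IsBounded D ∧ q ∈ D ∧
      ∀ P Q : ℂ → ℝ, IsSealedField Ω a b γ P Q → ∀ K ⊆ D, IsCompact K →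
      (∀ z ∈ Ω \ posAxis, z ∉ K → P z = 0 ∧ Q z = 0) → ∫ z in Ω, planeDiv P Q z = 0 := by
  refine ⟨Ω \ posAxis, h.isOpen_slit, h.isBounded.subset sdiff_subset, hq,
    fun P Q hf K hKD hK h0 => ?_⟩
  rw [← setIntegral_sdiff_posAxis]
  -- With `s = 1` there is no boundary. The strip is empty for `ε ≤ 1` and is all of `K` for `ε >
  -- 1`, hence the constant `volume K`.
  have key := setIntegral_planeDiv_eq_zero (D := Ω \ posAxis) (s := fun _ => 1) (P := P) (Q := Q)
    (C := (volume K).toReal) h.isOpen_slit contDiffOn_const hK hKD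
  have huniv : Ω \ posAxis ∩ {z : ℂ | (0 : ℝ) < 1} = Ω \ posAxis := by simp
  rw [huniv] at key
  refine key hf.contDiffOn_fst hf.contDiffOn_snd (fun z hz hzK => (h0 z hz hzK).1)
    (fun z hz hzK => (h0 z hz hzK).2) (by simp) (hf.integrableOn_div.mono_set sdiff_subset) ?_
  intro ε hε
  rcases le_or_gt ε 1 with h1 | h1
  · have : {z : ℂ | (0 : ℝ) < 1 ∧ 1 < ε} = ∅ := by
      ext z
      simp [h1]
    rw [this, inter_empty, measure_empty]
    exact zero_le
  · calc volume (K ∩ {z : ℂ | (0 : ℝ) < 1 ∧ 1 < ε}) ≤ volume K := measure_mono inter_subset_left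
      _ = ENNReal.ofReal (volume K).toReal := (ENNReal.ofReal_toReal hK.measure_lt_top.ne).symm
      _ ≤ ENNReal.ofReal ((volume K).toReal * ε) :=
        ENNReal.ofReal_le_ofReal (le_mul_of_one_le_right ENNReal.toReal_nonneg h1.le)

/-- The case of a half-disc: a field with vanishing vertical component on the real axis. -/
theorem setIntegral_planeDiv_half_ball {q : ℂ} {r : ℝ} {K : Set ℂ} (hK : IsCompact K)
    (hKD : K ⊆ Metric.ball q r) (hP : ContDiffOn ℝ 1 P (Metric.ball q r ∩ upper))
    (hQ : ContDiffOn ℝ 1 Q (Metric.ball q r ∩ upper))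
    (h0 : ∀ z ∈ Metric.ball q r ∩ upper, z ∉ K → P z = 0 ∧ Q z = 0)
    (hlim : ∀ w ∈ K, w.im = 0 → Tendsto Q (𝓝[Metric.ball q r ∩ upper] w) (𝓝 0))
    (hint : IntegrableOn (planeDiv P Q) (Metric.ball q r ∩ upper)) :
    ∫ z in Metric.ball q r ∩ upper, planeDiv P Q z = 0 := by
  refine setIntegral_planeDiv_eq_zero (s := fun z => z.im) (C := 2 * |r|) Metric.isOpen_ball
    Complex.imCLM.contDiff.contDiffOn hK hKD hP hQ (fun z hz hzK => (h0 z hz hzK).1)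
    (fun z hz hzK => (h0 z hz hzK).2) ?_ hint ?_
  · intro w hw hw0
    simp only [fderiv_im]
    simp only [Complex.one_im, Complex.I_im, mul_zero, mul_one, zero_add]
    exact hlim w hw hw0
  · intro ε hε
    refine (measure_mono ?_).trans (volume_ball_strip_le q r ε)
    rintro z ⟨hz, hz'⟩
    exact ⟨hKD hz, hz'⟩

theorem IsSealedField.integral_eq_zero_of_reflecting (h : IsRegion Ω a b γ) {x : ℝ}
    (hx : x ∈ Ioo a b) :
    ∃ D : Set ℂ, IsOpen D ∧ Bornology.IsBounded D ∧ (x : ℂ) ∈ D ∧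
      ∀ P Q : ℂ → ℝ, IsSealedField Ω a b γ P Q → ∀ K ⊆ D, IsCompact K →
      (∀ z ∈ Ω \ posAxis, z ∉ K → P z = 0 ∧ Q z = 0) → ∫ z in Ω, planeDiv P Q z = 0 := by
  obtain ⟨r, hr, hΩ, hre⟩ := h.exists_ball_reflecting hx
  refine ⟨Metric.ball x r, Metric.isOpen_ball, Metric.isBounded_ball, Metric.mem_ball_self hr,
    fun P Q hf K hKD hK h0 => ?_⟩
  have hsub : Metric.ball (x : ℂ) r ∩ (Ω \ posAxis) = Metric.ball (x : ℂ) r ∩ upper := by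
    rw [← inter_sdiff_assoc, hΩ, sdiff_eq_left]
    exact disjoint_upper_posAxis.mono_left inter_subset_right
  have hsub' : Metric.ball (x : ℂ) r ∩ upper ⊆ Ω \ posAxis := hsub ▸ inter_subset_right
  rw [← setIntegral_sdiff_posAxis, setIntegral_planeDiv_eq_inter h.isOpen_slit
    hK.isClosed hKD h0, hsub]
  refine setIntegral_planeDiv_half_ball hK hKD (hf.contDiffOn_fst.mono hsub')
    (hf.contDiffOn_snd.mono hsub') (fun z hz => h0 z (hsub' hz)) ?_
    (hf.integrableOn_div.mono_set (hsub'.trans sdiff_subset))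
  intro w hw hw0
  have hwr : w = (w.re : ℂ) := by apply Complex.ext <;> simp [hw0]
  have := hf.reflecting w.re (hre w (hKD hw))
  rw [← hwr] at this
  exact this.mono_left (nhdsWithin_mono _ fun z hz => ⟨(hsub' hz).1, hz.2⟩)

/-- Reflecting the lower half-disc and adding turns the balance of the two sides into a vanishing
condition: the folded field has vertical component `Q z - Q z̄`, which tends to `0` on the axis. -/
theorem IsSealedField.integral_eq_zero_of_passing (h : IsRegion Ω a b γ) {x : ℝ}
    (hx : x ∈ Ioo 0 a) :
    ∃ D : Set ℂ, IsOpen D ∧ Bornology.IsBounded D ∧ (x : ℂ) ∈ D ∧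
      ∀ P Q : ℂ → ℝ, IsSealedField Ω a b γ P Q → ∀ K ⊆ D, IsCompact K →
      (∀ z ∈ Ω \ posAxis, z ∉ K → P z = 0 ∧ Q z = 0) → ∫ z in Ω, planeDiv P Q z = 0 := by
  obtain ⟨r, hr, hΩ, hre⟩ := h.exists_ball_passing hx
  refine ⟨Metric.ball x r, Metric.isOpen_ball, Metric.isBounded_ball, Metric.mem_ball_self hr,
    fun P Q hf K hKD hK h0 => ?_⟩
  set B := Metric.ball (x : ℂ) r with hB
  have hBc : ∀ z, starRingEnd ℂ z ∈ B ↔ z ∈ B := by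
    intro z
    have : dist (starRingEnd ℂ z) (x : ℂ) = dist z x := by
      rw [← Complex.conj_ofReal x, Complex.dist_conj_conj, Complex.conj_ofReal]
    simp [hB, Metric.mem_ball, this]
  have hu : B ∩ upper ⊆ Ω \ posAxis := fun z hz =>
    ⟨hΩ hz.1, Set.disjoint_left.1 disjoint_upper_posAxis hz.2⟩
  have hl : B ∩ lower ⊆ Ω \ posAxis := fun z hz =>
    ⟨hΩ hz.1, Set.disjoint_left.1 disjoint_lower_posAxis hz.2⟩
  have hsub : B ∩ (Ω \ posAxis) = (B ∩ upper) ∪ (B ∩ lower) := by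
    ext z
    constructor
    · rintro ⟨hzB, hzΩ, hzp⟩
      rcases lt_trichotomy z.im 0 with hi | hi | hi
      · exact Or.inr ⟨hzB, hi⟩
      · exact absurd ⟨(hre z hzB).1.le, hi⟩ hzp
      · exact Or.inl ⟨hzB, hi⟩
    · rintro (hz | hz)
      · exact ⟨hz.1, hu hz⟩
      · exact ⟨hz.1, hl hz⟩
  have hconj : starRingEnd ℂ ⁻¹' (B ∩ lower) = B ∩ upper := by
    ext z
    simp only [mem_preimage, mem_inter_iff, hBc, lower, upper, mem_ofPred_eq, Complex.conj_im,
      neg_neg_iff_pos]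
  have hdisj : Disjoint (B ∩ upper) (B ∩ lower) := by
    rw [Set.disjoint_left]
    rintro z ⟨_, h1⟩ ⟨_, h2⟩
    exact lt_asymm (show 0 < z.im from h1) h2
  have hcu : ∀ {z}, z ∈ B ∩ upper → starRingEnd ℂ z ∈ B ∩ lower := fun {z} hz => by
    rw [← hconj] at hz
    exact hz
  have hBu : IsOpen (B ∩ upper) := Metric.isOpen_ball.inter isOpen_upper
  have hBl : IsOpen (B ∩ lower) := Metric.isOpen_ball.inter isOpen_lower
  have hconjd : ContDiff ℝ 1 (starRingEnd ℂ : ℂ → ℂ) := Complex.conjCLE.contDiff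
  have hPc : ContDiffOn ℝ 1 (fun z => P (starRingEnd ℂ z)) (B ∩ upper) :=
    (hf.contDiffOn_fst.mono hl).comp hconjd.contDiffOn fun z hz => hcu hz
  have hQc : ContDiffOn ℝ 1 (fun z => -Q (starRingEnd ℂ z)) (B ∩ upper) :=
    ((hf.contDiffOn_snd.mono hl).comp hconjd.contDiffOn fun z hz => hcu hz).neg
  have hiu : IntegrableOn (planeDiv P Q) (B ∩ upper) :=
    hf.integrableOn_div.mono_set (hu.trans sdiff_subset)
  have hil : IntegrableOn (planeDiv P Q) (B ∩ lower) :=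
    hf.integrableOn_div.mono_set (hl.trans sdiff_subset)
  have hilc : IntegrableOn (fun z => planeDiv P Q (starRingEnd ℂ z)) (B ∩ upper) := by
    have := (Complex.conjLIE.measurePreserving.integrableOn_comp_preimage
      Complex.conjLIE.toHomeomorph.measurableEmbedding (f := planeDiv P Q) (s := B ∩ lower)).2 hil
    rw [← hconj]
    exact this
  have hsum : ∀ z ∈ B ∩ upper,
      planeDiv (fun z => P z + P (starRingEnd ℂ z)) (fun z => Q z + -Q (starRingEnd ℂ z)) z =
      planeDiv P Q z + planeDiv P Q (starRingEnd ℂ z) := by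
    intro z hz
    rw [← planeDiv_conj]
    simp only [planeDiv]
    have hd : ∀ {f : ℂ → ℝ}, ContDiffOn ℝ 1 f (B ∩ upper) → DifferentiableAt ℝ f z := fun hf =>
      (hf.contDiffAt (hBu.mem_nhds hz)).differentiableAt one_ne_zero
    rw [fderiv_fun_add (hf.differentiableAt_fst h (hu hz)) (hd hPc),
      fderiv_fun_add (hf.differentiableAt_snd h (hu hz)) (hd hQc), add_apply, add_apply]
    ring
  rw [← setIntegral_sdiff_posAxis, setIntegral_planeDiv_eq_inter h.isOpen_slit
    hK.isClosed hKD h0, hsub, setIntegral_union hdisj hBl.measurableSet hiu hil,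
    ← setIntegral_conj _ (B ∩ lower), hconj, ← integral_add hiu hilc,
    ← setIntegral_congr_fun hBu.measurableSet hsum]
  have hKc : IsCompact (starRingEnd ℂ ⁻¹' K) :=
    Complex.conjLIE.toHomeomorph.isCompact_preimage.2 hK
  refine setIntegral_planeDiv_half_ball (hK.union hKc)
    (union_subset hKD fun z hz => (hBc z).1 (hKD hz)) ((hf.contDiffOn_fst.mono hu).add hPc)
    ((hf.contDiffOn_snd.mono hu).add hQc) ?_ ?_ ?_
  · intro z hz hzK
    rw [mem_union, not_or] at hzK
    have h1 := h0 z (hu hz) hzK.1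
    have h2 := h0 _ (hl (hcu hz)) hzK.2
    simp [h1, h2]
  · intro w hw hw0
    have hwB : w ∈ B := hw.elim (fun h => hKD h) fun h => (hBc w).1 (hKD h)
    have hwr : w = (w.re : ℂ) := by apply Complex.ext <;> simp [hw0]
    obtain ⟨Q₀, h1, h2⟩ := hf.passing w.re (hre w hwB)
    rw [← hwr] at h1 h2
    have h3 : Tendsto (fun z => starRingEnd ℂ z) (𝓝[B ∩ upper] w) (𝓝[Ω ∩ lower] w) := by
      refine tendsto_nhdsWithin_iff.2 ⟨?_, ?_⟩
      · have hc : Tendsto (fun z => starRingEnd ℂ z) (𝓝 w) (𝓝 (starRingEnd ℂ w)) :=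
          Complex.continuous_conj.tendsto w
        rw [Complex.conj_eq_iff_im.2 hw0] at hc
        exact hc.mono_left nhdsWithin_le_nhds
      · filter_upwards [self_mem_nhdsWithin] with z hz
        exact ⟨(hl (hcu hz)).1, (hcu hz).2⟩
    have h4 := (h1.mono_left (nhdsWithin_mono _ fun z hz => ⟨(hu hz).1, hz.2⟩)).add
      ((h2.comp h3).neg)
    simpa using h4
  · exact (hiu.add hilc).congr_fun (fun z hz => (hsum z hz).symm) hBu.measurableSet

/-- The divergence theorem for a sealed field. -/
theorem IsSealedField.integral_eq_zero (h : IsRegion Ω a b γ) (hf : IsSealedField Ω a b γ P Q) :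
    ∫ z in Ω, planeDiv P Q z = 0 := by
  have hloc : ∀ q ∈ closure Ω, ∃ D : Set ℂ, IsOpen D ∧ Bornology.IsBounded D ∧ q ∈ D ∧
      ∀ ρ : ℂ → ℝ, ContDiff ℝ 1 ρ → tsupport ρ ⊆ D →
        ∫ z in Ω, planeDiv (fun z => ρ z * P z) (fun z => ρ z * Q z) z = 0 := by
    intro q hq
    have hred : (∃ D : Set ℂ, IsOpen D ∧ Bornology.IsBounded D ∧ q ∈ D ∧
        ∀ P Q : ℂ → ℝ, IsSealedField Ω a b γ P Q → ∀ K ⊆ D, IsCompact K →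
        (∀ z ∈ Ω \ posAxis, z ∉ K → P z = 0 ∧ Q z = 0) → ∫ z in Ω, planeDiv P Q z = 0) →
        ∃ D : Set ℂ, IsOpen D ∧ Bornology.IsBounded D ∧ q ∈ D ∧
        ∀ ρ : ℂ → ℝ, ContDiff ℝ 1 ρ → tsupport ρ ⊆ D →
          ∫ z in Ω, planeDiv (fun z => ρ z * P z) (fun z => ρ z * Q z) z = 0 := by
      rintro ⟨D, hD, hDb, hqD, hint⟩
      refine ⟨D, hD, hDb, hqD, fun ρ hρ hsupp => ?_⟩
      have hc : IsCompact (tsupport ρ) :=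
        Metric.isCompact_of_isClosed_isBounded (isClosed_tsupport ρ) (hDb.subset hsupp)
      refine hint _ _ (hf.mul h hρ hc) (tsupport ρ) hsupp hc fun z _ hz => ?_
      simp [image_eq_zero_of_notMem_tsupport hz]
    rcases h.cases_closure hq with hq | ⟨t, ht, rfl⟩ | hq | ⟨x, hx, rfl⟩ | ⟨x, hx, rfl⟩
    · exact hred (IsSealedField.integral_eq_zero_of_interior h hq)
    · exact hred (IsSealedField.integral_eq_zero_of_curve h ht)
    · obtain ⟨r, hr, hball⟩ := Metric.mem_nhds_iff.1 (hf.eventually_zero q hq)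
      refine ⟨Metric.ball q r, Metric.isOpen_ball, Metric.isBounded_ball, Metric.mem_ball_self hr,
        fun ρ hρ hsupp => ?_⟩
      have h0 : ∀ z ∈ Ω \ posAxis, ρ z * P z = 0 ∧ ρ z * Q z = 0 := by
        intro z hz
        by_cases hzs : z ∈ tsupport ρ
        · simp [(hball (hsupp hzs)) hz]
        · simp [image_eq_zero_of_notMem_tsupport hzs]
      -- The localized field vanishes identically here, so the empty set serves as its support.
      rw [← setIntegral_sdiff_posAxis, setIntegral_planeDiv_eq_inter h.isOpen_slit
        isClosed_empty subset_rfl (fun z hz _ => h0 z hz)]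
      simp
    · exact hred (IsSealedField.integral_eq_zero_of_passing h hx)
    · exact hred (IsSealedField.integral_eq_zero_of_reflecting h hx)
  choose! D hDo hDb hqD hD using hloc
  have hcomp : IsCompact (closure Ω) := h.isBounded.isCompact_closure
  obtain ⟨T, hTK, hT⟩ := hcomp.elim_nhds_subcover D fun q hq => (hDo q hq).mem_nhds (hqD q hq)
  obtain ⟨f, hfsub⟩ := SmoothPartitionOfUnity.exists_isSubordinate (modelWithCornersSelf ℝ ℂ)
    (isClosed_closure (s := Ω)) (fun q : T => D q) (fun q => hDo q (hTK q q.2)) (by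
      intro z hz
      obtain ⟨q, hq, hzq⟩ := mem_iUnion₂.1 (hT hz)
      exact mem_iUnion.2 ⟨⟨q, hq⟩, hzq⟩)
  have hfc : ∀ q : T, ContDiff ℝ 1 (f q) := fun q =>
    (contMDiff_iff_contDiff.1 (f q).contMDiff).of_le (by simp)
  have hfcs : ∀ q : T, HasCompactSupport (f q) := fun q =>
    Metric.isCompact_of_isClosed_isBounded (isClosed_tsupport _)
      ((hDb q (hTK q q.2)).subset (hfsub q))
  have hsum : ∀ z ∈ Ω, ∑ q : T, f q z = 1 := by
    intro z hz
    rw [← finsum_eq_sum_of_fintype]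
    exact f.sum_eq_one (subset_closure hz)
  have hdiv : ∀ z ∈ Ω \ posAxis, planeDiv P Q z =
      ∑ q : T, planeDiv (fun z => f q z * P z) (fun z => f q z * Q z) z := by
    intro z hz
    have hPz := hf.differentiableAt_fst h hz
    have hQz := hf.differentiableAt_snd h hz
    have hfz : ∀ q : T, DifferentiableAt ℝ (f q) z := fun q =>
      (hfc q).differentiable one_ne_zero z
    have key : ∀ {R : ℂ → ℝ}, DifferentiableAt ℝ R z → ∀ v,
        fderiv ℝ R z v = ∑ q : T, fderiv ℝ (fun z => f q z * R z) z v := by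
      intro R hR v
      have he : R =ᶠ[𝓝 z] fun z => ∑ q : T, f q z * R z := by
        filter_upwards [h.isOpen.mem_nhds hz.1] with w hw
        rw [← Finset.sum_mul, hsum w hw, one_mul]
      rw [he.fderiv_eq, fderiv_fun_sum fun q _ => (hfz q).fun_mul hR]
      simp
    simp only [planeDiv]
    rw [key hPz, key hQz, ← Finset.sum_add_distrib]
  rw [← setIntegral_sdiff_posAxis, setIntegral_congr_fun h.isOpen_slit.measurableSet hdiv,
    integral_finsetSum _ fun q _ =>
      (hf.mul h (hfc q) (hfcs q)).integrableOn_div.mono_set sdiff_subset]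
  refine Finset.sum_eq_zero fun q _ => ?_
  rw [setIntegral_sdiff_posAxis]
  exact hD q (hTK q q.2) (f q) (hfc q) (hfsub q)

end HeleShaw
end

/-! ### The cut off test function and the divergence of its flux field. -/

noncomputable section

namespace HeleShaw

/-- The real-linear form `v ↦ Re (g v)`. -/
def reMul (g : ℂ) : ℂ →L[ℝ] ℝ := Complex.reCLM.comp (ContinuousLinearMap.mul ℝ ℂ g)

@[simp] theorem reMul_apply (g v : ℂ) : reMul g v = (g * v).re := rfl

theorem hasFDerivAt_re {f : ℂ → ℂ} {f' z : ℂ} (h : HasDerivAt f f' z) :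
    HasFDerivAt (fun z => (f z).re) (reMul f') z := by
  refine (Complex.reCLM.hasFDerivAt.comp z (h.hasFDerivAt.restrictScalars ℝ)).congr_fderiv ?_
  ext v
  simp [mul_comm]

theorem hasFDerivAt_im {f : ℂ → ℂ} {f' z : ℂ} (h : HasDerivAt f f' z) :
    HasFDerivAt (fun z => (f z).im) (reMul (-Complex.I * f')) z := by
  refine (Complex.imCLM.hasFDerivAt.comp z (h.hasFDerivAt.restrictScalars ℝ)).congr_fderiv ?_
  ext v
  simp
  ring

theorem hasFDerivAt_log_norm_sub {z p : ℂ} (h : z ≠ p) :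
    HasFDerivAt (fun z => Real.log ‖z - p‖) (reMul (z - p)⁻¹) z := by
  have hz : z - p ≠ 0 := sub_ne_zero.2 h
  have h1 : HasFDerivAt (fun z : ℂ => ‖z - p‖ ^ 2) _ z :=
    ((hasFDerivAt_id z).sub_const p).norm_sq
  have h2 := (h1.log (by positivity)).const_mul (1 / 2 : ℝ)
  have h3 : (fun z : ℂ => Real.log ‖z - p‖) = fun z => 1 / 2 * Real.log (‖z - p‖ ^ 2) := by
    funext z
    rw [Real.log_pow]
    push_cast
    ring
  rw [h3]
  refine h2.congr_fderiv ?_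
  ext v
  have hn : ‖z - p‖ ^ 2 = Complex.normSq (z - p) := (Complex.normSq_eq_norm_sq _).symm
  simp [Complex.inner, hn]
  ring

theorem contDiffAt_log_norm_sub {z p : ℂ} (h : z ≠ p) :
    ContDiffAt ℝ 1 (fun z => Real.log ‖z - p‖) z :=
  ((contDiffAt_id.sub contDiffAt_const).norm ℝ (sub_ne_zero.2 h)).log
    (norm_ne_zero_iff.2 (sub_ne_zero.2 h))

/-- A harmonic function with logarithmic poles at `0`, `a`, `b`. -/
def logWeight (a b : ℝ) (z : ℂ) : ℝ :=
  Real.log ‖z - 0‖ + Real.log ‖z - a‖ + Real.log ‖z - b‖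

/-- The complex derivative of the holomorphic completion of `logWeight`. -/
def logWeightDeriv (a b : ℝ) (z : ℂ) : ℂ := (z - 0)⁻¹ + (z - a)⁻¹ + (z - b)⁻¹

/-- The exceptional points. -/
def corners (a b : ℝ) : Set ℂ := {0, (a : ℂ), (b : ℂ)}

theorem isClosed_corners (a b : ℝ) : IsClosed (corners a b) := by
  unfold corners
  exact (Set.toFinite _).isClosed

theorem notMem_corners {a b : ℝ} {z : ℂ} :
    z ∉ corners a b ↔ z ≠ 0 ∧ z ≠ (a : ℂ) ∧ z ≠ (b : ℂ) := by
  simp [corners]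

variable {a b : ℝ} {z : ℂ}

theorem hasFDerivAt_logWeight (h : z ∉ corners a b) :
    HasFDerivAt (logWeight a b) (reMul (logWeightDeriv a b z)) z := by
  obtain ⟨h0, ha, hb⟩ := notMem_corners.1 h
  refine (((hasFDerivAt_log_norm_sub h0).add (hasFDerivAt_log_norm_sub ha)).add
    (hasFDerivAt_log_norm_sub hb)).congr_fderiv ?_
  ext v
  simp only [logWeightDeriv, add_apply, reMul_apply, add_mul, Complex.add_re]

theorem contDiffAt_logWeight (h : z ∉ corners a b) : ContDiffAt ℝ 1 (logWeight a b) z := by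
  obtain ⟨h0, ha, hb⟩ := notMem_corners.1 h
  exact ((contDiffAt_log_norm_sub h0).add (contDiffAt_log_norm_sub ha)).add
    (contDiffAt_log_norm_sub hb)

theorem differentiableOn_logWeightDeriv :
    DifferentiableOn ℂ (logWeightDeriv a b) (corners a b)ᶜ := by
  intro z hz
  obtain ⟨h0, ha, hb⟩ := notMem_corners.1 hz
  refine DifferentiableAt.differentiableWithinAt ?_
  unfold logWeightDeriv
  have key : ∀ p : ℂ, z ≠ p → DifferentiableAt ℂ (fun z => (z - p)⁻¹) z := fun p hp =>
    (differentiableAt_id.sub_const p).inv (sub_ne_zero.2 hp)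
  exact ((key _ h0).add (key _ ha)).add (key _ hb)

theorem hasDerivAt_logWeightDeriv (h : z ∉ corners a b) :
    HasDerivAt (logWeightDeriv a b) (deriv (logWeightDeriv a b) z) z :=
  (differentiableOn_logWeightDeriv.differentiableAt
    ((isClosed_corners a b).isOpen_compl.mem_nhds h)).hasDerivAt

theorem contDiffAt_real_of_differentiableOn {f : ℂ → ℂ} {U : Set ℂ} (hU : IsOpen U)
    (hf : DifferentiableOn ℂ f U) (hz : z ∈ U) : ContDiffAt ℝ 1 f z :=
  ((hf.contDiffOn hU).contDiffAt (hU.mem_nhds hz)).restrict_scalars ℝ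

/-- The three poles are distinct, so one logarithm diverges and the other two converge. Hence a
cutoff in terms of `logWeight` removes neighbourhoods of all three corners. -/
theorem tendsto_logWeight_atBot {q : ℂ} (ha : 0 < a) (hab : a < b) (hq : q ∈ corners a b) :
    Tendsto (logWeight a b) (𝓝[≠] q) atBot := by
  have hpole : ∀ p : ℂ, Tendsto (fun z => Real.log ‖z - p‖) (𝓝[≠] p) atBot := by
    intro p
    refine Real.tendsto_log_nhdsGT_zero.comp (tendsto_nhdsWithin_iff.2 ⟨?_, ?_⟩)
    · have : Tendsto (fun z : ℂ => ‖z - p‖) (𝓝 p) (𝓝 ‖p - p‖) :=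
        (continuous_id.sub continuous_const).norm.tendsto p
      rw [sub_self, norm_zero] at this
      exact this.mono_left nhdsWithin_le_nhds
    · filter_upwards [self_mem_nhdsWithin] with z hz
      exact norm_pos_iff.2 (sub_ne_zero.2 hz)
  have hreg : ∀ q p : ℂ, q ≠ p →
      Tendsto (fun z => Real.log ‖z - p‖) (𝓝[≠] q) (𝓝 (Real.log ‖q - p‖)) := fun q p h =>
    (contDiffAt_log_norm_sub h).continuousAt.tendsto.mono_left nhdsWithin_le_nhds
  have ha0 : (a : ℂ) ≠ 0 := Complex.ofReal_ne_zero.2 ha.ne'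
  have hb0 : (b : ℂ) ≠ 0 := Complex.ofReal_ne_zero.2 (ha.trans hab).ne'
  have hab' : (a : ℂ) ≠ b := fun h => hab.ne (Complex.ofReal_injective h)
  rcases hq with rfl | rfl | rfl
  · exact ((hpole 0).atBot_add (hreg _ _ ha0.symm)).atBot_add (hreg _ _ hb0.symm)
  · exact ((hreg _ _ ha0).add_atBot (hpole _)).atBot_add (hreg _ _ hab')
  · exact ((hreg _ _ hb0).add (hreg _ _ hab'.symm)).add_atBot (hpole _)

/-- A smooth step, `0` for `t ≤ -2` and `1` for `t ≥ -1`. -/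
def cut (t : ℝ) : ℝ := Real.smoothTransition (t + 2)

theorem deriv_cut : deriv cut = fun t => deriv Real.smoothTransition (t + 2) := by
  funext t
  unfold cut
  exact deriv_comp_add_const ..

theorem deriv_deriv_cut :
    deriv (deriv cut) = fun t => deriv (deriv Real.smoothTransition) (t + 2) := by
  rw [deriv_cut]
  funext t
  exact deriv_comp_add_const ..

theorem cut_contDiff : ContDiff ℝ 3 cut :=
  Real.smoothTransition.contDiff.comp (contDiff_id.add contDiff_const)

theorem deriv_cut_contDiff : ContDiff ℝ 2 (deriv cut) :=
  ((contDiff_succ_iff_deriv (n := 2)).1 cut_contDiff).2.2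

theorem deriv_deriv_cut_contDiff : ContDiff ℝ 1 (deriv (deriv cut)) :=
  ((contDiff_succ_iff_deriv (n := 1)).1 deriv_cut_contDiff).2.2

theorem cut_eventuallyEq_zero {t : ℝ} (h : t < -2) : cut =ᶠ[𝓝 t] fun _ => 0 := by
  filter_upwards [Iio_mem_nhds h] with x hx
  exact Real.smoothTransition.zero_of_nonpos (by linarith [mem_Iio.1 hx])

theorem cut_eq_zero {t : ℝ} (h : t < -2) : cut t = 0 := (cut_eventuallyEq_zero h).eq_of_nhds

theorem deriv_cut_eventuallyEq_zero {t : ℝ} (h : t < -2) : deriv cut =ᶠ[𝓝 t] fun _ => 0 := by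
  have := (cut_eventuallyEq_zero h).deriv
  simpa using this

theorem deriv_cut_eq_zero {t : ℝ} (h : t < -2) : deriv cut t = 0 :=
  (deriv_cut_eventuallyEq_zero h).eq_of_nhds

theorem deriv_deriv_cut_eq_zero {t : ℝ} (h : t < -2) : deriv (deriv cut) t = 0 := by
  rw [(deriv_cut_eventuallyEq_zero h).deriv_eq, deriv_const]

theorem cut_eq_one {t : ℝ} (h : -1 ≤ t) : cut t = 1 :=
  Real.smoothTransition.one_of_one_le (by linarith)

theorem abs_cut_le (t : ℝ) : |cut t| ≤ 1 := by
  rw [cut, abs_of_nonneg (Real.smoothTransition.nonneg _)]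
  exact Real.smoothTransition.le_one _

/-- The test function `Re f` cut off near the exceptional points. -/
def testFun (a b L : ℝ) (f : ℂ → ℂ) (z : ℂ) : ℝ := (f z).re * cut (logWeight a b z / L)

/-- The conjugate of the gradient of `testFun`. -/
def testGrad (a b L : ℝ) (f : ℂ → ℂ) (z : ℂ) : ℂ :=
  (cut (logWeight a b z / L) : ℝ) * deriv f z +
    ((f z).re * (deriv cut (logWeight a b z / L) / L) : ℝ) * logWeightDeriv a b z

/-- The Laplacian of `testFun`. -/
def testLaplacian (a b L : ℝ) (f : ℂ → ℂ) (z : ℂ) : ℝ :=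
  2 * (deriv cut (logWeight a b z / L) / L) *
      ((deriv f z).re * (logWeightDeriv a b z).re + (deriv f z).im * (logWeightDeriv a b z).im) +
    (f z).re * (deriv (deriv cut) (logWeight a b z / L) / L ^ 2) * ‖logWeightDeriv a b z‖ ^ 2

/-- The horizontal component of the field to which the divergence theorem is applied. -/
def fluxX (a b L c : ℝ) (Φ : ℂ → ℝ) (f : ℂ → ℂ) (z : ℂ) : ℝ :=
  Φ z * (testGrad a b L f z).re - testFun a b L f z * (fderiv ℝ Φ z 1 - c * z.re)

/-- The vertical component of the field to which the divergence theorem is applied. -/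
def fluxY (a b L c : ℝ) (Φ : ℂ → ℝ) (f : ℂ → ℂ) (z : ℂ) : ℝ :=
  Φ z * (-(testGrad a b L f z).im) - testFun a b L f z * (fderiv ℝ Φ z Complex.I - c * z.im)

/-- The divergence of the field `(fluxX, fluxY)`. -/
def fluxDiv (a b L c : ℝ) (Φ : ℂ → ℝ) (f : ℂ → ℂ) (z : ℂ) : ℝ :=
  Φ z * testLaplacian a b L f z + c * ((z * testGrad a b L f z).re + 2 * testFun a b L f z)

variable {L c : ℝ} {f : ℂ → ℂ} {Φ : ℂ → ℝ} {U : Set ℂ}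

theorem hasFDerivAt_cut_logWeight (h : z ∉ corners a b) :
    HasFDerivAt (fun z => cut (logWeight a b z / L))
      ((deriv cut (logWeight a b z / L) / L) • reMul (logWeightDeriv a b z)) z := by
  have h1 : HasDerivAt cut (deriv cut (logWeight a b z / L)) (logWeight a b z / L) :=
    (cut_contDiff.differentiable (by norm_num) _).hasDerivAt
  have h2 := (hasFDerivAt_logWeight h).mul_const L⁻¹
  refine (h1.comp_hasFDerivAt z h2).congr_fderiv ?_
  ext v
  simp
  ring

theorem hasFDerivAt_deriv_cut_logWeight (h : z ∉ corners a b) :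
    HasFDerivAt (fun z => deriv cut (logWeight a b z / L))
      ((deriv (deriv cut) (logWeight a b z / L) / L) • reMul (logWeightDeriv a b z)) z := by
  have h1 : HasDerivAt (deriv cut) (deriv (deriv cut) (logWeight a b z / L))
      (logWeight a b z / L) := (deriv_cut_contDiff.differentiable (by norm_num) _).hasDerivAt
  have h2 := (hasFDerivAt_logWeight h).mul_const L⁻¹
  refine (h1.comp_hasFDerivAt z h2).congr_fderiv ?_
  ext v
  simp
  ring

theorem hasFDerivAt_testFun (h : z ∉ corners a b) (hf : DifferentiableAt ℂ f z) :
    HasFDerivAt (testFun a b L f) (reMul (testGrad a b L f z)) z := by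
  refine ((hasFDerivAt_re hf.hasDerivAt).fun_mul (hasFDerivAt_cut_logWeight h)).congr_fderiv ?_
  ext v
  simp [testGrad]
  ring

theorem hasFDerivAt_fderiv_apply (hΦ : ContDiffAt ℝ 2 Φ z) (v : ℂ) :
    HasFDerivAt (fun z => fderiv ℝ Φ z v) (fderiv ℝ (fun z => fderiv ℝ Φ z v) z) z ∧
      ∀ u, fderiv ℝ (fun z => fderiv ℝ Φ z v) z u = fderiv ℝ (fderiv ℝ Φ) z u v := by
  have h1 : DifferentiableAt ℝ (fderiv ℝ Φ) z :=
    (hΦ.fderiv_right (m := 1) (by norm_num)).differentiableAt one_ne_zero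
  refine ⟨(h1.clm_apply (differentiableAt_const v)).hasFDerivAt, fun u => ?_⟩
  rw [fderiv_clm_apply h1 (differentiableAt_const v)]
  simp

theorem planeDiv_gradient_eq_zero (hΦ : InnerProductSpace.HarmonicAt Φ z) :
    planeDiv (fun z => fderiv ℝ Φ z 1) (fun z => fderiv ℝ Φ z Complex.I) z = 0 := by
  have h := hΦ.2.eq_of_nhds
  rw [InnerProductSpace.laplacian_eq_iteratedFDeriv_complexPlane] at h
  simp only [iteratedFDeriv_two_apply] at h
  simp only [planeDiv, (hasFDerivAt_fderiv_apply hΦ.1 _).2]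
  simpa using h

/-- Since `Re f` and `logWeight` are harmonic, the Laplacian of the product keeps only the cross
term and the term with `cut''`. -/
theorem planeDiv_testGrad (hU : IsOpen U) (hf : DifferentiableOn ℂ f U) (hzU : z ∈ U)
    (hz : z ∉ corners a b) :
    DifferentiableAt ℝ (fun z => (testGrad a b L f z).re) z ∧
    DifferentiableAt ℝ (fun z => -(testGrad a b L f z).im) z ∧
    planeDiv (fun z => (testGrad a b L f z).re) (fun z => -(testGrad a b L f z).im) z =
      testLaplacian a b L f z := by
  have hfz := (hf.differentiableAt (hU.mem_nhds hzU)).hasDerivAt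
  have hf'z := ((hf.deriv hU).differentiableAt (hU.mem_nhds hzU)).hasDerivAt
  have hg := hasDerivAt_logWeightDeriv hz
  have hc1 := hasFDerivAt_cut_logWeight (L := L) hz
  have hc2 := hasFDerivAt_deriv_cut_logWeight (L := L) hz
  have hre : (fun z => (testGrad a b L f z).re) = fun z =>
      cut (logWeight a b z / L) * (deriv f z).re +
      (f z).re * deriv cut (logWeight a b z / L) * (logWeightDeriv a b z).re * L⁻¹ := by
    funext z
    simp only [testGrad, Complex.add_re, Complex.re_ofReal_mul]
    ring
  have him : (fun z => -(testGrad a b L f z).im) = fun z =>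
      -(cut (logWeight a b z / L) * (deriv f z).im +
      (f z).re * deriv cut (logWeight a b z / L) * (logWeightDeriv a b z).im * L⁻¹) := by
    funext z
    simp only [testGrad, Complex.add_im, Complex.im_ofReal_mul]
    ring
  rw [hre, him]
  have h1 := (hc1.fun_mul (hasFDerivAt_re hf'z)).fun_add
    ((((hasFDerivAt_re hfz).fun_mul hc2).fun_mul (hasFDerivAt_re hg)).mul_const L⁻¹)
  have h2 := ((hc1.fun_mul (hasFDerivAt_im hf'z)).fun_add
    ((((hasFDerivAt_re hfz).fun_mul hc2).fun_mul (hasFDerivAt_im hg)).mul_const L⁻¹)).fun_neg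
  refine ⟨h1.differentiableAt, h2.differentiableAt, ?_⟩
  rw [planeDiv, h1.fderiv, h2.fderiv]
  have hn : ‖logWeightDeriv a b z‖ ^ 2 = (logWeightDeriv a b z).re * (logWeightDeriv a b z).re +
      (logWeightDeriv a b z).im * (logWeightDeriv a b z).im := by
    rw [← Complex.normSq_eq_norm_sq, Complex.normSq_apply]
  simp only [testLaplacian, hn, add_apply, neg_apply, smul_apply, reMul_apply,
    smul_eq_mul, mul_one, Complex.mul_re, Complex.mul_im, Complex.I_re, Complex.I_im, Complex.neg_re,
    mul_zero, zero_sub, zero_mul, one_mul, zero_add, neg_mul]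
  ring

/-- Green's identity: the terms `∇Φ · ∇u` cancel, `ΔΦ = 0`, and `div (c u z) = c (z · ∇u + 2u)`. No
derivative of `Φ` remains, so bounds on `Φ` alone will suffice. -/
theorem planeDiv_flux (hU : IsOpen U) (hf : DifferentiableOn ℂ f U) (hzU : z ∈ U)
    (hz : z ∉ corners a b) (hΦ : InnerProductSpace.HarmonicAt Φ z) :
    planeDiv (fluxX a b L c Φ f) (fluxY a b L c Φ f) z = fluxDiv a b L c Φ f z := by
  have hT := hasFDerivAt_testFun (L := L) hz (hf.differentiableAt (hU.mem_nhds hzU))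
  obtain ⟨hg1, hg2, hg⟩ := planeDiv_testGrad (L := L) hU hf hzU hz
  have hΦd : HasFDerivAt Φ (fderiv ℝ Φ z) z :=
    (hΦ.1.differentiableAt (by norm_num)).hasFDerivAt
  have h1 := (hΦd.fun_mul hg1.hasFDerivAt).fun_sub (hT.fun_mul
    ((hasFDerivAt_fderiv_apply hΦ.1 1).1.fun_sub
      ((hasFDerivAt_re (hasDerivAt_id z)).const_mul c)))
  have h2 := (hΦd.fun_mul hg2.hasFDerivAt).fun_sub (hT.fun_mul
    ((hasFDerivAt_fderiv_apply hΦ.1 Complex.I).1.fun_sub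
      ((hasFDerivAt_im (hasDerivAt_id z)).const_mul c)))
  have hharm := planeDiv_gradient_eq_zero hΦ
  have e1 : fderiv ℝ (fluxX a b L c Φ f) z = _ := h1.fderiv
  have e2 : fderiv ℝ (fluxY a b L c Φ f) z = _ := h2.fderiv
  rw [planeDiv, e1, e2]
  rw [planeDiv] at hg hharm
  simp only [fluxDiv, ← hg, add_apply, sub_apply, smul_apply, reMul_apply,
    smul_eq_mul, id, mul_one, Complex.mul_re, Complex.I_re, Complex.I_im, Complex.neg_re,
    Complex.one_re, mul_zero, zero_sub, neg_mul, neg_neg]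
  linear_combination (-(testFun a b L f z)) * hharm

end HeleShaw
end

/-! ### Boundary behaviour: the flux field is sealed. -/

noncomputable section

namespace HeleShaw

/-- A holomorphic function on the plane slit along the positive half-axis whose real part
satisfies the boundary conditions adjoint to those of the potential. -/
structure IsTestFunction (p : ℝ) (f : ℂ → ℂ) : Prop where
  differentiableOn : DifferentiableOn ℂ f posAxisᶜ
  sides : ∀ x : ℝ, 0 < x → ∃ F F' G G' : ℂ,
    Tendsto f (𝓝[upper] (x : ℂ)) (𝓝 F) ∧ Tendsto (deriv f) (𝓝[upper] (x : ℂ)) (𝓝 F') ∧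
    Tendsto f (𝓝[lower] (x : ℂ)) (𝓝 G) ∧ Tendsto (deriv f) (𝓝[lower] (x : ℂ)) (𝓝 G') ∧
    F'.im = 0 ∧ G.re = p * F.re
  bound : ∀ R : ℝ, ∃ C : ℝ, ∀ z ∉ posAxis, ‖z‖ ≤ R →
    ‖f z‖ ≤ C * ‖z‖ ^ (1 / 2 : ℝ) ∧ ‖deriv f z‖ ≤ C * ‖z‖ ^ (-(1 / 2) : ℝ)

variable {p a b L c : ℝ} {f : ℂ → ℂ} {Φ : ℂ → ℝ} {Ω : Set ℂ} {γ : ℝ → ℂ}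

theorem corners_subset_posAxis (ha : 0 < a) (hab : a < b) : corners a b ⊆ posAxis := by
  rintro z (rfl | rfl | rfl)
  · exact ⟨by simp, by simp⟩
  · exact ofReal_mem_posAxis ha.le
  · exact ofReal_mem_posAxis (ha.trans hab).le

theorem IsRegion.slit_subset (h : IsRegion Ω a b γ) : Ω \ posAxis ⊆ (corners a b)ᶜ := fun _ hz hc =>
  hz.2 (corners_subset_posAxis h.a_pos h.a_lt_b hc)

theorem tendsto_clm_apply {l : Filter ℂ} {A : ℂ → ℂ →L[ℝ] ℝ} {Λ : ℂ →L[ℝ] ℝ}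
    (h : Tendsto A l (𝓝 Λ)) (v : ℂ) : Tendsto (fun z => A z v) l (𝓝 (Λ v)) :=
  ((ContinuousLinearMap.apply ℝ ℝ v).continuous.tendsto Λ).comp h

section Limits

variable {l : Filter ℂ} {q F F' : ℂ} {v : ℝ} {Λ : ℂ →L[ℝ] ℝ}

theorem tendsto_logWeight_div (hq : q ∉ corners a b) (hl : l ≤ 𝓝 q) :
    Tendsto (fun z => logWeight a b z / L) l (𝓝 (logWeight a b q / L)) :=
  ((contDiffAt_logWeight hq).continuousAt.tendsto.mono_left hl).div_const L

theorem tendsto_testFun (hq : q ∉ corners a b) (hl : l ≤ 𝓝 q) (hf : Tendsto f l (𝓝 F)) :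
    Tendsto (testFun a b L f) l (𝓝 (F.re * cut (logWeight a b q / L))) :=
  ((Complex.continuous_re.tendsto _).comp hf).mul
    ((cut_contDiff.continuous.tendsto _).comp (tendsto_logWeight_div hq hl))

theorem tendsto_logWeightDeriv (hq : q ∉ corners a b) (hl : l ≤ 𝓝 q) :
    Tendsto (logWeightDeriv a b) l (𝓝 (logWeightDeriv a b q)) :=
  (hasDerivAt_logWeightDeriv hq).continuousAt.tendsto.mono_left hl

theorem tendsto_testGrad (hq : q ∉ corners a b) (hl : l ≤ 𝓝 q) (hf : Tendsto f l (𝓝 F))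
    (hf' : Tendsto (deriv f) l (𝓝 F')) :
    Tendsto (testGrad a b L f) l (𝓝 ((cut (logWeight a b q / L) : ℝ) * F' +
      (F.re * (deriv cut (logWeight a b q / L) / L) : ℝ) * logWeightDeriv a b q)) := by
  have h1 := (cut_contDiff.continuous.tendsto _).comp (tendsto_logWeight_div (L := L) hq hl)
  have h2 := ((deriv_cut_contDiff.continuous.tendsto _).comp
    (tendsto_logWeight_div (L := L) hq hl)).div_const L
  have h3 := ((Complex.continuous_re.tendsto _).comp hf).mul h2
  exact (((Complex.continuous_ofReal.tendsto _).comp h1).mul hf').add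
    (((Complex.continuous_ofReal.tendsto _).comp h3).mul (tendsto_logWeightDeriv hq hl))

theorem tendsto_testLaplacian (hq : q ∉ corners a b) (hl : l ≤ 𝓝 q) (hf : Tendsto f l (𝓝 F))
    (hf' : Tendsto (deriv f) l (𝓝 F')) : ∃ u, Tendsto (testLaplacian a b L f) l (𝓝 u) := by
  have h2 := ((deriv_cut_contDiff.continuous.tendsto _).comp
    (tendsto_logWeight_div (L := L) hq hl)).div_const L
  have h3 := ((deriv_deriv_cut_contDiff.continuous.tendsto _).comp
    (tendsto_logWeight_div (L := L) hq hl)).div_const (L ^ 2)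
  have hg := tendsto_logWeightDeriv hq hl
  have re : ∀ {u : ℂ → ℂ} {w : ℂ}, Tendsto u l (𝓝 w) → Tendsto (fun z => (u z).re) l (𝓝 w.re) :=
    fun h => (Complex.continuous_re.tendsto _).comp h
  have im : ∀ {u : ℂ → ℂ} {w : ℂ}, Tendsto u l (𝓝 w) → Tendsto (fun z => (u z).im) l (𝓝 w.im) :=
    fun h => (Complex.continuous_im.tendsto _).comp h
  exact ⟨_, ((h2.const_mul 2).mul (((re hf').mul (re hg)).add ((im hf').mul (im hg)))).add
    (((re hf).mul h3).mul (hg.norm.pow 2))⟩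

theorem tendsto_fluxX (hq : q ∉ corners a b) (hl : l ≤ 𝓝 q) (hf : Tendsto f l (𝓝 F))
    (hf' : Tendsto (deriv f) l (𝓝 F')) (hΦ : Tendsto Φ l (𝓝 v))
    (hΦ' : Tendsto (fderiv ℝ Φ) l (𝓝 Λ)) :
    Tendsto (fluxX a b L c Φ f) l (𝓝 (v * ((cut (logWeight a b q / L) : ℝ) * F' +
      (F.re * (deriv cut (logWeight a b q / L) / L) : ℝ) * logWeightDeriv a b q).re -
      F.re * cut (logWeight a b q / L) * (Λ 1 - c * q.re))) :=
  (hΦ.mul ((Complex.continuous_re.tendsto _).comp (tendsto_testGrad hq hl hf hf'))).sub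
    ((tendsto_testFun hq hl hf).mul ((tendsto_clm_apply hΦ' _).sub
      (((Complex.continuous_re.tendsto _).mono_left hl).const_mul c)))

theorem tendsto_fluxY (hq : q ∉ corners a b) (hl : l ≤ 𝓝 q) (hf : Tendsto f l (𝓝 F))
    (hf' : Tendsto (deriv f) l (𝓝 F')) (hΦ : Tendsto Φ l (𝓝 v))
    (hΦ' : Tendsto (fderiv ℝ Φ) l (𝓝 Λ)) :
    Tendsto (fluxY a b L c Φ f) l (𝓝 (v * (-((cut (logWeight a b q / L) : ℝ) * F' +
      (F.re * (deriv cut (logWeight a b q / L) / L) : ℝ) * logWeightDeriv a b q).im) -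
      F.re * cut (logWeight a b q / L) * (Λ Complex.I - c * q.im))) :=
  (hΦ.mul ((Complex.continuous_im.tendsto _).comp (tendsto_testGrad hq hl hf hf')).neg).sub
    ((tendsto_testFun hq hl hf).mul ((tendsto_clm_apply hΦ' _).sub
      (((Complex.continuous_im.tendsto _).mono_left hl).const_mul c)))

theorem tendsto_fluxDiv (hq : q ∉ corners a b) (hl : l ≤ 𝓝 q) (hf : Tendsto f l (𝓝 F))
    (hf' : Tendsto (deriv f) l (𝓝 F')) (hΦ : Tendsto Φ l (𝓝 v)) :
    ∃ u, Tendsto (fluxDiv a b L c Φ f) l (𝓝 u) := by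
  obtain ⟨u, hu⟩ := tendsto_testLaplacian (L := L) hq hl hf hf'
  have hid : Tendsto (fun z : ℂ => z) l (𝓝 q) := hl
  exact ⟨_, (hΦ.mul hu).add ((((Complex.continuous_re.tendsto _).comp
    (hid.mul (tendsto_testGrad hq hl hf hf'))).add
    ((tendsto_testFun hq hl hf).const_mul 2)).const_mul c)⟩

end Limits

theorem nhdsWithin_slit_le {x : ℝ} (hx : 0 < x) :
    𝓝[Ω \ posAxis] (x : ℂ) ≤ 𝓝[Ω ∩ upper] (x : ℂ) ⊔ 𝓝[Ω ∩ lower] (x : ℂ) := by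
  rw [← nhdsWithin_union]
  have hre : {z : ℂ | 0 < z.re} ∈ 𝓝 (x : ℂ) :=
    (isOpen_lt continuous_const Complex.continuous_re).mem_nhds (by simpa using hx)
  refine le_inf inf_le_left (le_principal_iff.2 ?_)
  filter_upwards [mem_nhdsWithin_of_mem_nhds hre, self_mem_nhdsWithin] with z hz1 hz2
  rcases lt_trichotomy z.im 0 with hi | hi | hi
  · exact Or.inr ⟨hz2.1, hi⟩
  · exact absurd ⟨hz1.le, hi⟩ hz2.2
  · exact Or.inl ⟨hz2.1, hi⟩

theorem IsRegion.nhdsWithin_lower_eq_bot (h : IsRegion Ω a b γ) {x : ℝ} (hx : x ∈ Ioo a b) :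
    𝓝[Ω ∩ lower] (x : ℂ) = ⊥ := by
  obtain ⟨r, hr, hΩ, -⟩ := h.exists_ball_reflecting hx
  rw [← empty_mem_iff_bot]
  filter_upwards [self_mem_nhdsWithin, mem_nhdsWithin_of_mem_nhds (Metric.ball_mem_nhds _ hr)]
    with z hz hzB
  have hzu : z ∈ Metric.ball (x : ℂ) r ∩ upper := hΩ ▸ ⟨hzB, hz.1⟩
  exact lt_asymm (show 0 < z.im from hzu.2) hz.2

/-- Every function that is bounded near each point of the closure of a region is bounded. -/
theorem IsRegion.exists_bound (h : IsRegion Ω a b γ) {u : ℂ → ℝ}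
    (hu : ∀ q ∈ closure Ω, u =O[𝓝[Ω \ posAxis] q] (fun _ => (1 : ℝ))) :
    ∃ C : ℝ, ∀ z ∈ Ω \ posAxis, |u z| ≤ C := by
  have key : ∃ C : ℝ, ∀ z ∈ closure Ω ∩ (Ω \ posAxis), |u z| ≤ C := by
    refine h.isBounded.isCompact_closure.induction_on
      (p := fun s => ∃ C : ℝ, ∀ z ∈ s ∩ (Ω \ posAxis), |u z| ≤ C) ⟨0, by simp⟩ ?_ ?_ ?_
    · rintro s t hst ⟨C, hC⟩
      exact ⟨C, fun z hz => hC z ⟨hst hz.1, hz.2⟩⟩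
    · rintro s t ⟨C, hC⟩ ⟨C', hC'⟩
      refine ⟨max C C', fun z hz => ?_⟩
      rcases hz.1 with h1 | h1
      · exact (hC z ⟨h1, hz.2⟩).trans (le_max_left _ _)
      · exact (hC' z ⟨h1, hz.2⟩).trans (le_max_right _ _)
    · intro q hq
      obtain ⟨C, hC⟩ := (hu q hq).bound
      obtain ⟨s, hs, hsub⟩ := mem_nhdsWithin_iff_exists_mem_nhds_inter.1 hC
      refine ⟨s, mem_nhdsWithin_of_mem_nhds hs, C, fun z hz => ?_⟩
      simpa using hsub hz
  obtain ⟨C, hC⟩ := key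
  exact ⟨C, fun z hz => hC z ⟨subset_closure hz.1, hz⟩⟩

theorem IsRegion.integrableOn_of_locally_bounded (h : IsRegion Ω a b γ) {u : ℂ → ℝ}
    (hc : ContinuousOn u (Ω \ posAxis))
    (hu : ∀ q ∈ closure Ω, u =O[𝓝[Ω \ posAxis] q] (fun _ => (1 : ℝ))) : IntegrableOn u Ω := by
  obtain ⟨C, hC⟩ := h.exists_bound hu
  rw [← integrableOn_sdiff_posAxis]
  refine IntegrableOn.of_bound ((measure_mono sdiff_subset).trans_lt h.isBounded.measure_lt_top)
    (hc.aestronglyMeasurable h.isOpen_slit.measurableSet) C ?_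
  filter_upwards [ae_restrict_mem h.isOpen_slit.measurableSet] with z hz using hC z hz

theorem IsRegion.nhdsWithin_slit_neBot (h : IsRegion Ω a b γ) {t : ℝ} (ht : t ∈ Ioo (0 : ℝ) 1) :
    (𝓝[Ω \ posAxis] (γ t)).NeBot := by
  have h1 : (𝓝[Ω] (γ t)).NeBot := mem_closure_iff_nhdsWithin_neBot.1
    (frontier_subset_closure (h.curve_mem_frontier (Ioo_subset_Icc_self ht)))
  refine h1.mono (le_inf inf_le_left (le_principal_iff.2 ?_))
  filter_upwards [self_mem_nhdsWithin, mem_nhdsWithin_of_mem_nhds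
    (isClosed_posAxis.isOpen_compl.mem_nhds (h.not_mem_posAxis t ht))] with z h2 h3 using ⟨h2, h3⟩

/-- The values of the differential of the potential on the curve: the field `∇Φ - c z` is
tangential. -/
theorem curve_tangential (h : IsRegion Ω a b γ) {t : ℝ} (ht : t ∈ Ioo (0 : ℝ) 1)
    {Λ : ℂ →L[ℝ] ℝ} (hΛ : Tendsto (fderiv ℝ Φ) (𝓝[Ω \ posAxis] (γ t)) (𝓝 Λ))
    (hc : Tendsto (fun z => fderiv ℝ Φ z (outwardNormal γ t)) (𝓝[Ω \ posAxis] (γ t))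
      (𝓝 (c * inner ℝ (γ t) (outwardNormal γ t)))) :
    (Λ 1 - c * (γ t).re) * (deriv γ t).im = (Λ Complex.I - c * (γ t).im) * (deriv γ t).re := by
  have := h.nhdsWithin_slit_neBot ht
  have h1 := tendsto_nhds_unique (tendsto_clm_apply hΛ _) hc
  have hd : 0 < ‖deriv γ t‖ := norm_pos_iff.2 (h.deriv_ne_zero t ht)
  have hn : outwardNormal γ t = (‖deriv γ t‖⁻¹ * (deriv γ t).im) • (1 : ℂ) +
      (-(‖deriv γ t‖⁻¹ * (deriv γ t).re)) • Complex.I := by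
    apply Complex.ext <;> simp [outwardNormal, div_eq_mul_inv, ← Complex.ofReal_inv, mul_comm]
  rw [hn, map_add, map_smul, map_smul] at h1
  simp [Complex.inner] at h1
  field_simp at h1
  linarith

theorem IsTestFunction.continuousAt (hf : IsTestFunction p f) {z : ℂ} (hz : z ∉ posAxis) :
    ContinuousAt f z ∧ ContinuousAt (deriv f) z :=
  ⟨(hf.differentiableOn.differentiableAt (isClosed_posAxis.isOpen_compl.mem_nhds hz)).continuousAt,
    ((hf.differentiableOn.deriv isClosed_posAxis.isOpen_compl).differentiableAt
      (isClosed_posAxis.isOpen_compl.mem_nhds hz)).continuousAt⟩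

/-- The potential, the test function and their derivatives have limits along `l`. -/
def HasLimits (Φ : ℂ → ℝ) (f : ℂ → ℂ) (l : Filter ℂ) : Prop :=
  ∃ (F F' : ℂ) (v : ℝ) (Λ : ℂ →L[ℝ] ℝ), Tendsto f l (𝓝 F) ∧ Tendsto (deriv f) l (𝓝 F') ∧
    Tendsto Φ l (𝓝 v) ∧ Tendsto (fderiv ℝ Φ) l (𝓝 Λ)

/-- Two filters are needed because on `(0, a)` the limits from above and from below differ;
elsewhere the same filter is used twice. -/
theorem IsPotential.exists_hasLimits (h : IsRegion Ω a b γ) (hΦ : IsPotential p Ω a b γ Φ)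
    (hf : IsTestFunction p f) {q : ℂ} (hq : q ∈ closure Ω) (hqc : q ∉ corners a b) :
    ∃ l₁ l₂ : Filter ℂ, 𝓝[Ω \ posAxis] q ≤ l₁ ⊔ l₂ ∧ l₁ ≤ 𝓝 q ∧ l₂ ≤ 𝓝 q ∧
      HasLimits Φ f l₁ ∧ HasLimits Φ f l₂ := by
  have hle : ∀ S : Set ℂ, 𝓝[S] q ≤ 𝓝 q := fun S => nhdsWithin_le_nhds
  rcases h.cases_closure hq with hq | ⟨t, ht, rfl⟩ | hq | ⟨x, hx, rfl⟩ | ⟨x, hx, rfl⟩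
  · have hcd := (hΦ.harmonic q hq).1
    have hlim : HasLimits Φ f (𝓝[Ω \ posAxis] q) := ⟨_, _, _, _,
      (hf.continuousAt hq.2).1.tendsto.mono_left (hle _),
      (hf.continuousAt hq.2).2.tendsto.mono_left (hle _),
      hcd.continuousAt.tendsto.mono_left (hle _),
      (hcd.fderiv_right (m := 1) (by norm_num)).continuousAt.tendsto.mono_left (hle _)⟩
    exact ⟨_, _, le_sup_left, hle _, hle _, hlim, hlim⟩
  · have hp := h.not_mem_posAxis t ht
    obtain ⟨Λ, hΛ⟩ := hΦ.curve_diff t ht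
    have hlim : HasLimits Φ f (𝓝[Ω \ posAxis] (γ t)) := ⟨_, _, _, _,
      (hf.continuousAt hp).1.tendsto.mono_left (hle _),
      (hf.continuousAt hp).2.tendsto.mono_left (hle _), hΦ.curve_zero t ⟨ht.1.le, ht.2⟩, hΛ⟩
    exact ⟨_, _, le_sup_left, hle _, hle _, hlim, hlim⟩
  · exact absurd hq hqc
  · obtain ⟨F, F', G, G', hF, hF', hG, hG', -⟩ := hf.sides x hx.1
    obtain ⟨Λ, Λ', hΛ, hΛ', -⟩ := hΦ.passing x hx
    obtain ⟨v, hv⟩ := hΦ.upper_cont x ⟨hx.1, hx.2.trans h.a_lt_b⟩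
    exact ⟨_, _, nhdsWithin_slit_le hx.1, hle _, hle _,
      ⟨F, F', v, Λ, hF.mono_left (nhdsWithin_mono _ inter_subset_right),
        hF'.mono_left (nhdsWithin_mono _ inter_subset_right), hv, hΛ⟩,
      ⟨G, G', 0, Λ', hG.mono_left (nhdsWithin_mono _ inter_subset_right),
        hG'.mono_left (nhdsWithin_mono _ inter_subset_right), hΦ.lower_zero x ⟨hx.1, hx.2.le⟩, hΛ'⟩⟩
  · have hx0 := h.a_pos.trans hx.1
    obtain ⟨F, F', G, G', hF, hF', hG, hG', -⟩ := hf.sides x hx0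
    obtain ⟨Λ, hΛ, -⟩ := hΦ.reflecting x hx
    obtain ⟨v, hv⟩ := hΦ.upper_cont x ⟨hx0, hx.2⟩
    have hlim : HasLimits Φ f (𝓝[Ω ∩ upper] (x : ℂ)) := ⟨F, F', v, Λ,
      hF.mono_left (nhdsWithin_mono _ inter_subset_right),
      hF'.mono_left (nhdsWithin_mono _ inter_subset_right), hv, hΛ⟩
    refine ⟨_, _, ?_, hle _, hle _, hlim, hlim⟩
    -- `Ω` has no points below `(a, b)` nearby, so the lower filter is `⊥`.
    have := nhdsWithin_slit_le (Ω := Ω) hx0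
    rwa [h.nhdsWithin_lower_eq_bot hx, sup_bot_eq, ← sup_idem (𝓝[Ω ∩ upper] (x : ℂ))] at this

theorem eventually_logWeight_lt (h : IsRegion Ω a b γ) (hL : 0 < L) {q : ℂ}
    (hq : q ∈ corners a b) : ∀ᶠ z in 𝓝 q, z ∈ Ω \ posAxis → logWeight a b z / L < -2 := by
  have h1 := (tendsto_logWeight_atBot h.a_pos h.a_lt_b hq).eventually (eventually_lt_atBot (-2 * L))
  rw [eventually_nhdsWithin_iff] at h1
  filter_upwards [h1] with z hz hzW
  have hzq : z ≠ q := fun hzq => h.slit_subset hzW (hzq ▸ hq)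
  rw [div_lt_iff₀ hL]
  exact hz hzq

theorem test_eq_zero {z : ℂ} (hz : logWeight a b z / L < -2) :
    testFun a b L f z = 0 ∧ testGrad a b L f z = 0 ∧ testLaplacian a b L f z = 0 := by
  simp [testFun, testGrad, testLaplacian, cut_eq_zero hz, deriv_cut_eq_zero hz,
    deriv_deriv_cut_eq_zero hz]

theorem isBigO_one_of_hasLimits (h : IsRegion Ω a b γ) (hΦ : IsPotential p Ω a b γ Φ)
    (hf : IsTestFunction p f) {u : ℂ → ℝ}
    (hu : ∀ q ∉ corners a b, ∀ l ≤ 𝓝 q, HasLimits Φ f l → ∃ y, Tendsto u l (𝓝 y))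
    (hu0 : ∀ q ∈ corners a b, ∀ᶠ z in 𝓝 q, z ∈ Ω \ posAxis → u z = 0) {q : ℂ}
    (hq : q ∈ closure Ω) : u =O[𝓝[Ω \ posAxis] q] (fun _ => (1 : ℝ)) := by
  by_cases hqc : q ∈ corners a b
  · refine IsBigO.of_bound 0 ?_
    rw [eventually_nhdsWithin_iff]
    filter_upwards [hu0 q hqc] with z hz hzW
    simp [hz hzW]
  · obtain ⟨l₁, l₂, hle, h1, h2, hl1, hl2⟩ := hΦ.exists_hasLimits h hf hq hqc
    obtain ⟨y₁, hy₁⟩ := hu q hqc l₁ h1 hl1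
    obtain ⟨y₂, hy₂⟩ := hu q hqc l₂ h2 hl2
    exact ((hy₁.isBigO_one ℝ).sup (hy₂.isBigO_one ℝ)).mono hle

theorem contDiffAt_flux (h : IsRegion Ω a b γ) (hΦ : IsPotential p Ω a b γ Φ)
    (hf : IsTestFunction p f) {z : ℂ} (hz : z ∈ Ω \ posAxis) :
    ContDiffAt ℝ 1 (fluxX a b L c Φ f) z ∧ ContDiffAt ℝ 1 (fluxY a b L c Φ f) z ∧
      ContinuousAt (fluxDiv a b L c Φ f) z := by
  have hzc : z ∉ corners a b := h.slit_subset hz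
  have hcd := (hΦ.harmonic z hz).1
  have hfd : ∀ v : ℂ, ContDiffAt ℝ 1 (fun z => fderiv ℝ Φ z v) z := fun v =>
    (hcd.fderiv_right (m := 1) (by norm_num)).clm_apply contDiffAt_const
  have hw : ContDiffAt ℝ 1 (fun z => logWeight a b z / L) z :=
    (contDiffAt_logWeight hzc).div_const L
  have hf1 : ContDiffAt ℝ 1 f z :=
    contDiffAt_real_of_differentiableOn isClosed_posAxis.isOpen_compl hf.differentiableOn hz.2
  have hf2 : ContDiffAt ℝ 1 (deriv f) z :=
    contDiffAt_real_of_differentiableOn isClosed_posAxis.isOpen_compl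
      (hf.differentiableOn.deriv isClosed_posAxis.isOpen_compl) hz.2
  have hg : ContDiffAt ℝ 1 (logWeightDeriv a b) z :=
    contDiffAt_real_of_differentiableOn (isClosed_corners a b).isOpen_compl
      differentiableOn_logWeightDeriv hzc
  have re : ∀ {u : ℂ → ℂ}, ContDiffAt ℝ 1 u z → ContDiffAt ℝ 1 (fun z => (u z).re) z := fun h =>
    Complex.reCLM.contDiff.contDiffAt.comp z h
  have im : ∀ {u : ℂ → ℂ}, ContDiffAt ℝ 1 u z → ContDiffAt ℝ 1 (fun z => (u z).im) z := fun h =>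
    Complex.imCLM.contDiff.contDiffAt.comp z h
  have hof : ∀ {u : ℂ → ℝ}, ContDiffAt ℝ 1 u z → ContDiffAt ℝ 1 (fun z => (u z : ℂ)) z := fun h =>
    Complex.ofRealCLM.contDiff.contDiffAt.comp z h
  have hcut : ContDiffAt ℝ 1 (fun z => cut (logWeight a b z / L)) z :=
    (cut_contDiff.of_le (by norm_num)).contDiffAt.comp z hw
  have hcut' : ContDiffAt ℝ 1 (fun z => deriv cut (logWeight a b z / L)) z :=
    (deriv_cut_contDiff.of_le (by norm_num)).contDiffAt.comp z hw
  have hcut'' : ContDiffAt ℝ 1 (fun z => deriv (deriv cut) (logWeight a b z / L)) z :=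
    deriv_deriv_cut_contDiff.contDiffAt.comp z hw
  have hT : ContDiffAt ℝ 1 (testFun a b L f) z := (re hf1).mul hcut
  have hG : ContDiffAt ℝ 1 (testGrad a b L f) z :=
    ((hof hcut).mul hf2).add ((hof ((re hf1).mul (hcut'.div_const L))).mul hg)
  have hΔ : ContinuousAt (testLaplacian a b L f) z :=
    ((continuousAt_const.mul (hcut'.div_const L).continuousAt).mul
      (((re hf2).mul (re hg)).add ((im hf2).mul (im hg))).continuousAt).add
      ((((re hf1).mul (hcut''.div_const (L ^ 2))).continuousAt).mul (hg.continuousAt.norm.pow 2))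
  have hΦ1 : ContDiffAt ℝ 1 Φ z := hcd.of_le (by norm_num)
  refine ⟨?_, ?_, ?_⟩
  · exact (hΦ1.mul (re hG)).sub (hT.mul ((hfd 1).sub (contDiffAt_const.mul (re contDiffAt_id))))
  · exact (hΦ1.mul (im hG).neg).sub
      (hT.mul ((hfd Complex.I).sub (contDiffAt_const.mul (im contDiffAt_id))))
  · exact (hΦ1.continuousAt.mul hΔ).add (continuousAt_const.mul
      ((re (contDiffAt_id.mul hG)).continuousAt.add (continuousAt_const.mul hT.continuousAt)))

/-- The adjoint boundary conditions are used here. The cutoff respects them since `logWeightDeriv`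
is real on the real axis: the cutoff has no normal derivative there. Integrability follows from
local boundedness, as every term vanishes near the corners and has limits elsewhere. -/
theorem isSealedField_flux (h : IsRegion Ω a b γ) (hΦ : IsPotential p Ω a b γ Φ)
    (hf : IsTestFunction p f) (hL : 0 < L)
    (hc : ∀ t ∈ Ioo (0 : ℝ) 1, Tendsto (fun z => fderiv ℝ Φ z (outwardNormal γ t))
      (𝓝[Ω \ posAxis] (γ t)) (𝓝 (c * inner ℝ (γ t) (outwardNormal γ t)))) :
    IsSealedField Ω a b γ (fluxX a b L c Φ f) (fluxY a b L c Φ f) := by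
  have hzero : ∀ q ∈ corners a b, ∀ᶠ z in 𝓝 q, z ∈ Ω \ posAxis →
      fluxX a b L c Φ f z = 0 ∧ fluxY a b L c Φ f z = 0 ∧ fluxDiv a b L c Φ f z = 0 := by
    intro q hq
    filter_upwards [eventually_logWeight_lt h hL hq] with z hz hzW
    obtain ⟨h1, h2, h3⟩ := test_eq_zero (f := f) (hz hzW)
    simp [fluxX, fluxY, fluxDiv, h1, h2, h3]
  have hX : ContDiffOn ℝ 1 (fluxX a b L c Φ f) (Ω \ posAxis) := fun z hz =>
    (contDiffAt_flux h hΦ hf hz).1.contDiffWithinAt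
  have hY : ContDiffOn ℝ 1 (fluxY a b L c Φ f) (Ω \ posAxis) := fun z hz =>
    (contDiffAt_flux h hΦ hf hz).2.1.contDiffWithinAt
  have hcorner : ∀ {x : ℝ}, x ≠ 0 → x ≠ a → x ≠ b → (x : ℂ) ∉ corners a b := fun h1 h2 h3 =>
    notMem_corners.2 ⟨Complex.ofReal_ne_zero.2 h1, fun h => h2 (Complex.ofReal_injective h),
      fun h => h3 (Complex.ofReal_injective h)⟩
  have hgim : ∀ x : ℝ, (logWeightDeriv a b x).im = 0 := by
    intro x
    have : logWeightDeriv a b x = (((x - 0)⁻¹ + (x - a)⁻¹ + (x - b)⁻¹ : ℝ) : ℂ) := by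
      simp [logWeightDeriv]
    rw [this, Complex.ofReal_im]
  refine ⟨hX, hY, ?_, ?_, ?_, ?_, ?_, ?_, ?_⟩
  · intro q hq
    filter_upwards [hzero q hq] with z hz hzW
    exact ⟨(hz hzW).1, (hz hzW).2.1⟩
  · intro t ht
    have hp := h.not_mem_posAxis t ht
    have hqc : γ t ∉ corners a b := fun hq => hp (corners_subset_posAxis h.a_pos h.a_lt_b hq)
    obtain ⟨Λ, hΛ⟩ := hΦ.curve_diff t ht
    have hv := hΦ.curve_zero t ⟨ht.1.le, ht.2⟩
    have hf1 := (hf.continuousAt hp).1.tendsto.mono_left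
      (nhdsWithin_le_nhds (s := Ω \ posAxis))
    have hf2 := (hf.continuousAt hp).2.tendsto.mono_left
      (nhdsWithin_le_nhds (s := Ω \ posAxis))
    refine ⟨_, _, tendsto_fluxX hqc nhdsWithin_le_nhds hf1 hf2 hv hΛ,
      tendsto_fluxY hqc nhdsWithin_le_nhds hf1 hf2 hv hΛ, ?_⟩
    -- On the curve `Φ = 0`, so only the tangential field `-u (∇Φ - c z)` is left.
    have hT := curve_tangential h ht hΛ (hc t ht)
    linear_combination (-((f (γ t)).re * cut (logWeight a b (γ t) / L))) * hT
  · intro x hx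
    have hx0 := h.a_pos.trans hx.1
    obtain ⟨F, F', G, G', hF, hF', hG, hG', hF'0, -⟩ := hf.sides x hx0
    obtain ⟨Λ, hΛ, hΛ0⟩ := hΦ.reflecting x hx
    obtain ⟨v, hv⟩ := hΦ.upper_cont x ⟨hx0, hx.2⟩
    have := tendsto_fluxY (c := c) (L := L) (hcorner hx0.ne' hx.1.ne' hx.2.ne) nhdsWithin_le_nhds
      (hF.mono_left (nhdsWithin_mono _ inter_subset_right))
      (hF'.mono_left (nhdsWithin_mono _ inter_subset_right)) hv hΛ
    convert this using 2
    rw [Complex.add_im, Complex.im_ofReal_mul, Complex.im_ofReal_mul, hF'0, hgim, hΛ0]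
    simp
  · intro x hx
    obtain ⟨F, F', G, G', hF, hF', hG, hG', hF'0, hGF⟩ := hf.sides x hx.1
    obtain ⟨Λ, Λ', hΛ, hΛ', hΛΛ'⟩ := hΦ.passing x hx
    obtain ⟨v, hv⟩ := hΦ.upper_cont x ⟨hx.1, hx.2.trans h.a_lt_b⟩
    have hxc := hcorner hx.1.ne' hx.2.ne (hx.2.trans h.a_lt_b).ne
    have h1 := tendsto_fluxY (c := c) (L := L) hxc nhdsWithin_le_nhds
      (hF.mono_left (nhdsWithin_mono _ inter_subset_right))
      (hF'.mono_left (nhdsWithin_mono _ inter_subset_right)) hv hΛ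
    have h2 := tendsto_fluxY (c := c) (L := L) hxc nhdsWithin_le_nhds
      (hG.mono_left (nhdsWithin_mono _ inter_subset_right))
      (hG'.mono_left (nhdsWithin_mono _ inter_subset_right)) (hΦ.lower_zero x ⟨hx.1, hx.2.le⟩) hΛ'
    refine ⟨_, h1, ?_⟩
    convert h2 using 2
    -- Above, the factor of `Φ` vanishes because `F'` and `logWeightDeriv` are real; below, `Φ`
    -- itself vanishes. What is left agrees: the factor `p` sits on `Φ_y` above and on `Re f` below.
    rw [Complex.add_im, Complex.im_ofReal_mul, Complex.im_ofReal_mul, hF'0, hgim, hΛΛ', hGF]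
    simp
    ring
  · exact h.integrableOn_of_locally_bounded hX.continuousOn fun q hq =>
      isBigO_one_of_hasLimits h hΦ hf
        (fun q hqc l hl ⟨F, F', v, Λ, h1, h2, h3, h4⟩ => ⟨_, tendsto_fluxX hqc hl h1 h2 h3 h4⟩)
        (fun q hqc => (hzero q hqc).mono fun z hz hzW => (hz hzW).1) hq
  · exact h.integrableOn_of_locally_bounded hY.continuousOn fun q hq =>
      isBigO_one_of_hasLimits h hΦ hf
        (fun q hqc l hl ⟨F, F', v, Λ, h1, h2, h3, h4⟩ => ⟨_, tendsto_fluxY hqc hl h1 h2 h3 h4⟩)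
        (fun q hqc => (hzero q hqc).mono fun z hz hzW => (hz hzW).2.1) hq
  · have hD : IntegrableOn (fluxDiv a b L c Φ f) Ω :=
      h.integrableOn_of_locally_bounded
        (fun z hz => (contDiffAt_flux h hΦ hf hz).2.2.continuousWithinAt) fun q hq =>
      isBigO_one_of_hasLimits h hΦ hf
        (fun q hqc l hl ⟨F, F', v, Λ, h1, h2, h3, h4⟩ => tendsto_fluxDiv hqc hl h1 h2 h3)
        (fun q hqc => (hzero q hqc).mono fun z hz hzW => (hz hzW).2.2) hq
    rw [← integrableOn_sdiff_posAxis] at hD ⊢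
    exact hD.congr_fun (fun z hz => (planeDiv_flux isClosed_posAxis.isOpen_compl
      hf.differentiableOn hz.2 (h.slit_subset hz) (hΦ.harmonic z hz)).symm)
      h.isOpen_slit.measurableSet

theorem integral_fluxDiv_eq_zero (h : IsRegion Ω a b γ) (hΦ : IsPotential p Ω a b γ Φ)
    (hf : IsTestFunction p f) (hL : 0 < L)
    (hc : ∀ t ∈ Ioo (0 : ℝ) 1, Tendsto (fun z => fderiv ℝ Φ z (outwardNormal γ t))
      (𝓝[Ω \ posAxis] (γ t)) (𝓝 (c * inner ℝ (γ t) (outwardNormal γ t)))) :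
    ∫ z in Ω \ posAxis, fluxDiv a b L c Φ f z = 0 := by
  have h0 := (isSealedField_flux h hΦ hf hL hc).integral_eq_zero h
  rw [← setIntegral_sdiff_posAxis] at h0
  rw [← h0]
  exact setIntegral_congr_fun h.isOpen_slit.measurableSet fun z hz =>
    (planeDiv_flux isClosed_posAxis.isOpen_compl hf.differentiableOn hz.2 (h.slit_subset hz)
      (hΦ.harmonic z hz)).symm

end HeleShaw
end

/-! ### Growth of the potential and of the error terms. -/

noncomputable section

namespace HeleShaw

variable {p a b L c : ℝ} {f : ℂ → ℂ} {Φ : ℂ → ℝ} {Ω : Set ℂ} {γ : ℝ → ℂ}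

theorem alpha_nonneg (p : ℝ) : 0 ≤ alpha p :=
  div_nonneg (Real.arccos_nonneg p) (by positivity)

theorem alpha_le {p : ℝ} (hp : 0 ≤ p) : alpha p ≤ 1 / 4 := by
  have h : Real.arccos p ≤ Real.pi / 2 := Real.arccos_le_pi_div_two.2 hp
  rw [alpha, div_le_iff₀ (by positivity)]
  linarith

theorem abs_sourceProfile_le (p : ℝ) {z : ℂ} (hz : ‖z‖ ≤ 1) :
    |sourceProfile p z| ≤ 2 * Real.pi * sourceSize p z := by
  have hpi := Real.pi_gt_three
  unfold sourceProfile sourceSize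
  split_ifs with h
  · have h0 : 0 ≤ ‖z‖ ^ (-alpha p) := by positivity
    rw [abs_mul, abs_of_nonneg h0, mul_comm]
    exact mul_le_mul_of_nonneg_right ((Real.abs_sin_le_one _).trans (by linarith)) h0
  · have h0 : 0 ≤ Real.log (1 / ‖z‖) := by
      rw [one_div, Real.log_inv]
      linarith [Real.log_nonpos (norm_nonneg z) hz]
    rw [abs_mul, abs_of_nonneg h0, mul_comm]
    refine mul_le_mul_of_nonneg_right ?_ h0
    have h1 := Complex.neg_pi_lt_arg (-z)
    have h2 := Complex.arg_le_pi (-z)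
    have h3 : angle z = (-z).arg + Real.pi := by simp [angle, logBranch, Complex.log_im]
    rw [h3, abs_le]
    constructor <;> linarith

/-- The exponent `1/3` treats both cases at once: it exceeds `α ≤ 1/4`, and it absorbs the logarithm
through `log x ≤ 3 x^(1/3)`, the source of the constant `3`. -/
theorem sourceSize_mul_le (hp : 0 ≤ p) {z : ℂ} (hz0 : z ≠ 0) (hz : ‖z‖ ≤ 1) :
    |sourceSize p z| * ‖z‖ ^ (1 / 3 : ℝ) ≤ 3 := by
  have hpos : 0 < ‖z‖ := norm_pos_iff.2 hz0
  unfold sourceSize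
  split_ifs with h
  · rw [abs_of_nonneg (by positivity), ← Real.rpow_add hpos]
    refine (Real.rpow_le_one hpos.le hz ?_).trans (by norm_num)
    linarith [alpha_le hp]
  · have h0 : 0 ≤ Real.log (1 / ‖z‖) := by
      rw [one_div, Real.log_inv]
      linarith [Real.log_nonpos hpos.le hz]
    rw [abs_of_nonneg h0]
    have h1 : Real.log (1 / ‖z‖) ≤ (1 / ‖z‖) ^ (1 / 3 : ℝ) / (1 / 3) :=
      Real.log_le_rpow_div (by positivity) (by norm_num)
    have h2 : (1 / ‖z‖) ^ (1 / 3 : ℝ) * ‖z‖ ^ (1 / 3 : ℝ) = 1 := by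
      rw [← Real.mul_rpow (by positivity) hpos.le, one_div_mul_cancel hpos.ne', Real.one_rpow]
    calc Real.log (1 / ‖z‖) * ‖z‖ ^ (1 / 3 : ℝ) ≤
        (1 / ‖z‖) ^ (1 / 3 : ℝ) / (1 / 3) * ‖z‖ ^ (1 / 3 : ℝ) := by gcongr
      _ = 3 * ((1 / ‖z‖) ^ (1 / 3 : ℝ) * ‖z‖ ^ (1 / 3 : ℝ)) := by ring
      _ = 3 := by rw [h2, mul_one]

theorem IsPotential.isBigO_zero (hp : 0 ≤ p) (hΦ : IsPotential p Ω a b γ Φ) :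
    (fun z => Φ z * ‖z‖ ^ (1 / 3 : ℝ)) =O[𝓝[Ω \ posAxis] 0] (fun _ => (1 : ℝ)) := by
  obtain ⟨κ, hκ, ho⟩ := hΦ.source
  have h1 := ho.bound one_pos
  refine IsBigO.of_bound ((1 + κ * (2 * Real.pi)) * 3) ?_
  filter_upwards [h1, self_mem_nhdsWithin,
    mem_nhdsWithin_of_mem_nhds (Metric.closedBall_mem_nhds (0 : ℂ) one_pos)] with z hz1 hz2 hz3
  have hz0 : z ≠ 0 := by
    rintro rfl
    exact hz2.2 ⟨by simp, by simp⟩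
  have hz3' : ‖z‖ ≤ 1 := by simpa using hz3
  have h2 := abs_sourceProfile_le p hz3'
  have h3 := sourceSize_mul_le hp hz0 hz3'
  simp only [Real.norm_eq_abs, one_mul, abs_one, mul_one] at hz1 ⊢
  have h4 : |Φ z| ≤ (1 + κ * (2 * Real.pi)) * |sourceSize p z| := by
    have h5 : |Φ z| ≤ |Φ z + κ * sourceProfile p z| + |κ * sourceProfile p z| := by
      have := abs_sub (Φ z + κ * sourceProfile p z) (κ * sourceProfile p z)
      simpa using this
    rw [abs_mul κ, abs_of_pos hκ] at h5
    have h6 : κ * |sourceProfile p z| ≤ κ * (2 * Real.pi * |sourceSize p z|) := by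
      refine mul_le_mul_of_nonneg_left (h2.trans ?_) hκ.le
      exact mul_le_mul_of_nonneg_left (le_abs_self _) (by positivity)
    linarith
  rw [abs_mul, abs_of_nonneg (a := ‖z‖ ^ (1 / 3 : ℝ)) (by positivity)]
  calc |Φ z| * ‖z‖ ^ (1 / 3 : ℝ) ≤ (1 + κ * (2 * Real.pi)) * |sourceSize p z| * ‖z‖ ^ (1 / 3 : ℝ) := by
        gcongr
    _ = (1 + κ * (2 * Real.pi)) * (|sourceSize p z| * ‖z‖ ^ (1 / 3 : ℝ)) := by ring
    _ ≤ _ := by gcongr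

/-- Only the source is singular. At `a` the potential has a limit from above and tends to `0` from
below; at `b = γ 0` it tends to `0`. -/
theorem IsPotential.exists_bound (hp : 0 ≤ p) (h : IsRegion Ω a b γ)
    (hΦ : IsPotential p Ω a b γ Φ) (hf : IsTestFunction p f) :
    ∃ C : ℝ, ∀ z ∈ Ω \ posAxis, |Φ z| ≤ C * ‖z‖ ^ (-(1 / 3) : ℝ) := by
  have hnorm : ∀ (l : Filter ℂ) (q : ℂ), l ≤ 𝓝 q →
      Tendsto (fun z => ‖z‖ ^ (1 / 3 : ℝ)) l (𝓝 (‖q‖ ^ (1 / 3 : ℝ))) := fun l q hl =>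
    ((continuous_norm.rpow_const fun _ => Or.inr (by norm_num)).tendsto q).mono_left hl
  have key : ∃ C : ℝ, ∀ z ∈ Ω \ posAxis, |Φ z * ‖z‖ ^ (1 / 3 : ℝ)| ≤ C := by
    refine h.exists_bound fun q hq => ?_
    by_cases hqc : q ∈ corners a b
    · rcases hqc with rfl | rfl | rfl
      · exact hΦ.isBigO_zero hp
      · obtain ⟨v, hv⟩ := hΦ.upper_cont a ⟨h.a_pos, h.a_lt_b⟩
        have hl := hΦ.lower_zero a ⟨h.a_pos, le_rfl⟩
        exact (((hv.mul (hnorm _ _ nhdsWithin_le_nhds)).isBigO_one ℝ).sup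
          ((hl.mul (hnorm _ _ nhdsWithin_le_nhds)).isBigO_one ℝ)).mono (nhdsWithin_slit_le h.a_pos)
      · have hv := hΦ.curve_zero 0 ⟨le_rfl, one_pos⟩
        rw [h.start] at hv
        exact (hv.mul (hnorm _ _ nhdsWithin_le_nhds)).isBigO_one ℝ
    · obtain ⟨l₁, l₂, hle, h1, h2, ⟨_, _, v₁, _, -, -, hl1, -⟩, ⟨_, _, v₂, _, -, -, hl2, -⟩⟩ :=
        hΦ.exists_hasLimits h hf hq hqc
      exact (((hl1.mul (hnorm _ _ h1)).isBigO_one ℝ).sup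
        ((hl2.mul (hnorm _ _ h2)).isBigO_one ℝ)).mono hle
  obtain ⟨C, hC⟩ := key
  refine ⟨C, fun z hz => ?_⟩
  have hz0 : 0 < ‖z‖ := norm_pos_iff.2 (notMem_corners.1 (h.slit_subset hz)).1
  have h1 := hC z hz
  rw [abs_mul, abs_of_nonneg (a := ‖z‖ ^ (1 / 3 : ℝ)) (by positivity)] at h1
  rw [Real.rpow_neg hz0.le, ← div_eq_mul_inv, le_div_iff₀ (by positivity)]
  exact h1

theorem integrableOn_norm_sub_rpow (q : ℂ) {s : ℝ} (hs : s < 2) (hΩ : Bornology.IsBounded Ω) :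
    IntegrableOn (fun z => ‖z - q‖ ^ (-s)) Ω := by
  have hloc : LocallyIntegrable (fun z : ℂ => ‖z‖ ^ (-s)) volume := by
    refine locallyIntegrable_of_norm_le_rpow (C := 1) (α := s) (by simp) (by simpa using hs) ?_ ?_
    · refine .of_forall fun z => ?_
      rw [Real.norm_of_nonneg (by positivity), one_mul]
    · exact (measurable_norm.pow_const _).aestronglyMeasurable
  obtain ⟨R, hR⟩ := hΩ.subset_closedBall q
  have h1 : IntegrableOn (fun z : ℂ => ‖z‖ ^ (-s)) (Metric.closedBall 0 R) :=
    hloc.integrableOn_isCompact (isCompact_closedBall 0 R)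
  have h2 := ((measurePreserving_sub_right volume q).integrableOn_comp_preimage
    (MeasurableEquiv.subRight q).measurableEmbedding).2 h1
  refine h2.mono_set fun z hz => ?_
  simpa [dist_eq_norm] using hR hz

/-- Polar coordinates turn `r⁻²` into `r⁻¹`. With `δ` exponentially small in `L` the integral grows
only linearly in `L`, which is the gain of the logarithmic cutoff. -/
theorem integral_annulus {δ R : ℝ} (hδ : 0 < δ) (hδR : δ ≤ R) (q : ℂ) :
    Integrable (fun z : ℂ => (Icc δ R).indicator (fun y => (y ^ 2)⁻¹) ‖z - q‖) ∧
    ∫ z : ℂ, (Icc δ R).indicator (fun y => (y ^ 2)⁻¹) ‖z - q‖ = 2 * Real.pi * Real.log (R / δ) := by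
  have heq : ∀ y ∈ Ioi (0 : ℝ), (Icc δ R).indicator (fun y => y⁻¹) y =
      y ^ (Module.finrank ℝ ℂ - 1) • (Icc δ R).indicator (fun y => (y ^ 2)⁻¹) y := by
    intro y hy
    by_cases hyI : y ∈ Icc δ R
    · have : y ≠ 0 := ne_of_gt hy
      simp [hyI]
      field_simp
    · simp [hyI]
  have hsub : Icc δ R ⊆ Ioi 0 := fun y hy => hδ.trans_le hy.1
  have hcont : ContinuousOn (fun y : ℝ => y⁻¹) (Icc δ R) :=
    continuousOn_inv₀.mono fun y hy => (hsub hy).ne'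
  have hint : IntegrableOn ((Icc δ R).indicator (fun y : ℝ => y⁻¹)) (Ioi 0) :=
    (hcont.integrableOn_Icc.integrable_indicator measurableSet_Icc).integrableOn
  constructor
  · have h1 : Integrable (fun z : ℂ => (Icc δ R).indicator (fun y => (y ^ 2)⁻¹) ‖z‖) :=
      (integrable_fun_norm_addHaar volume).2 (hint.congr_fun heq measurableSet_Ioi)
    exact h1.comp_sub_right q
  · rw [integral_sub_right_eq_self (fun z : ℂ => (Icc δ R).indicator (fun y => (y ^ 2)⁻¹) ‖z‖) q,
      integral_fun_norm_addHaar volume, ← setIntegral_congr_fun measurableSet_Ioi heq,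
      setIntegral_indicator measurableSet_Icc, inter_eq_right.2 hsub, integral_Icc_eq_integral_Ioc,
      ← intervalIntegral.integral_of_le hδR, integral_inv_of_pos hδ (hδ.trans_le hδR)]
    simp [Measure.real]
    ring

theorem deriv_cut_eq_zero_of_gt {t : ℝ} (h : -1 < t) : deriv cut t = 0 := by
  have : cut =ᶠ[𝓝 t] fun _ => 1 := by
    filter_upwards [Ioi_mem_nhds h] with x hx
    exact cut_eq_one (le_of_lt hx)
  rw [this.deriv_eq, deriv_const]

/-- The part of `fluxDiv` that contains the second derivative of the cutoff. -/
def fluxDivSnd (a b L : ℝ) (Φ : ℂ → ℝ) (f : ℂ → ℂ) (z : ℂ) : ℝ :=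
  Φ z * (f z).re * (deriv (deriv cut) (logWeight a b z / L) / L ^ 2) * ‖logWeightDeriv a b z‖ ^ 2

theorem continuousAt_fluxDivSnd (h : IsRegion Ω a b γ) (hΦ : IsPotential p Ω a b γ Φ)
    (hf : IsTestFunction p f) {z : ℂ} (hz : z ∈ Ω \ posAxis) :
    ContinuousAt (fluxDivSnd a b L Φ f) z := by
  have hzc := h.slit_subset hz
  have h1 : ContinuousAt (fun z => (f z).re) z :=
    Complex.continuous_re.continuousAt.comp (hf.continuousAt hz.2).1
  have h2 : ContinuousAt (fun z => deriv (deriv cut) (logWeight a b z / L)) z :=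
    ContinuousAt.comp (f := fun z => logWeight a b z / L)
      deriv_deriv_cut_contDiff.continuous.continuousAt
      ((contDiffAt_logWeight hzc).continuousAt.div_const L)
  exact (((hΦ.harmonic z hz).1.continuousAt.mul h1).mul (h2.div_const _)).mul
    ((hasDerivAt_logWeightDeriv hzc).continuousAt.norm.pow 2)

theorem norm_logWeightDeriv_le (z : ℂ) :
    ‖logWeightDeriv a b z‖ ≤ ‖z - 0‖⁻¹ + ‖z - a‖⁻¹ + ‖z - b‖⁻¹ := by
  refine (norm_add₃_le ..).trans ?_
  simp only [norm_inv]
  exact le_rfl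

theorem exists_bound_deriv_cut :
    ∃ M : ℝ, 0 ≤ M ∧ ∀ t : ℝ, |deriv cut t| ≤ M ∧ |deriv (deriv cut) t| ≤ M := by
  obtain ⟨M, hM0, hM⟩ := exists_bound_deriv_smoothTransition
  refine ⟨M, hM0, fun t => ?_⟩
  rw [deriv_deriv_cut, deriv_cut]
  exact hM (t + 2)

/-- A bound for the diameter of a region, also seen from its corners. -/
theorem IsRegion.exists_radius (h : IsRegion Ω a b γ) :
    ∃ R : ℝ, 1 ≤ R ∧ ∀ z ∈ Ω, ∀ q ∈ corners a b, ‖z - q‖ ≤ R := by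
  obtain ⟨R, hR⟩ := h.isBounded.exists_norm_le
  refine ⟨max 1 (R + b), le_max_left _ _, fun z hz q hq => le_max_of_le_right ?_⟩
  have hb := h.a_pos.trans h.a_lt_b
  refine (norm_sub_le _ _).trans (add_le_add (hR z hz) ?_)
  rcases hq with rfl | rfl | rfl
  · simpa using hb.le
  · rw [Complex.norm_real, Real.norm_of_nonneg h.a_pos.le]
    exact h.a_lt_b.le
  · rw [Complex.norm_real, Real.norm_of_nonneg hb.le]

/-- Where the cutoff does not vanish, the distance to the corners is bounded below. -/
theorem le_norm_sub_of_le_logWeight {R : ℝ} {z : ℂ} (hz : z ∉ corners a b)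
    (hzR : ∀ q ∈ corners a b, ‖z - q‖ ≤ R) (hL : 0 < L) (hw : -2 ≤ logWeight a b z / L) :
    ∀ q ∈ corners a b, Real.exp (-2 * L - 2 * Real.log R) ≤ ‖z - q‖ := by
  obtain ⟨h0, ha, hb⟩ := notMem_corners.1 hz
  have hpos : ∀ q : ℂ, z ≠ q → 0 < ‖z - q‖ := fun q hq => norm_pos_iff.2 (sub_ne_zero.2 hq)
  have hlog : ∀ q ∈ corners a b, z ≠ q → Real.log ‖z - q‖ ≤ Real.log R := fun q hq hzq =>
    Real.log_le_log (hpos q hzq) (hzR q hq)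
  -- The three logarithms add up to at least `-2L` and two of them are at most `log R`, which bounds
  -- the third below.
  rw [le_div_iff₀ hL, logWeight] at hw
  have l0 := hlog 0 (by simp [corners]) h0
  have la := hlog a (by simp [corners]) ha
  have lb := hlog b (by simp [corners]) hb
  rintro q (rfl | rfl | rfl)
  · rw [← Real.le_log_iff_exp_le (hpos _ h0)]
    linarith
  · rw [← Real.le_log_iff_exp_le (hpos _ ha)]
    linarith
  · rw [← Real.le_log_iff_exp_le (hpos _ hb)]
    linarith

/-- `Φ f` is `O(r^(1/6))`, hence at most `C C' R`; the gradient of `logWeight` squared is at most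
`3` times the sum of the inverse squared distances; and where `cut''` is not zero all three
distances lie in the stated annulus. -/
theorem abs_fluxDivSnd_le {R C C' M : ℝ} (hR : 1 ≤ R) (hL : 0 < L) {z : ℂ}
    (hz : z ∉ corners a b) (hzR : ∀ q ∈ corners a b, ‖z - q‖ ≤ R)
    (hΦ : |Φ z| ≤ C * ‖z‖ ^ (-(1 / 3) : ℝ)) (hf : ‖f z‖ ≤ C' * ‖z‖ ^ (1 / 2 : ℝ))
    (hM : ∀ t, |deriv (deriv cut) t| ≤ M) (hC : 0 ≤ C) (hC' : 0 ≤ C') :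
    |fluxDivSnd a b L Φ f z| ≤ C * C' * R * M * 3 / L ^ 2 *
      ((Icc (Real.exp (-2 * L - 2 * Real.log R)) R).indicator (fun y => (y ^ 2)⁻¹) ‖z - 0‖ +
       (Icc (Real.exp (-2 * L - 2 * Real.log R)) R).indicator (fun y => (y ^ 2)⁻¹) ‖z - a‖ +
       (Icc (Real.exp (-2 * L - 2 * Real.log R)) R).indicator (fun y => (y ^ 2)⁻¹) ‖z - b‖) := by
  have hM0 : 0 ≤ M := (abs_nonneg _).trans (hM 0)
  have hind : ∀ q : ℂ, 0 ≤ (Icc (Real.exp (-2 * L - 2 * Real.log R)) R).indicator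
      (fun y => (y ^ 2)⁻¹) ‖z - q‖ := fun q => indicator_nonneg (fun y _ => by positivity) _
  rcases lt_or_ge (logWeight a b z / L) (-2) with hw | hw
  · rw [fluxDivSnd, deriv_deriv_cut_eq_zero hw]
    simp only [zero_div, mul_zero, zero_mul, abs_zero]
    have := hind 0
    have := hind a
    have := hind b
    positivity
  · have hin := le_norm_sub_of_le_logWeight hz hzR hL hw
    have hval : ∀ q ∈ corners a b, (Icc (Real.exp (-2 * L - 2 * Real.log R)) R).indicator
        (fun y => (y ^ 2)⁻¹) ‖z - q‖ = ‖z - q‖⁻¹ ^ 2 := fun q hq => by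
      rw [indicator_of_mem (show ‖z - q‖ ∈ Icc _ R from ⟨hin q hq, hzR q hq⟩), inv_pow]
    rw [hval 0 (by simp [corners]), hval a (by simp [corners]), hval b (by simp [corners])]
    have hz0 : 0 < ‖z‖ := norm_pos_iff.2 (notMem_corners.1 hz).1
    have hzR0 : ‖z‖ ≤ R := by simpa using hzR 0 (by simp [corners])
    have h1 : |Φ z * (f z).re| ≤ C * C' * R := by
      rw [abs_mul]
      calc |Φ z| * |(f z).re| ≤ (C * ‖z‖ ^ (-(1 / 3) : ℝ)) * (C' * ‖z‖ ^ (1 / 2 : ℝ)) :=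
            mul_le_mul hΦ ((Complex.abs_re_le_norm _).trans hf) (abs_nonneg _) (by positivity)
        _ = C * C' * ‖z‖ ^ (1 / 6 : ℝ) := by
            rw [show (1 / 6 : ℝ) = -(1 / 3) + 1 / 2 by norm_num, Real.rpow_add hz0]
            ring
        _ ≤ C * C' * R := by
            gcongr
            calc ‖z‖ ^ (1 / 6 : ℝ) ≤ R ^ (1 / 6 : ℝ) := by gcongr
              _ ≤ R ^ (1 : ℝ) := Real.rpow_le_rpow_of_exponent_le hR (by norm_num)
              _ = R := Real.rpow_one R
    have h2 : ‖logWeightDeriv a b z‖ ^ 2 ≤ 3 * (‖z - 0‖⁻¹ ^ 2 + ‖z - a‖⁻¹ ^ 2 + ‖z - b‖⁻¹ ^ 2) := by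
      refine (pow_le_pow_left₀ (norm_nonneg _) (norm_logWeightDeriv_le z) 2).trans ?_
      nlinarith [sq_nonneg (‖z - 0‖⁻¹ - ‖z - a‖⁻¹), sq_nonneg (‖z - 0‖⁻¹ - ‖z - b‖⁻¹),
        sq_nonneg (‖z - a‖⁻¹ - ‖z - b‖⁻¹)]
    rw [fluxDivSnd, abs_mul, abs_mul, abs_div, abs_of_nonneg (a := L ^ 2) (by positivity),
      abs_of_nonneg (a := ‖logWeightDeriv a b z‖ ^ 2) (by positivity)]
    calc |Φ z * (f z).re| * (|deriv (deriv cut) (logWeight a b z / L)| / L ^ 2) *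
          ‖logWeightDeriv a b z‖ ^ 2
        ≤ (C * C' * R) * (M / L ^ 2) *
          (3 * (‖z - 0‖⁻¹ ^ 2 + ‖z - a‖⁻¹ ^ 2 + ‖z - b‖⁻¹ ^ 2)) := by
          gcongr
          exact hM _
      _ = _ := by ring

end HeleShaw
end

/-! ### Removing the cutoff. -/

noncomputable section

namespace HeleShaw

variable {p a b L c : ℝ} {f : ℂ → ℂ} {Φ : ℂ → ℝ} {Ω : Set ℂ} {γ : ℝ → ℂ}

theorem norm_setIntegral_fluxDivSnd_le {W : Set ℂ} (hW : MeasurableSet W) {R A : ℝ} (hR : 1 ≤ R)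
    (hL : 0 < L) (hA : 0 ≤ A) (hbd : ∀ z ∈ W, |fluxDivSnd a b L Φ f z| ≤ A / L ^ 2 *
      ((Icc (Real.exp (-2 * L - 2 * Real.log R)) R).indicator (fun y => (y ^ 2)⁻¹) ‖z - 0‖ +
       (Icc (Real.exp (-2 * L - 2 * Real.log R)) R).indicator (fun y => (y ^ 2)⁻¹) ‖z - a‖ +
       (Icc (Real.exp (-2 * L - 2 * Real.log R)) R).indicator (fun y => (y ^ 2)⁻¹) ‖z - b‖)) :
    ‖∫ z in W, fluxDivSnd a b L Φ f z‖ ≤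
      A / L ^ 2 * (3 * (2 * Real.pi * (3 * Real.log R + 2 * L))) := by
  set δ := Real.exp (-2 * L - 2 * Real.log R) with hδ
  have hδ0 : 0 < δ := Real.exp_pos _
  have hlogR : 0 ≤ Real.log R := Real.log_nonneg hR
  have hδR : δ ≤ R := (Real.exp_le_one_iff.2 (by linarith)).trans hR
  have hlog : Real.log (R / δ) = 3 * Real.log R + 2 * L := by
    rw [Real.log_div (by linarith) hδ0.ne', hδ, Real.log_exp]
    ring
  have h0 := integral_annulus hδ0 hδR 0
  have ha := integral_annulus hδ0 hδR (a : ℂ)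
  have hb := integral_annulus hδ0 hδR (b : ℂ)
  have hsum : Integrable fun z : ℂ => (Icc δ R).indicator (fun y => (y ^ 2)⁻¹) ‖z - 0‖ +
      (Icc δ R).indicator (fun y => (y ^ 2)⁻¹) ‖z - a‖ +
      (Icc δ R).indicator (fun y => (y ^ 2)⁻¹) ‖z - b‖ := (h0.1.add ha.1).add hb.1
  have hval : ∫ z : ℂ, ((Icc δ R).indicator (fun y => (y ^ 2)⁻¹) ‖z - 0‖ +
      (Icc δ R).indicator (fun y => (y ^ 2)⁻¹) ‖z - a‖ +
      (Icc δ R).indicator (fun y => (y ^ 2)⁻¹) ‖z - b‖) =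
      3 * (2 * Real.pi * (3 * Real.log R + 2 * L)) := by
    refine (integral_add (h0.1.add ha.1) hb.1).trans ?_
    refine (congrArg (· + _) (integral_add h0.1 ha.1)).trans ?_
    simp only [h0.2, ha.2, hb.2, hlog]
    ring
  have hind : ∀ q z : ℂ, 0 ≤ (Icc δ R).indicator (fun y : ℝ => (y ^ 2)⁻¹) ‖z - q‖ := fun q z =>
    indicator_nonneg (fun y _ => by positivity) _
  have hle : ‖∫ z in W, fluxDivSnd a b L Φ f z‖ ≤ ∫ z in W, A / L ^ 2 *
      ((Icc δ R).indicator (fun y => (y ^ 2)⁻¹) ‖z - 0‖ +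
       (Icc δ R).indicator (fun y => (y ^ 2)⁻¹) ‖z - a‖ +
       (Icc δ R).indicator (fun y => (y ^ 2)⁻¹) ‖z - b‖) := by
    refine norm_integral_le_of_norm_le (hsum.const_mul _).integrableOn ?_
    filter_upwards [ae_restrict_mem hW] with z hz using hbd z hz
  refine hle.trans ((setIntegral_le_integral (hsum.const_mul _) (.of_forall fun z => ?_)).trans ?_)
  · have := hind 0 z
    have := hind a z
    have := hind b z
    simp only [Pi.zero_apply]
    positivity
  · rw [integral_const_mul, hval]

theorem tendsto_annulus_bound (A B : ℝ) :
    Tendsto (fun n : ℕ => A / ((n : ℝ) + 1) ^ 2 *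
      (3 * (2 * Real.pi * (3 * B + 2 * ((n : ℝ) + 1))))) atTop (𝓝 0) := by
  have h1 : Tendsto (fun n : ℕ => 1 / ((n : ℝ) + 1)) atTop (𝓝 0) :=
    tendsto_one_div_add_atTop_nhds_zero_nat
  have h2 := ((h1.pow 2).const_mul (A * 18 * Real.pi * B)).add (h1.const_mul (A * 12 * Real.pi))
  refine (h2.congr fun n => ?_).trans (by simp)
  have : ((n : ℝ) + 1) ≠ 0 := by positivity
  field_simp
  ring

/-- Replace the larger of the two distances by the smaller one. The exponent `-11/6` is above `-2`,
so both terms on the right are integrable in the plane. -/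
theorem rpow_mul_inv_le {x y : ℝ} (hx : 0 < x) (hy : 0 < y) :
    x ^ (-(5 / 6) : ℝ) * y⁻¹ ≤ x ^ (-(11 / 6) : ℝ) + y ^ (-(11 / 6) : ℝ) := by
  have hsplit : ∀ t : ℝ, 0 < t → t ^ (-(5 / 6) : ℝ) * t⁻¹ = t ^ (-(11 / 6) : ℝ) := fun t ht => by
    rw [← Real.rpow_neg_one t, ← Real.rpow_add ht]
    norm_num
  rcases le_total x y with h | h
  · calc x ^ (-(5 / 6) : ℝ) * y⁻¹ ≤ x ^ (-(5 / 6) : ℝ) * x⁻¹ := by gcongr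
      _ = x ^ (-(11 / 6) : ℝ) := hsplit x hx
      _ ≤ _ := le_add_of_nonneg_right (by positivity)
  · calc x ^ (-(5 / 6) : ℝ) * y⁻¹ ≤ y ^ (-(5 / 6) : ℝ) * y⁻¹ :=
          mul_le_mul_of_nonneg_right (Real.rpow_le_rpow_of_nonpos hy h (by norm_num))
            (by positivity)
      _ = y ^ (-(11 / 6) : ℝ) := hsplit y hy
      _ ≤ _ := le_add_of_nonneg_left (by positivity)

theorem integrableOn_inv_norm_sub (q : ℂ) (hΩ : Bornology.IsBounded Ω) :
    IntegrableOn (fun z => ‖z - q‖⁻¹) Ω := by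
  have := integrableOn_norm_sub_rpow q (s := 1) (by norm_num) hΩ
  simpa only [Real.rpow_neg_one] using this

theorem integrableOn_rpow_mul_inv {W : Set ℂ} (q : ℂ) (hW : MeasurableSet W)
    (hWb : Bornology.IsBounded W) (h0 : (0 : ℂ) ∉ W) (hq : q ∉ W) :
    IntegrableOn (fun z => ‖z‖ ^ (-(5 / 6) : ℝ) * ‖z - q‖⁻¹) W := by
  have h1 := (integrableOn_norm_sub_rpow 0 (s := 11 / 6) (by norm_num) hWb).add
    (integrableOn_norm_sub_rpow q (s := 11 / 6) (by norm_num) hWb)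
  refine Integrable.mono' h1 ?_ ?_
  · exact ((measurable_norm.pow_const _).mul
      (measurable_id.sub_const q).norm.inv).aestronglyMeasurable
  · filter_upwards [ae_restrict_mem hW] with z hz
    rw [Real.norm_of_nonneg (by positivity)]
    have h2 : 0 < ‖z‖ := norm_pos_iff.2 fun h => h0 (h ▸ hz)
    have h3 : 0 < ‖z - q‖ := norm_pos_iff.2 (sub_ne_zero.2 fun h => hq (h ▸ hz))
    simpa using rpow_mul_inv_le h2 h3

/-- The sum of the inverse distances to the corners. -/
def cornerSum (a b : ℝ) (z : ℂ) : ℝ := ‖z - 0‖⁻¹ + ‖z - a‖⁻¹ + ‖z - b‖⁻¹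

/-- `L ≥ 1` bounds `cut' / L` by `M`, so the majorant does not depend on `L`. The exponent `-5/6` is
that of `Φ f'`. -/
theorem abs_fluxDiv_sub_le {R C C' M : ℝ} (hR : 1 ≤ R) (hL : 1 ≤ L) {z : ℂ}
    (hz : z ∉ corners a b) (hzR : ‖z‖ ≤ R)
    (hΦ : |Φ z| ≤ C * ‖z‖ ^ (-(1 / 3) : ℝ)) (hf : ‖f z‖ ≤ C' * ‖z‖ ^ (1 / 2 : ℝ))
    (hf' : ‖deriv f z‖ ≤ C' * ‖z‖ ^ (-(1 / 2) : ℝ))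
    (hM : ∀ t, |deriv cut t| ≤ M) (hC : 0 ≤ C) (hC' : 0 ≤ C') :
    |fluxDiv a b L c Φ f z - fluxDivSnd a b L Φ f z| ≤
      2 * M * C * C' * (‖z‖ ^ (-(5 / 6) : ℝ) * cornerSum a b z) +
      |c| * (R * (C' * ‖z‖ ^ (-(1 / 2) : ℝ) + C' * R * M * cornerSum a b z) + 2 * (C' * R)) := by
  have hM0 : 0 ≤ M := (abs_nonneg _).trans (hM 0)
  have hz0 : 0 < ‖z‖ := norm_pos_iff.2 (notMem_corners.1 hz).1
  have hg : ‖logWeightDeriv a b z‖ ≤ cornerSum a b z := norm_logWeightDeriv_le z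
  have hψ : |deriv cut (logWeight a b z / L) / L| ≤ M := by
    rw [abs_div, abs_of_pos (by linarith : 0 < L)]
    exact (div_le_self (abs_nonneg _) hL).trans (hM _)
  have hfR : ‖f z‖ ≤ C' * R := by
    refine hf.trans (mul_le_mul_of_nonneg_left ?_ hC')
    calc ‖z‖ ^ (1 / 2 : ℝ) ≤ R ^ (1 / 2 : ℝ) := by gcongr
      _ ≤ R ^ (1 : ℝ) := Real.rpow_le_rpow_of_exponent_le hR (by norm_num)
      _ = R := Real.rpow_one R
  have hinner : |(deriv f z).re * (logWeightDeriv a b z).re +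
      (deriv f z).im * (logWeightDeriv a b z).im| ≤ ‖deriv f z‖ * ‖logWeightDeriv a b z‖ := by
    have h1 := Complex.abs_re_le_norm (deriv f z * starRingEnd ℂ (logWeightDeriv a b z))
    rw [norm_mul, RCLike.norm_conj] at h1
    simpa using h1
  have hsplit : fluxDiv a b L c Φ f z - fluxDivSnd a b L Φ f z =
      Φ z * (2 * (deriv cut (logWeight a b z / L) / L) *
      ((deriv f z).re * (logWeightDeriv a b z).re + (deriv f z).im * (logWeightDeriv a b z).im)) +
      c * ((z * testGrad a b L f z).re + 2 * testFun a b L f z) := by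
    rw [fluxDiv, fluxDivSnd, testLaplacian]
    ring
  have hT : |testFun a b L f z| ≤ C' * R := by
    rw [testFun, abs_mul]
    exact (mul_le_of_le_one_right (abs_nonneg _) (abs_cut_le _)).trans
      ((Complex.abs_re_le_norm _).trans hfR)
  have hG : ‖testGrad a b L f z‖ ≤
      C' * ‖z‖ ^ (-(1 / 2) : ℝ) + C' * R * M * cornerSum a b z := by
    refine (norm_add_le _ _).trans (add_le_add ?_ ?_)
    · rw [norm_mul, Complex.norm_real]
      exact (mul_le_of_le_one_left (norm_nonneg _) (abs_cut_le _)).trans hf'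
    · rw [norm_mul, Complex.norm_real, norm_mul]
      have h1 : ‖(f z).re‖ ≤ C' * R := (Complex.abs_re_le_norm _).trans hfR
      have h2 : ‖deriv cut (logWeight a b z / L) / L‖ ≤ M := hψ
      gcongr
  have h1 : |Φ z * (2 * (deriv cut (logWeight a b z / L) / L) *
      ((deriv f z).re * (logWeightDeriv a b z).re + (deriv f z).im * (logWeightDeriv a b z).im))| ≤
      2 * M * C * C' * (‖z‖ ^ (-(5 / 6) : ℝ) * cornerSum a b z) := by
    rw [abs_mul, abs_mul, abs_mul 2, abs_two]
    calc _ ≤ (C * ‖z‖ ^ (-(1 / 3) : ℝ)) * (2 * M *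
          ((C' * ‖z‖ ^ (-(1 / 2) : ℝ)) * cornerSum a b z)) := by
          have := hinner.trans (mul_le_mul hf' hg (norm_nonneg _) (by positivity))
          gcongr
      _ = _ := by
          rw [show (-(5 / 6) : ℝ) = -(1 / 3) + -(1 / 2) by norm_num, Real.rpow_add hz0]
          ring
  have h2 : |(z * testGrad a b L f z).re| ≤
      R * (C' * ‖z‖ ^ (-(1 / 2) : ℝ) + C' * R * M * cornerSum a b z) := by
    refine (Complex.abs_re_le_norm _).trans ?_
    rw [norm_mul]
    gcongr
  rw [hsplit]
  refine (abs_add_le _ _).trans (add_le_add h1 ?_)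
  rw [abs_mul]
  refine mul_le_mul_of_nonneg_left ((abs_add_le _ _).trans (add_le_add h2 ?_)) (abs_nonneg c)
  rw [abs_mul, abs_two]
  gcongr

theorem tendsto_fluxDiv_sub (z : ℂ) :
    Tendsto (fun n : ℕ => fluxDiv a b ((n : ℝ) + 1) c Φ f z - fluxDivSnd a b ((n : ℝ) + 1) Φ f z)
      atTop (𝓝 (c * ((z * deriv f z).re + 2 * (f z).re))) := by
  refine tendsto_const_nhds.congr' ?_
  have h1 : Tendsto (fun n : ℕ => logWeight a b z * (1 / ((n : ℝ) + 1))) atTop (𝓝 0) := by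
    simpa using tendsto_one_div_add_atTop_nhds_zero_nat.const_mul (logWeight a b z)
  filter_upwards [h1.eventually (lt_mem_nhds (show (-1 : ℝ) < 0 by norm_num))] with n hn
  rw [mul_one_div] at hn
  simp [fluxDiv, fluxDivSnd, testLaplacian, testGrad, testFun, cut_eq_one hn.le,
    deriv_cut_eq_zero_of_gt hn]
  ring

/-- The moment of a test function that is stationary under the homothetic flow. -/
theorem integral_test_eq_zero (hp : 0 ≤ p) (h : IsRegion Ω a b γ) (hΦ : IsPotential p Ω a b γ Φ)
    (hH : IsHomothetic Ω γ Φ) (hf : IsTestFunction p f) :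
    ∫ z in Ω, ((z * deriv f z).re + 2 * (f z).re) = 0 := by
  obtain ⟨c, hc0, hc⟩ := hH
  set W := Ω \ posAxis with hW
  have hWm : MeasurableSet W := h.isOpen_slit.measurableSet
  have hWb : Bornology.IsBounded W := h.isBounded.subset sdiff_subset
  obtain ⟨R, hR, hRq⟩ := h.exists_radius
  obtain ⟨C₀, hC₀⟩ := hΦ.exists_bound hp h hf
  obtain ⟨C₁, hC₁⟩ := hf.bound R
  obtain ⟨M, hM0, hM⟩ := exists_bound_deriv_cut
  set C := |C₀|
  set C' := |C₁|
  have hzR : ∀ z ∈ W, ‖z‖ ≤ R := fun z hz => by simpa using hRq z hz.1 0 (by simp [corners])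
  have hΦC : ∀ z ∈ W, |Φ z| ≤ C * ‖z‖ ^ (-(1 / 3) : ℝ) := fun z hz =>
    (hC₀ z hz).trans (mul_le_mul_of_nonneg_right (le_abs_self _) (by positivity))
  have hfC : ∀ z ∈ W, ‖f z‖ ≤ C' * ‖z‖ ^ (1 / 2 : ℝ) := fun z hz =>
    (hC₁ z hz.2 (hzR z hz)).1.trans (mul_le_mul_of_nonneg_right (le_abs_self _) (by positivity))
  have hfC' : ∀ z ∈ W, ‖deriv f z‖ ≤ C' * ‖z‖ ^ (-(1 / 2) : ℝ) := fun z hz =>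
    (hC₁ z hz.2 (hzR z hz)).2.trans (mul_le_mul_of_nonneg_right (le_abs_self _) (by positivity))
  have hcor : ∀ q ∈ corners a b, q ∉ W := fun q hq hqW => h.slit_subset hqW hq
  -- This part has no fixed integrable majorant supplied by the estimates; its integral is bounded
  -- by `L⁻²` times `O(L)`.
  have hsnd : Tendsto (fun n : ℕ => ∫ z in W, fluxDivSnd a b ((n : ℝ) + 1) Φ f z) atTop (𝓝 0) := by
    refine squeeze_zero_norm (fun n => ?_) (tendsto_annulus_bound (C * C' * R * M * 3) (Real.log R))
    refine norm_setIntegral_fluxDivSnd_le hWm hR (by positivity) (by positivity) fun z hz => ?_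
    exact abs_fluxDivSnd_le hR (by positivity) (h.slit_subset hz) (hRq z hz.1) (hΦC z hz)
      (hfC z hz) (fun t => (hM t).2) (abs_nonneg _) (abs_nonneg _)
  have hsum_int : IntegrableOn (cornerSum a b) W :=
    ((integrableOn_inv_norm_sub 0 hWb).add (integrableOn_inv_norm_sub a hWb)).add
      (integrableOn_inv_norm_sub b hWb)
  have hmul_int : IntegrableOn (fun z => ‖z‖ ^ (-(5 / 6) : ℝ) * cornerSum a b z) W := by
    have h0 := hcor 0 (by simp [corners])
    have := ((integrableOn_rpow_mul_inv 0 hWm hWb h0 h0).add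
      (integrableOn_rpow_mul_inv a hWm hWb h0 (hcor a (by simp [corners])))).add
      (integrableOn_rpow_mul_inv b hWm hWb h0 (hcor b (by simp [corners])))
    refine this.congr (.of_forall fun z => ?_)
    simp only [cornerSum, Pi.add_apply]
    ring
  have hhalf_int : IntegrableOn (fun z : ℂ => ‖z‖ ^ (-(1 / 2) : ℝ)) W := by
    simpa using integrableOn_norm_sub_rpow 0 (s := 1 / 2) (by norm_num) hWb
  have hconst_int : ∀ k : ℝ, IntegrableOn (fun _ : ℂ => k) W := fun k =>
    integrableOn_const hWb.measure_lt_top.ne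
  have hcontSnd : ∀ L : ℝ, ContinuousOn (fluxDivSnd a b L Φ f) W := fun L z hz =>
    (continuousAt_fluxDivSnd h hΦ hf hz).continuousWithinAt
  have hcont : ∀ L : ℝ, ContinuousOn (fluxDiv a b L c Φ f) W := fun L z hz =>
    (contDiffAt_flux h hΦ hf hz).2.2.continuousWithinAt
  have hK : IntegrableOn (fun z => 2 * M * C * C' * (‖z‖ ^ (-(5 / 6) : ℝ) * cornerSum a b z) +
      |c| * (R * (C' * ‖z‖ ^ (-(1 / 2) : ℝ) + C' * R * M * cornerSum a b z) + 2 * (C' * R))) W :=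
    (hmul_int.const_mul _).add ((((((hhalf_int.const_mul _).add
      (hsum_int.const_mul _))).const_mul _).add (hconst_int _)).const_mul _)
  have hbound : ∀ n : ℕ, ∀ z ∈ W,
      ‖fluxDiv a b ((n : ℝ) + 1) c Φ f z - fluxDivSnd a b ((n : ℝ) + 1) Φ f z‖ ≤
      2 * M * C * C' * (‖z‖ ^ (-(5 / 6) : ℝ) * cornerSum a b z) +
      |c| * (R * (C' * ‖z‖ ^ (-(1 / 2) : ℝ) + C' * R * M * cornerSum a b z) + 2 * (C' * R)) :=
    fun n z hz => abs_fluxDiv_sub_le hR (by linarith [n.cast_nonneg (α := ℝ)]) (h.slit_subset hz)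
      (hzR z hz) (hΦC z hz) (hfC z hz) (hfC' z hz) (fun t => (hM t).1) (abs_nonneg _) (abs_nonneg _)
  have hmeas : ∀ n : ℕ, AEStronglyMeasurable (fun z =>
      fluxDiv a b ((n : ℝ) + 1) c Φ f z - fluxDivSnd a b ((n : ℝ) + 1) Φ f z)
      (volume.restrict W) := fun n =>
    ((hcont _).sub (hcontSnd _)).aestronglyMeasurable hWm
  have hfst : Tendsto (fun n : ℕ => ∫ z in W,
      (fluxDiv a b ((n : ℝ) + 1) c Φ f z - fluxDivSnd a b ((n : ℝ) + 1) Φ f z)) atTop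
      (𝓝 (∫ z in W, c * ((z * deriv f z).re + 2 * (f z).re))) := by
    refine tendsto_integral_of_dominated_convergence _ hmeas hK ?_
      (.of_forall fun z => tendsto_fluxDiv_sub z)
    intro n
    filter_upwards [ae_restrict_mem hWm] with z hz using hbound n z hz
  have hintDiff : ∀ n : ℕ, IntegrableOn (fun z =>
      fluxDiv a b ((n : ℝ) + 1) c Φ f z - fluxDivSnd a b ((n : ℝ) + 1) Φ f z) W := fun n => by
    refine Integrable.mono' hK (hmeas n) ?_
    filter_upwards [ae_restrict_mem hWm] with z hz using hbound n z hz
  -- For each `L` the whole divergence integrates to zero; letting `L → ∞` in the two parts leaves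
  -- `c` times the moment, and `c ≠ 0`.
  have hzero : ∀ n : ℕ, ∫ z in W, fluxDivSnd a b ((n : ℝ) + 1) Φ f z =
      -∫ z in W, (fluxDiv a b ((n : ℝ) + 1) c Φ f z - fluxDivSnd a b ((n : ℝ) + 1) Φ f z) := by
    intro n
    have hL : (0 : ℝ) < (n : ℝ) + 1 := by positivity
    have h0 := integral_fluxDiv_eq_zero h hΦ hf hL hc
    have hD : IntegrableOn (fluxDiv a b ((n : ℝ) + 1) c Φ f) W := by
      have hs := isSealedField_flux h hΦ hf hL hc
      exact (hs.integrableOn_div.mono_set sdiff_subset).congr_fun (fun z hz =>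
        planeDiv_flux isClosed_posAxis.isOpen_compl hf.differentiableOn hz.2 (h.slit_subset hz)
          (hΦ.harmonic z hz)) hWm
    have hS : IntegrableOn (fluxDivSnd a b ((n : ℝ) + 1) Φ f) W := by
      refine (hD.sub (hintDiff n)).congr (.of_forall fun z => ?_)
      simp
    rw [integral_sub hD hS, h0, zero_sub, neg_neg]
  have hlim : Tendsto (fun n : ℕ => ∫ z in W, fluxDivSnd a b ((n : ℝ) + 1) Φ f z) atTop
      (𝓝 (-∫ z in W, c * ((z * deriv f z).re + 2 * (f z).re))) :=
    hfst.neg.congr fun n => (hzero n).symm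
  have hfin := tendsto_nhds_unique hlim hsnd
  rw [integral_const_mul, neg_eq_zero, mul_eq_zero, setIntegral_sdiff_posAxis] at hfin
  exact hfin.resolve_left hc0.ne'

theorem IsTestFunction.integrableOn_re (h : IsRegion Ω a b γ) (hf : IsTestFunction p f) :
    IntegrableOn (fun z => (f z).re) Ω := by
  obtain ⟨R, hR, hRq⟩ := h.exists_radius
  obtain ⟨C, hC⟩ := hf.bound R
  rw [← integrableOn_sdiff_posAxis]
  refine IntegrableOn.of_bound ((measure_mono sdiff_subset).trans_lt h.isBounded.measure_lt_top) ?_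
    (|C| * R ^ (1 / 2 : ℝ)) ?_
  · refine ContinuousOn.aestronglyMeasurable (fun z hz => ?_) h.isOpen_slit.measurableSet
    exact (Complex.continuous_re.continuousAt.comp
      (hf.continuousAt hz.2).1).continuousWithinAt
  · filter_upwards [ae_restrict_mem h.isOpen_slit.measurableSet] with z hz
    have hzR : ‖z‖ ≤ R := by simpa using hRq z hz.1 0 (by simp [corners])
    refine (Complex.abs_re_le_norm _).trans ((hC z hz.2 hzR).1.trans ?_)
    gcongr
    exact le_abs_self C

end HeleShaw
end

/-! ### Powers and logarithms as test functions. -/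

noncomputable section

namespace HeleShaw

variable {p : ℝ} {z : ℂ}

theorem neg_mem_slitPlane (hz : z ∉ posAxis) : -z ∈ Complex.slitPlane := by
  rw [Complex.mem_slitPlane_iff]
  by_contra! hcon
  exact hz ⟨by simpa using hcon.1, by simpa using hcon.2⟩

theorem hasDerivAt_logBranch (hz : z ∉ posAxis) : HasDerivAt logBranch z⁻¹ z := by
  have h := ((hasDerivAt_neg z).clog (neg_mem_slitPlane hz)).add_const (Real.pi * Complex.I)
  exact h.congr_deriv (by rw [neg_div_neg_eq, one_div])

theorem exp_logBranch (hz : z ≠ 0) : Complex.exp (logBranch z) = z := by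
  rw [logBranch, Complex.exp_add, Complex.exp_log (neg_ne_zero.2 hz), Complex.exp_pi_mul_I]
  ring

theorem logBranch_re (z : ℂ) : (logBranch z).re = Real.log ‖z‖ := by
  simp [logBranch, Complex.log_re]

theorem norm_logBranch_le (z : ℂ) : ‖logBranch z‖ ≤ |Real.log ‖z‖| + 2 * Real.pi := by
  refine (Complex.norm_le_abs_re_add_abs_im _).trans ?_
  rw [logBranch_re]
  have h1 := Complex.neg_pi_lt_arg (-z)
  have h2 := Complex.arg_le_pi (-z)
  have h3 : (logBranch z).im = (-z).arg + Real.pi := by simp [logBranch, Complex.log_im]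
  have h4 : |(logBranch z).im| ≤ 2 * Real.pi := by
    rw [h3, abs_le]
    constructor <;> linarith
  linarith

theorem tendsto_neg_nhdsWithin {x : ℝ} {S T : Set ℂ} (h : ∀ z ∈ S, -z ∈ T) :
    Tendsto (fun z : ℂ => -z) (𝓝[S] (x : ℂ)) (𝓝[T] (-(x : ℂ))) :=
  tendsto_nhdsWithin_iff.2 ⟨(continuous_neg.tendsto _).mono_left nhdsWithin_le_nhds,
    eventually_mem_nhdsWithin.mono h⟩

/-- If `z` approaches from above, `-z` approaches the cut of `Complex.log` from below, where the
argument tends to `-π`; the added `πi` cancels it. From the lower side it doubles instead, giving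
`2πi`. -/
theorem tendsto_logBranch_upper {x : ℝ} (hx : 0 < x) :
    Tendsto logBranch (𝓝[upper] (x : ℂ)) (𝓝 (Real.log x : ℂ)) := by
  have h1 := Complex.tendsto_log_nhdsWithin_im_neg_of_re_neg_of_im_zero (z := -(x : ℂ))
    (by simpa using hx) (by simp)
  have h2 := (h1.comp (tendsto_neg_nhdsWithin (x := x) (S := upper) fun z hz => by
    simpa [upper] using hz)).add_const (Real.pi * Complex.I)
  have h3 : (Real.log ‖-(x : ℂ)‖ : ℂ) - Real.pi * Complex.I + Real.pi * Complex.I =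
      (Real.log x : ℂ) := by
    simp [abs_of_pos hx]
  rw [h3] at h2
  exact h2

theorem tendsto_logBranch_lower {x : ℝ} (hx : 0 < x) :
    Tendsto logBranch (𝓝[lower] (x : ℂ)) (𝓝 ((Real.log x : ℂ) + 2 * Real.pi * Complex.I)) := by
  have h1 := Complex.tendsto_log_nhdsWithin_im_nonneg_of_re_neg_of_im_zero (z := -(x : ℂ))
    (by simpa using hx) (by simp)
  have h2 := (h1.comp (tendsto_neg_nhdsWithin (x := x) (S := lower) fun z hz => by
    have : z.im < 0 := hz
    simpa using this.le)).add_const (Real.pi * Complex.I)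
  have h3 : (Real.log ‖-(x : ℂ)‖ : ℂ) + Real.pi * Complex.I + Real.pi * Complex.I =
      (Real.log x : ℂ) + 2 * Real.pi * Complex.I := by
    simp [abs_of_pos hx]
    ring
  rw [h3] at h2
  exact h2

theorem hasDerivAt_branchPow (s : ℝ) (hz : z ∉ posAxis) :
    HasDerivAt (fun z => branchPow z s) (s * z⁻¹ * branchPow z s) z := by
  have h := ((hasDerivAt_logBranch hz).const_mul (s : ℂ)).cexp
  exact h.congr_deriv (mul_comm _ _)

theorem norm_branchPow (s : ℝ) (hz : z ≠ 0) : ‖branchPow z s‖ = ‖z‖ ^ s := by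
  rw [branchPow, Complex.norm_exp, Complex.re_ofReal_mul, logBranch_re,
    Real.rpow_def_of_pos (norm_pos_iff.2 hz), mul_comm]

theorem ne_zero_of_notMem_posAxis (hz : z ∉ posAxis) : z ≠ 0 := by
  rintro rfl
  exact hz ⟨by simp, by simp⟩

theorem eventually_upper_notMem_posAxis (x : ℝ) : ∀ᶠ z in 𝓝[upper] (x : ℂ), z ∉ posAxis :=
  eventually_mem_nhdsWithin.mono fun _ hz => Set.disjoint_left.1 disjoint_upper_posAxis hz

theorem eventually_lower_notMem_posAxis (x : ℝ) : ∀ᶠ z in 𝓝[lower] (x : ℂ), z ∉ posAxis :=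
  eventually_mem_nhdsWithin.mono fun _ hz => Set.disjoint_left.1 disjoint_lower_posAxis hz

theorem tendsto_inv_nhdsWithin {x : ℝ} (hx : 0 < x) (S : Set ℂ) :
    Tendsto (fun z : ℂ => z⁻¹) (𝓝[S] (x : ℂ)) (𝓝 (x : ℂ)⁻¹) :=
  ((continuousAt_inv₀ (Complex.ofReal_ne_zero.2 hx.ne')).tendsto).mono_left nhdsWithin_le_nhds

/-- On the upper side `z ^ s` and its derivative are real; on the lower side the real part is `x ^ s
cos 2πs`. The growth bounds at the origin need `s ≥ 1/2`. -/
theorem isTestFunction_branchPow {s : ℝ} (hs : 1 / 2 ≤ s) (hcos : Real.cos (2 * Real.pi * s) = p) :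
    IsTestFunction p (fun z => branchPow z s) := by
  have hexp : ∀ {l : Filter ℂ} {w : ℂ}, Tendsto logBranch l (𝓝 w) →
      Tendsto (fun z => branchPow z s) l (𝓝 (Complex.exp (s * w))) := fun h =>
    (Complex.continuous_exp.tendsto _).comp (h.const_mul (s : ℂ))
  have hderiv : ∀ {z}, z ∉ posAxis →
      s * z⁻¹ * branchPow z s = deriv (fun z => branchPow z s) z := fun hz =>
    (hasDerivAt_branchPow s hz).deriv.symm
  refine ⟨fun z hz => (hasDerivAt_branchPow s hz).differentiableAt.differentiableWithinAt, ?_, ?_⟩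
  · intro x hx
    have hu := hexp (tendsto_logBranch_upper hx)
    have hl := hexp (tendsto_logBranch_lower hx)
    refine ⟨_, _, _, _, hu,
      ((((tendsto_inv_nhdsWithin hx upper).const_mul (s : ℂ)).mul hu).congr' <|
        (eventually_upper_notMem_posAxis x).mono fun z hz => hderiv hz), hl,
      ((((tendsto_inv_nhdsWithin hx lower).const_mul (s : ℂ)).mul hl).congr' <|
        (eventually_lower_notMem_posAxis x).mono fun z hz => hderiv hz), ?_, ?_⟩
    · rw [← Complex.ofReal_inv, ← Complex.ofReal_mul, ← Complex.ofReal_mul, ← Complex.ofReal_exp,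
        ← Complex.ofReal_mul, Complex.ofReal_im]
    · rw [Complex.exp_re, Complex.exp_re, ← hcos]
      simp
      rw [mul_comm s (2 * Real.pi)]
      ring
  · intro R
    -- The factor `1` serves the function and the factor `s` its derivative.
    refine ⟨max 1 s * (max R 0) ^ (s - 1 / 2), fun z hz hzR => ?_⟩
    have hz0 := ne_zero_of_notMem_posAxis hz
    have hpos : 0 < ‖z‖ := norm_pos_iff.2 hz0
    have hle : ‖z‖ ^ (s - 1 / 2) ≤ (max R 0) ^ (s - 1 / 2) :=
      Real.rpow_le_rpow hpos.le (hzR.trans (le_max_left _ _)) (by linarith)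
    constructor
    · rw [norm_branchPow s hz0]
      calc ‖z‖ ^ s = 1 * ‖z‖ ^ (s - 1 / 2) * ‖z‖ ^ (1 / 2 : ℝ) := by
            rw [one_mul, ← Real.rpow_add hpos]
            ring_nf
        _ ≤ _ := by
            gcongr
            exact le_max_left _ _
    · rw [← hderiv hz, norm_mul, norm_mul, norm_branchPow s hz0, Complex.norm_real, norm_inv,
        Real.norm_of_nonneg (by linarith)]
      calc s * ‖z‖⁻¹ * ‖z‖ ^ s = s * ‖z‖ ^ (s - 1 / 2) * ‖z‖ ^ (-(1 / 2) : ℝ) := by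
            rw [mul_assoc, mul_assoc, ← Real.rpow_neg_one, ← Real.rpow_add hpos,
              ← Real.rpow_add hpos]
            ring_nf
        _ ≤ _ := by
            gcongr
            exact le_max_right _ _

theorem rpow_half_mul_norm_logBranch_le {R : ℝ} (hz : z ≠ 0) (hzR : ‖z‖ ≤ R) :
    ‖z‖ ^ (1 / 2 : ℝ) * ‖logBranch z‖ ≤ 2 * (1 + R) + R ^ (1 / 2 : ℝ) * (2 * Real.pi) := by
  have hpos : 0 < ‖z‖ := norm_pos_iff.2 hz
  have h1 : Real.log ‖z‖ ≤ ‖z‖ ^ (1 / 2 : ℝ) / (1 / 2) :=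
    Real.log_le_rpow_div hpos.le (by norm_num)
  have h2 : Real.log ‖z‖⁻¹ ≤ ‖z‖⁻¹ ^ (1 / 2 : ℝ) / (1 / 2) :=
    Real.log_le_rpow_div (by positivity) (by norm_num)
  rw [Real.log_inv] at h2
  have h3 : |Real.log ‖z‖| ≤ 2 * (‖z‖⁻¹ ^ (1 / 2 : ℝ) + ‖z‖ ^ (1 / 2 : ℝ)) := by
    have : 0 ≤ ‖z‖⁻¹ ^ (1 / 2 : ℝ) := by positivity
    have : 0 ≤ ‖z‖ ^ (1 / 2 : ℝ) := by positivity
    rw [abs_le]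
    constructor <;> linarith
  have h4 : ‖z‖ ^ (1 / 2 : ℝ) * ‖z‖⁻¹ ^ (1 / 2 : ℝ) = 1 := by
    rw [← Real.mul_rpow hpos.le (by positivity), mul_inv_cancel₀ hpos.ne', Real.one_rpow]
  have h5 : ‖z‖ ^ (1 / 2 : ℝ) * ‖z‖ ^ (1 / 2 : ℝ) = ‖z‖ := by
    rw [← Real.rpow_add hpos]
    norm_num
  calc ‖z‖ ^ (1 / 2 : ℝ) * ‖logBranch z‖ ≤
      ‖z‖ ^ (1 / 2 : ℝ) * (2 * (‖z‖⁻¹ ^ (1 / 2 : ℝ) + ‖z‖ ^ (1 / 2 : ℝ)) + 2 * Real.pi) := by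
        gcongr
        exact (norm_logBranch_le z).trans (by linarith)
    _ = 2 * (‖z‖ ^ (1 / 2 : ℝ) * ‖z‖⁻¹ ^ (1 / 2 : ℝ) + ‖z‖ ^ (1 / 2 : ℝ) * ‖z‖ ^ (1 / 2 : ℝ)) +
        ‖z‖ ^ (1 / 2 : ℝ) * (2 * Real.pi) := by ring
    _ ≤ _ := by
        rw [h4, h5]
        have := Real.pi_pos
        gcongr

theorem hasDerivAt_pow_mul_logBranch (m : ℕ) (hz : z ∉ posAxis) :
    HasDerivAt (fun z => z ^ (m + 1) * logBranch z)
      (((m : ℂ) + 1) * z ^ m * logBranch z + z ^ m) z := by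
  refine ((hasDerivAt_pow (m + 1) z).fun_mul (hasDerivAt_logBranch hz)).congr_deriv ?_
  have hz0 := ne_zero_of_notMem_posAxis hz
  push_cast
  rw [pow_succ, mul_assoc _ z, mul_inv_cancel₀ hz0, mul_one]

/-- The two boundary values differ by `2πi x^(m+1)`, which is purely imaginary, so the real parts
agree: this is the condition for `p = 1`. The exponent `m + 1 ≥ 1` absorbs the logarithm in the
bounds. -/
theorem isTestFunction_pow_mul_logBranch (m : ℕ) :
    IsTestFunction 1 (fun z => z ^ (m + 1) * logBranch z) := by
  have hderiv : ∀ {z}, z ∉ posAxis → ((m : ℂ) + 1) * z ^ m * logBranch z + z ^ m =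
      deriv (fun z => z ^ (m + 1) * logBranch z) z := fun hz =>
    (hasDerivAt_pow_mul_logBranch m hz).deriv.symm
  have hpow : ∀ (k : ℕ) (S : Set ℂ) (x : ℝ), Tendsto (fun z : ℂ => z ^ k) (𝓝[S] (x : ℂ))
      (𝓝 ((x : ℂ) ^ k)) := fun k S x =>
    ((continuous_pow k).tendsto _).mono_left nhdsWithin_le_nhds
  refine ⟨fun z hz =>
    (hasDerivAt_pow_mul_logBranch m hz).differentiableAt.differentiableWithinAt, ?_, ?_⟩
  · intro x hx
    have hu := tendsto_logBranch_upper hx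
    have hl := tendsto_logBranch_lower hx
    refine ⟨_, _, _, _, (hpow (m + 1) _ x).mul hu,
      ((((hpow m upper x).const_mul ((m : ℂ) + 1)).mul hu).add (hpow m _ x)).congr'
        ((eventually_upper_notMem_posAxis x).mono fun z hz => hderiv hz), (hpow (m + 1) _ x).mul hl,
      ((((hpow m lower x).const_mul ((m : ℂ) + 1)).mul hl).add (hpow m _ x)).congr'
        ((eventually_lower_notMem_posAxis x).mono fun z hz => hderiv hz), ?_, ?_⟩
    · have : ((m : ℂ) + 1) * (x : ℂ) ^ m * (Real.log x : ℂ) + (x : ℂ) ^ m =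
          ((((m : ℝ) + 1) * x ^ m * Real.log x + x ^ m : ℝ) : ℂ) := by
        push_cast
        ring
      rw [this, Complex.ofReal_im]
    · rw [← Complex.ofReal_pow, Complex.re_ofReal_mul, Complex.re_ofReal_mul, one_mul]
      simp
  · intro R
    set B := 2 * (1 + R) + R ^ (1 / 2 : ℝ) * (2 * Real.pi) with hB
    refine ⟨((m : ℝ) + 1) * R ^ m * B + R ^ m * R ^ (1 / 2 : ℝ), fun z hz hzR => ?_⟩
    have hz0 := ne_zero_of_notMem_posAxis hz
    have hpos : 0 < ‖z‖ := norm_pos_iff.2 hz0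
    have hR : 0 < R := hpos.trans_le hzR
    have hπ := Real.pi_pos
    have hB0 : 0 ≤ B := by positivity
    have hlog := rpow_half_mul_norm_logBranch_le hz0 hzR
    have h5 : ‖z‖ ^ (1 / 2 : ℝ) * ‖z‖ ^ (1 / 2 : ℝ) = ‖z‖ := by
      rw [← Real.rpow_add hpos]
      norm_num
    have h6 : ‖z‖ ^ (1 / 2 : ℝ) * ‖z‖ ^ (-(1 / 2) : ℝ) = 1 := by
      rw [← Real.rpow_add hpos]
      norm_num
    constructor
    · rw [norm_mul, norm_pow, pow_succ]
      calc ‖z‖ ^ m * ‖z‖ * ‖logBranch z‖ =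
          ‖z‖ ^ m * (‖z‖ ^ (1 / 2 : ℝ) * ‖logBranch z‖) * ‖z‖ ^ (1 / 2 : ℝ) := by
            nth_rewrite 2 [← h5]
            ring
        _ ≤ R ^ m * B * ‖z‖ ^ (1 / 2 : ℝ) := by gcongr
        _ ≤ _ := by
            refine mul_le_mul_of_nonneg_right ?_ (by positivity)
            have h7 : 0 ≤ (m : ℝ) * (R ^ m * B) := by positivity
            have h8 : 0 ≤ R ^ m * R ^ (1 / 2 : ℝ) := by positivity
            linarith
    · rw [← hderiv hz]
      have hm : ‖(m : ℂ) + 1‖ = (m : ℝ) + 1 := by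
        have : (m : ℂ) + 1 = ((m + 1 : ℕ) : ℂ) := by push_cast; rfl
        rw [this, Complex.norm_natCast]
        push_cast
        rfl
      refine (norm_add_le _ _).trans ?_
      rw [norm_mul, norm_mul, norm_pow, hm]
      calc ((m : ℝ) + 1) * ‖z‖ ^ m * ‖logBranch z‖ + ‖z‖ ^ m =
          (((m : ℝ) + 1) * ‖z‖ ^ m * (‖z‖ ^ (1 / 2 : ℝ) * ‖logBranch z‖) +
            ‖z‖ ^ m * ‖z‖ ^ (1 / 2 : ℝ)) * ‖z‖ ^ (-(1 / 2) : ℝ) := by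
            linear_combination (-(((m : ℝ) + 1) * ‖z‖ ^ m * ‖logBranch z‖ + ‖z‖ ^ m)) * h6
        _ ≤ _ := by gcongr

variable {a b : ℝ} {Φ : ℂ → ℝ} {Ω : Set ℂ} {γ : ℝ → ℂ}

/-- `z ^ s` is homogeneous: `z f' = s f`, so the stationary moment is `s + 2 > 0` times the integral
sought. -/
theorem integral_branchPow_eq_zero (hp : 0 ≤ p) (h : IsRegion Ω a b γ)
    (hΦ : IsPotential p Ω a b γ Φ) (hH : IsHomothetic Ω γ Φ) {s : ℝ} (hs : 1 / 2 ≤ s)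
    (hcos : Real.cos (2 * Real.pi * s) = p) :
    IntegrableOn (fun z => (branchPow z s).re) Ω ∧ ∫ z in Ω, (branchPow z s).re = 0 := by
  have hf := isTestFunction_branchPow hs hcos
  refine ⟨hf.integrableOn_re h, ?_⟩
  have h0 := integral_test_eq_zero hp h hΦ hH hf
  have heq : ∀ z ∈ Ω \ posAxis, (z * deriv (fun z => branchPow z s) z).re +
      2 * (branchPow z s).re = (s + 2) * (branchPow z s).re := by
    intro z hz
    have hz0 := ne_zero_of_notMem_posAxis hz.2
    have : z * (s * z⁻¹ * branchPow z s) = s * branchPow z s := by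
      field_simp
    rw [(hasDerivAt_branchPow s hz.2).deriv, this, Complex.re_ofReal_mul]
    ring
  rw [← setIntegral_sdiff_posAxis, setIntegral_congr_fun h.isOpen_slit.measurableSet heq,
    integral_const_mul, setIntegral_sdiff_posAxis, mul_eq_zero] at h0
  exact h0.resolve_left (by linarith)

theorem branchPow_natCast (n : ℕ) (hz : z ≠ 0) : branchPow z n = z ^ n := by
  rw [branchPow, Complex.ofReal_natCast, Complex.exp_nat_mul, exp_logBranch hz]

theorem integral_pow_eq_zero (h : IsRegion Ω a b γ) (hΦ : IsPotential 1 Ω a b γ Φ)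
    (hH : IsHomothetic Ω γ Φ) {n : ℕ} (hn : 1 ≤ n) :
    IntegrableOn (fun z : ℂ => (z ^ n).re) Ω ∧ ∫ z in Ω, (z ^ n).re = 0 := by
  have hn' : (1 : ℝ) ≤ n := by exact_mod_cast hn
  have hcos : Real.cos (2 * Real.pi * n) = 1 := by
    rw [mul_comm]
    exact Real.cos_nat_mul_two_pi n
  have key := integral_branchPow_eq_zero zero_le_one h hΦ hH (s := n) (by linarith) hcos
  have heq : ∀ z ∈ Ω \ posAxis, (branchPow z n).re = (z ^ n).re := fun z hz => by
    rw [branchPow_natCast n (ne_zero_of_notMem_posAxis hz.2)]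
  constructor
  · rw [← integrableOn_sdiff_posAxis]
    exact (key.1.mono_set sdiff_subset).congr_fun heq h.isOpen_slit.measurableSet
  · rw [← setIntegral_sdiff_posAxis, ← setIntegral_congr_fun h.isOpen_slit.measurableSet heq,
      setIntegral_sdiff_posAxis]
    exact key.2

theorem integral_pow_mul_logBranch_eq_zero (h : IsRegion Ω a b γ) (hΦ : IsPotential 1 Ω a b γ Φ)
    (hH : IsHomothetic Ω γ Φ) {n : ℕ} (hn : 1 ≤ n) :
    IntegrableOn (fun z : ℂ => (z ^ n * logBranch z).re) Ω ∧
      ∫ z in Ω, (z ^ n * logBranch z).re = 0 := by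
  obtain ⟨m, rfl⟩ := Nat.exists_eq_add_of_le' hn
  have hf := isTestFunction_pow_mul_logBranch m
  have hint := hf.integrableOn_re h
  refine ⟨hint, ?_⟩
  have h0 := integral_test_eq_zero zero_le_one h hΦ hH hf
  obtain ⟨hpi, hp0⟩ := integral_pow_eq_zero h hΦ hH hn
  -- Homogeneity fails by the term `z ^ (m + 1)`, whose integral is already known to vanish.
  have heq : ∀ z ∈ Ω \ posAxis, (z * deriv (fun z => z ^ (m + 1) * logBranch z) z).re +
      2 * (z ^ (m + 1) * logBranch z).re =
      ((m : ℝ) + 3) * (z ^ (m + 1) * logBranch z).re + (z ^ (m + 1)).re := by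
    intro z hz
    have h1 : z * (((m : ℂ) + 1) * z ^ m * logBranch z + z ^ m) =
        (((m : ℝ) + 1 : ℝ) : ℂ) * (z ^ (m + 1) * logBranch z) + z ^ (m + 1) := by
      push_cast
      ring
    rw [(hasDerivAt_pow_mul_logBranch m hz.2).deriv, h1, Complex.add_re, Complex.re_ofReal_mul]
    ring
  rw [← setIntegral_sdiff_posAxis, setIntegral_congr_fun h.isOpen_slit.measurableSet heq,
    setIntegral_sdiff_posAxis, integral_add (hint.const_mul _) hpi, hp0, add_zero,
    integral_const_mul, mul_eq_zero] at h0
  exact h0.resolve_left (by positivity)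

theorem cos_alpha (hp : p ∈ Icc (0 : ℝ) 1) : Real.cos (2 * Real.pi * alpha p) = p := by
  have : 2 * Real.pi * alpha p = Real.arccos p := by
    rw [alpha]
    field_simp
  rw [this, Real.cos_arccos (by linarith [hp.1]) hp.2]

end HeleShaw
end

theorem proposition3 (p : ℝ) (hp : p ∈ Set.Icc (0 : ℝ) 1) (Ω : Set ℂ)
    (hΩ : HeleShaw.IsSolution p Ω) :
    ((0 ≤ HeleShaw.alpha p ∧ HeleShaw.alpha p ≤ 1 / 4) ∧
      ∀ n : ℕ, 1 ≤ n →
        (MeasureTheory.IntegrableOn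
            (fun z : ℂ => (HeleShaw.branchPow z (n + HeleShaw.alpha p)).re) Ω ∧
          ∫ z in Ω, (HeleShaw.branchPow z (n + HeleShaw.alpha p)).re = 0) ∧
        (MeasureTheory.IntegrableOn
            (fun z : ℂ => (HeleShaw.branchPow z (n - HeleShaw.alpha p)).re) Ω ∧
          ∫ z in Ω, (HeleShaw.branchPow z (n - HeleShaw.alpha p)).re = 0)) ∧
    (p = 1 → ∀ n : ℕ, 1 ≤ n →
        (MeasureTheory.IntegrableOn (fun z : ℂ => (z ^ n).re) Ω ∧
          ∫ z in Ω, (z ^ n).re = 0) ∧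
        (MeasureTheory.IntegrableOn (fun z : ℂ => (z ^ n * HeleShaw.logBranch z).re) Ω ∧
          ∫ z in Ω, (z ^ n * HeleShaw.logBranch z).re = 0)) := by
  obtain ⟨a, b, γ, Φ, h, hΦ, hH⟩ := hΩ
  have hα0 := HeleShaw.alpha_nonneg p
  have hα1 := HeleShaw.alpha_le hp.1
  have hcos := HeleShaw.cos_alpha hp
  refine ⟨⟨⟨hα0, hα1⟩, fun n hn => ?_⟩, ?_⟩
  · have hn' : (1 : ℝ) ≤ n := by exact_mod_cast hn
    -- Both exponents are at least `1 - 1/4`, hence at least `1/2`, and `cos 2π(n ± α) = cos 2πα =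
    -- p`.
    refine ⟨HeleShaw.integral_branchPow_eq_zero hp.1 h hΦ hH (by linarith) ?_,
      HeleShaw.integral_branchPow_eq_zero hp.1 h hΦ hH (by linarith) ?_⟩
    · rw [← Real.cos_add_nat_mul_two_pi _ n] at hcos
      exact (congrArg Real.cos (by ring)).trans hcos
    · rw [← Real.cos_nat_mul_two_pi_sub _ n] at hcos
      exact (congrArg Real.cos (by ring)).trans hcos
  · rintro rfl n hn
    exact ⟨HeleShaw.integral_pow_eq_zero h hΦ hH hn,
      HeleShaw.integral_pow_mul_logBranch_eq_zero h hΦ hH hn⟩
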